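/- Consider the Kolmogorov equation $u_t+xu_y=u_{xx}$ for $u=u(t,x,y)$. Let $u_{kl}$, $k,l\in\mathbb N_0$, stand for $\partial^{k+l}u/\partial x^k\partial y^l$, so that $(t,x,y,u_{kl})$ are coordinates on the manifold defined by the equation and its differential consequences in the infinite-order jet space over $\mathbb R^3_{t,x,y}\times\mathbb R_u$. A differential function is a (globally defined) real smooth function of $t,x,y$ and finitely many $u_{kl}$. On differential functions one has the total derivatives $$\mathrm D_t=\partial_t+\sum_{k,l}(u_{k+2,l}-xu_{k,l+1}-ku_{k-1,l+1})\partial_{u_{kl}},\quad \mathrm D_x=\partial_x+\sum_{k,l}u_{k+1,l}\partial_{u_{kl}},\quad \mathrm D_y=\partial_y+\sum_{k,l}u_{k,l+1}\partial_{u_{kl}}.$$ Put $\mathrm F=\mathrm D_t+x\mathrm D_y-\mathrm D_x^2$. Let $\Lambda$ be the space of linear generalized symmetries of the equation, i.e., of the vector fields $\eta\,\partial_u$ with $\mathrm F\eta=0$ and $\eta=\sum_{k+l\le n}\eta^{kl}(t,x,y)u_{kl}$ for some $n\in\mathbb N_0$ and some smooth $\eta^{kl}$. It is a real Lie algebra with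 the bracket $[\eta\,\partial_u,\zeta\,\partial_u]=\big(\mathrm{pr}(\eta\,\partial_u)\zeta-\mathrm{pr}(\zeta\,\partial_u)\eta\big)\partial_u$, where $\mathrm{pr}(\eta\,\partial_u)=\sum_{k,l}(\mathrm D_x^k\mathrm D_y^l\eta)\partial_{u_{kl}}$. Let $$\mathrm P^3=3t^2\mathrm D_x+t^3\mathrm D_y-3(y-tx),\quad \mathrm P^2=2t\mathrm D_x+t^2\mathrm D_y+x,\quad \mathrm P^1=\mathrm D_x+t\mathrm D_y,\quad \mathrm P^0=\mathrm D_y,$$ and let $\Upsilon_{\mathfrak r}$ be the unital associative algebra of operators generated by them. Let $\mathfrak r$ be the Lie algebra of vector fields spanned by $$\mathcal P^3=3t^2\partial_x+t^3\partial_y+3(y-tx)u\partial_u,\quad \mathcal P^2=2t\partial_x+t^2\partial_y-xu\partial_u,\quad \mathcal P^1=\partial_x+t\partial_y,\quad \mathcal P^0=\partial_y,\quad \mathcal I=u\partial_u,$$ let $\iota\colon\mathfrak r\to\mathfrak U(\mathfrak r)$ be the canonical map to its universal enveloping algebra, and let $(\iota(\mathcal I)+1)$ be the two-sided ideal generated by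 $\iota(\mathcal I)+1$. The second Weyl algebra $\mathrm W(2,\mathbb R)$ is the unital associative $\mathbb R$-algebra with generators $p_1,p_2,q_1,q_2$ and relations $p_ip_j=p_jp_i$, $q_iq_j=q_jq_i$, $p_iq_j-q_jp_i=\delta_{ij}$. For an associative algebra $A$, let $A^{(-)}$ denote $A$ with the commutator bracket. Then the following holds. 1. $\Lambda$ coincides with the span $\Lambda_{\mathfrak r}$ of the vector fields $\big((\mathrm P^3)^{i_3}(\mathrm P^2)^{i_2}(\mathrm P^1)^{i_1}(\mathrm P^0)^{i_0}u\big)\partial_u$, $i_0,i_1,i_2,i_3\in\mathbb N_0$. 2. The correspondence $(\mathrm Qu)\partial_u\mapsto\mathrm Q$, $\mathrm Q\in\Upsilon_{\mathfrak r}$, is a well-defined linear bijection $\varphi\colon\Lambda\to\Upsilon_{\mathfrak r}$ with $\varphi([a,b])=-[\varphi(a),\varphi(b)]$, i.e., an anti-isomorphism of the Lie algebras $\Lambda$ and $\Upsilon_{\mathfrak r}^{(-)}$. 3. There is an isomorphism of unital associative algebras $\mathfrak U(\mathfrak r)/(\iota(\mathcal I)+1)\to\Upsilon_{\mathfrak r}$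 that maps the class of $\iota(\mathcal P^j)$ to $\mathrm P^j$, $j=0,1,2,3$. Consequently, $\Lambda$ is anti-isomorphic, and also isomorphic, to the Lie algebra $\big(\mathfrak U(\mathfrak r)/(\iota(\mathcal I)+1)\big)^{(-)}$. 4. The Lie algebra $\Lambda$ is isomorphic to $\mathrm W(2,\mathbb R)^{(-)}$. 5. The center of $\Lambda$ is one-dimensional and spanned by $u\partial_u$, and the quotient of $\Lambda$ by its center is a simple Lie algebra. -/

import Mathlib

open scoped ContDiff

noncomputable section

namespace Kolmogorov

/-! ### Differential functions on the manifold defined by `u_t + x u_y = u_xx` in the jet space -/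

/-- The standard coordinates `t, x, y, u_{kl}` on the manifold defined by the equation
`u_t + x u_y = u_xx` and its differential consequences in the infinite-order jet space;
`u k l` is the jet variable `∂^{k+l} u / ∂x^k ∂y^l`. -/
inductive Coord : Type
  | t : Coord
  | x : Coord
  | y : Coord
  | u (k l : ℕ) : Coord
  deriving DecidableEq

/-- A point of that manifold, given by its coordinates. -/
abbrev Jet : Type := Coord → ℝ

/-- `f` is a smooth function of the coordinates in the finite set `S`. -/
def IsSmoothIn (S : Finset Coord) (f : Jet → ℝ) : Prop :=
  ∃ g : (S → ℝ) → ℝ, ContDiff ℝ ∞ g ∧ ∀ p : Jet, f p = g (fun i => p i)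

/-- The partial derivative of a function with respect to the coordinate `i`. -/
def pderiv (i : Coord) (f : Jet → ℝ) : Jet → ℝ :=
  fun p => deriv (fun s => f (Function.update p i s)) (p i)

theorem IsSmoothIn.mono {S T : Finset Coord} (h : S ⊆ T) {f : Jet → ℝ} (hf : IsSmoothIn S f) :
    IsSmoothIn T f := by
  obtain ⟨g, hg, hfg⟩ := hf
  refine ⟨fun q => g (fun i => q ⟨i, h i.2⟩), hg.comp ?_, fun p => hfg p⟩
  exact contDiff_pi.2 fun i => contDiff_apply ℝ ℝ _

theorem IsSmoothIn.add {S : Finset Coord} {f g : Jet → ℝ} (hf : IsSmoothIn S f)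
    (hg : IsSmoothIn S g) : IsSmoothIn S (f + g) := by
  obtain ⟨a, ha, hfa⟩ := hf
  obtain ⟨b, hb, hgb⟩ := hg
  exact ⟨a + b, ha.add hb, fun p => by simp [hfa, hgb]⟩

theorem IsSmoothIn.mul {S : Finset Coord} {f g : Jet → ℝ} (hf : IsSmoothIn S f)
    (hg : IsSmoothIn S g) : IsSmoothIn S (f * g) := by
  obtain ⟨a, ha, hfa⟩ := hf
  obtain ⟨b, hb, hgb⟩ := hg
  exact ⟨a * b, ha.mul hb, fun p => by simp [hfa, hgb]⟩

theorem isSmoothIn_const (S : Finset Coord) (c : ℝ) : IsSmoothIn S (fun _ => c) :=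
  ⟨fun _ => c, contDiff_const, fun _ => rfl⟩

theorem isSmoothIn_coord {S : Finset Coord} {i : Coord} (hi : i ∈ S) :
    IsSmoothIn S (fun p => p i) :=
  ⟨fun q => q ⟨i, hi⟩, contDiff_apply ℝ ℝ _, fun _ => rfl⟩

theorem restrict_update (S : Finset Coord) (p : Jet) {i : Coord} (hi : i ∈ S) (s : ℝ) :
    (fun j : S => Function.update p i s j) =
      Function.update (fun j : S => p j) ⟨i, hi⟩ s := by
  funext j
  by_cases h : (j : Coord) = i
  · have : j = ⟨i, hi⟩ := Subtype.ext h
    subst this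
    simp
  · have : j ≠ ⟨i, hi⟩ := fun h' => h (congrArg Subtype.val h')
    simp [h, this]

theorem hasDerivAt_of_mem {S : Finset Coord} {f : Jet → ℝ} {g : (S → ℝ) → ℝ}
    (hg : ContDiff ℝ ∞ g) (hfg : ∀ p : Jet, f p = g (fun i => p i)) {i : Coord} (hi : i ∈ S)
    (p : Jet) :
    HasDerivAt (fun s => f (Function.update p i s))
      (fderiv ℝ g (fun j : S => p j) (Pi.single ⟨i, hi⟩ 1)) (p i) := by
  have h1 : (fun s => f (Function.update p i s)) =
      fun s => g (Function.update (fun j : S => p j) ⟨i, hi⟩ s) := by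
    funext s
    rw [hfg, restrict_update S p hi]
  rw [h1]
  have h2 : HasDerivAt (Function.update (fun j : S => p j) ⟨i, hi⟩)
      (Pi.single (⟨i, hi⟩ : S) (1 : ℝ)) (p i) := hasDerivAt_update _ _ _
  have h3 : Function.update (fun j : S => p j) ⟨i, hi⟩ (p i) = fun j : S => p j :=
    Function.update_eq_self (⟨i, hi⟩ : S) (fun j : S => p j)
  have h4 : HasFDerivAt g (fderiv ℝ g (fun j : S => p j))
      (Function.update (fun j : S => p j) ⟨i, hi⟩ (p i)) := by
    rw [h3]
    exact ((hg.differentiable (by simp)) _).hasFDerivAt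
  exact h4.comp_hasDerivAt (p i) h2

theorem pderiv_of_notMem {S : Finset Coord} {f : Jet → ℝ} (hf : IsSmoothIn S f) {i : Coord}
    (hi : i ∉ S) : pderiv i f = 0 := by
  obtain ⟨g, hg, hfg⟩ := hf
  funext p
  have : (fun s => f (Function.update p i s)) = fun _ => f p := by
    funext s
    rw [hfg, hfg]
    congr 1
    funext j
    have : (j : Coord) ≠ i := fun h => hi (h ▸ j.2)
    simp [this]
  simp [pderiv, this]

theorem pderiv_eq {S : Finset Coord} {f : Jet → ℝ} {g : (S → ℝ) → ℝ}
    (hg : ContDiff ℝ ∞ g) (hfg : ∀ p : Jet, f p = g (fun i => p i)) {i : Coord} (hi : i ∈ S)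
    (p : Jet) : pderiv i f p = fderiv ℝ g (fun j : S => p j) (Pi.single ⟨i, hi⟩ 1) :=
  (hasDerivAt_of_mem hg hfg hi p).deriv

theorem IsSmoothIn.differentiableAt {S : Finset Coord} {f : Jet → ℝ} (hf : IsSmoothIn S f)
    (i : Coord) (p : Jet) : DifferentiableAt ℝ (fun s => f (Function.update p i s)) (p i) := by
  obtain ⟨g, hg, hfg⟩ := hf.mono (Finset.subset_insert i S)
  exact (hasDerivAt_of_mem hg hfg (Finset.mem_insert_self i S) p).differentiableAt

theorem contDiff_fderiv_single {S : Finset Coord} {g : (S → ℝ) → ℝ} (hg : ContDiff ℝ ∞ g)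
    (v : S → ℝ) : ContDiff ℝ ∞ (fun q => fderiv ℝ g q v) :=
  (hg.fderiv_right (m := ∞) (by simp)).clm_apply contDiff_const

theorem IsSmoothIn.pderiv {S : Finset Coord} {f : Jet → ℝ} (hf : IsSmoothIn S f) (i : Coord) :
    IsSmoothIn S (pderiv i f) := by
  by_cases hi : i ∈ S
  · obtain ⟨g, hg, hfg⟩ := hf
    exact ⟨_, contDiff_fderiv_single hg (Pi.single ⟨i, hi⟩ 1), fun p => pderiv_eq hg hfg hi p⟩
  · rw [pderiv_of_notMem hf hi]
    exact isSmoothIn_const S 0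

theorem pderiv_comm {S : Finset Coord} {f : Jet → ℝ} (hf : IsSmoothIn S f) (i j : Coord) :
    Kolmogorov.pderiv i (Kolmogorov.pderiv j f) =
      Kolmogorov.pderiv j (Kolmogorov.pderiv i f) := by
  obtain ⟨g, hg, hfg⟩ :=
    hf.mono (show S ⊆ insert i (insert j S) from fun a ha => by simp [ha])
  have hi : i ∈ insert i (insert j S) := by simp
  have hj : j ∈ insert i (insert j S) := by simp
  funext p
  have key : ∀ v w : (insert i (insert j S) : Finset Coord) → ℝ, ∀ q,
      fderiv ℝ (fun q => fderiv ℝ g q v) q w = fderiv ℝ (fderiv ℝ g) q w v := by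
    intro v w q
    have hd : DifferentiableAt ℝ (fderiv ℝ g) q :=
      ((hg.fderiv_right (m := ∞) (by simp)).differentiable (by simp)) q
    rw [fderiv_clm_apply hd (differentiableAt_const v)]
    simp
  rw [pderiv_eq (contDiff_fderiv_single hg _) (fun p => pderiv_eq hg hfg hj p) hi,
    pderiv_eq (contDiff_fderiv_single hg _) (fun p => pderiv_eq hg hfg hi p) hj, key, key]
  have hs : IsSymmSndFDerivAt ℝ g (fun k : (insert i (insert j S) : Finset Coord) => p k) :=
    (hg.contDiffAt).isSymmSndFDerivAt (by
      rw [minSmoothness_of_isRCLikeNormedField]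
      exact WithTop.coe_le_coe.2 le_top)
  exact hs.eq _ _

theorem pderiv_add {S : Finset Coord} {f g : Jet → ℝ} (hf : IsSmoothIn S f)
    (hg : IsSmoothIn S g) (i : Coord) :
    Kolmogorov.pderiv i (f + g) = Kolmogorov.pderiv i f + Kolmogorov.pderiv i g := by
  funext p
  exact deriv_add (hf.differentiableAt i p) (hg.differentiableAt i p)

theorem pderiv_mul {S : Finset Coord} {f g : Jet → ℝ} (hf : IsSmoothIn S f)
    (hg : IsSmoothIn S g) (i : Coord) :
    Kolmogorov.pderiv i (f * g) = f * Kolmogorov.pderiv i g + g * Kolmogorov.pderiv i f := by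
  funext p
  have h := deriv_mul (hf.differentiableAt i p) (hg.differentiableAt i p)
  simp only [Function.update_eq_self] at h
  simp only [Kolmogorov.pderiv, Pi.add_apply, Pi.mul_apply]
  rw [show (fun s => f (Function.update p i s) * g (Function.update p i s)) =
    (fun s => f (Function.update p i s)) * (fun s => g (Function.update p i s)) from rfl, h]
  ring

/-- The algebra of differential functions, as a subalgebra of the algebra of all functions. -/
def diffFunctions : Subalgebra ℝ (Jet → ℝ) where
  carrier := {f | ∃ S : Finset Coord, IsSmoothIn S f}
  mul_mem' := by
    rintro f g ⟨S, hf⟩ ⟨T, hg⟩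
    exact ⟨S ∪ T, (hf.mono Finset.subset_union_left).mul (hg.mono Finset.subset_union_right)⟩
  add_mem' := by
    rintro f g ⟨S, hf⟩ ⟨T, hg⟩
    exact ⟨S ∪ T, (hf.mono Finset.subset_union_left).add (hg.mono Finset.subset_union_right)⟩
  algebraMap_mem' c := ⟨∅, isSmoothIn_const ∅ c⟩

/-- Differential functions: smooth functions of `t`, `x`, `y` and finitely many `u_{kl}`. -/
def DiffFun : Type := diffFunctions

instance : CommRing DiffFun := inferInstanceAs (CommRing diffFunctions)

instance : Algebra ℝ DiffFun := inferInstanceAs (Algebra ℝ diffFunctions)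

/-- A differential function, as a function on the jet manifold. -/
instance : CoeOut DiffFun (Jet → ℝ) := ⟨fun f => Subtype.val (p := (· ∈ diffFunctions)) f⟩

/-- A coordinate as a differential function. -/
def coord (i : Coord) : DiffFun :=
  ⟨fun p => p i, {i}, isSmoothIn_coord (Finset.mem_singleton_self i)⟩

theorem exists_common (f g : DiffFun) :
    ∃ S : Finset Coord, IsSmoothIn S (f : Jet → ℝ) ∧ IsSmoothIn S (g : Jet → ℝ) := by
  obtain ⟨S, hf⟩ := f.2
  obtain ⟨T, hg⟩ := g.2
  exact ⟨S ∪ T, hf.mono Finset.subset_union_left, hg.mono Finset.subset_union_right⟩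

/-- The partial derivative `∂/∂i` as a derivation of the algebra of differential functions. -/
def partialD (i : Coord) : Derivation ℝ DiffFun DiffFun :=
  Derivation.mk'
    { toFun := fun f => ⟨pderiv i f, f.2.imp fun _ h => h.pderiv i⟩
      map_add' := fun f g => by
        obtain ⟨S, hf, hg⟩ := exists_common f g
        exact Subtype.ext (pderiv_add hf hg i)
      map_smul' := fun c f => by
        apply Subtype.ext
        funext p
        exact deriv_const_mul_field c }
    (fun f g => by
      obtain ⟨S, hf, hg⟩ := exists_common f g
      exact Subtype.ext (pderiv_mul hf hg i))

theorem coe_partialD (i : Coord) (f : DiffFun) :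
    ((partialD i f : DiffFun) : Jet → ℝ) = pderiv i f := rfl

theorem partialD_of_notMem {S : Finset Coord} {f : DiffFun} (hf : IsSmoothIn S (f : Jet → ℝ))
    {i : Coord} (hi : i ∉ S) : partialD i f = 0 :=
  Subtype.ext (pderiv_of_notMem hf hi)

theorem partialD_comm (i j : Coord) (f : DiffFun) :
    partialD i (partialD j f) = partialD j (partialD i f) :=
  Subtype.ext (pderiv_comm f.2.choose_spec i j)

theorem partialD_coord (i j : Coord) : partialD i (coord j) = if i = j then 1 else 0 := by
  apply Subtype.ext
  funext p
  rw [coe_partialD]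
  by_cases h : i = j
  · subst h
    simp [pderiv, coord]
    rfl
  · simp [pderiv, coord, h, Function.update_of_ne (Ne.symm h)]
    rfl

theorem support_field_finite (a : Coord → DiffFun) {S : Finset Coord} {f : DiffFun}
    (hf : IsSmoothIn S (f : Jet → ℝ)) :
    (Function.support fun i => a i * partialD i f) ⊆ S := by
  intro i hi
  by_contra h
  exact hi (by simp [partialD_of_notMem hf h])

theorem finsum_field (a : Coord → DiffFun) {S : Finset Coord} {f : DiffFun}
    (hf : IsSmoothIn S (f : Jet → ℝ)) :
    ∑ᶠ i, a i * partialD i f = ∑ i ∈ S, a i * partialD i f :=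
  finsum_eq_sum_of_support_subset _ (support_field_finite a hf)

/-- The vector field `∑_i a_i ∂/∂i` on the jet manifold with coefficients `a_i`, as a derivation
of the algebra of differential functions; the sum over all coordinates `i` is finite on each
differential function. -/
def field (a : Coord → DiffFun) : Derivation ℝ DiffFun DiffFun :=
  Derivation.mk'
    { toFun := fun f => ∑ᶠ i, a i * partialD i f
      map_add' := fun f g => by
        obtain ⟨S, hf, hg⟩ := exists_common f g
        have hfg : IsSmoothIn S ((f + g : DiffFun) : Jet → ℝ) := hf.add hg
        rw [finsum_field a hf, finsum_field a hg, finsum_field a hfg, ← Finset.sum_add_distrib]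
        exact Finset.sum_congr rfl fun i _ => by rw [map_add, mul_add]
      map_smul' := fun c f => by
        obtain ⟨S, hf⟩ := f.2
        have hcf : IsSmoothIn S ((c • f : DiffFun) : Jet → ℝ) :=
          (isSmoothIn_const S c).mul hf
        rw [finsum_field a hf, finsum_field a hcf, RingHom.id_apply, Finset.smul_sum]
        exact Finset.sum_congr rfl fun i _ => by rw [Derivation.map_smul, mul_smul_comm] }
    (fun f g => by
      obtain ⟨S, hf, hg⟩ := exists_common f g
      have hfg : IsSmoothIn S ((f * g : DiffFun) : Jet → ℝ) := hf.mul hg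
      simp only [LinearMap.coe_mk, AddHom.coe_mk]
      rw [finsum_field a hf, finsum_field a hg, finsum_field a hfg, smul_eq_mul, smul_eq_mul,
        Finset.mul_sum, Finset.mul_sum, ← Finset.sum_add_distrib]
      refine Finset.sum_congr rfl fun i _ => ?_
      rw [Derivation.leibniz, smul_eq_mul, smul_eq_mul]
      ring)

theorem field_apply (a : Coord → DiffFun) (f : DiffFun) :
    field a f = ∑ᶠ i, a i * partialD i f := rfl

theorem field_eq_sum (a : Coord → DiffFun) {S : Finset Coord} {f : DiffFun}
    (hf : IsSmoothIn S (f : Jet → ℝ)) : field a f = ∑ i ∈ S, a i * partialD i f :=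
  finsum_field a hf

theorem field_coord (a : Coord → DiffFun) (i : Coord) : field a (coord i) = a i := by
  rw [field_eq_sum a (S := {i}) (isSmoothIn_coord (Finset.mem_singleton_self i))]
  simp [partialD_coord]

theorem field_ext {a b : Coord → DiffFun} (h : ∀ i, a i = b i) (f : DiffFun) :
    field a f = field b f := by
  rw [funext h]

theorem field_zero {a : Coord → DiffFun} (h : ∀ i, a i = 0) (f : DiffFun) : field a f = 0 := by
  rw [field_apply]
  simp [h]

theorem field_comm (a b : Coord → DiffFun) (f : DiffFun) :
    field a (field b f) - field b (field a f) =
      field (fun i => field a (b i) - field b (a i)) f := by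
  obtain ⟨S, hf⟩ := f.2
  have hp : ∀ i, IsSmoothIn S ((partialD i f : DiffFun) : Jet → ℝ) := fun i => hf.pderiv i
  have expand : ∀ a b : Coord → DiffFun, field a (field b f) =
      (∑ j ∈ S, field a (b j) * partialD j f) +
        ∑ j ∈ S, ∑ i ∈ S, b j * a i * partialD i (partialD j f) := by
    intro a b
    rw [field_eq_sum b hf, map_sum, ← Finset.sum_add_distrib]
    refine Finset.sum_congr rfl fun j _ => ?_
    rw [Derivation.leibniz, smul_eq_mul, smul_eq_mul, field_eq_sum a (hp j), Finset.mul_sum,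
      add_comm, mul_comm]
    congr 1
    exact Finset.sum_congr rfl fun i _ => by ring
  rw [expand, expand, field_eq_sum _ hf]
  have swap : ∑ j ∈ S, ∑ i ∈ S, b j * a i * partialD i (partialD j f) =
      ∑ j ∈ S, ∑ i ∈ S, a j * b i * partialD i (partialD j f) := by
    rw [Finset.sum_comm]
    refine Finset.sum_congr rfl fun j _ => Finset.sum_congr rfl fun i _ => ?_
    rw [partialD_comm, mul_comm (b i)]
  rw [swap, add_sub_add_right_eq_sub, ← Finset.sum_sub_distrib]
  exact Finset.sum_congr rfl fun i _ => by ring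

/-! ### Total derivatives, evolutionary vector fields and their Lie bracket -/

/-- The restricted total derivative
`D_t = ∂_t + ∑ (u_{k+2,l} - x u_{k,l+1} - k u_{k-1,l+1}) ∂_{u_{kl}}`. -/
def Dt : Derivation ℝ DiffFun DiffFun :=
  field fun
    | .t => 1
    | .x => 0
    | .y => 0
    | .u k l => coord (.u (k + 2) l) - coord .x * coord (.u k (l + 1))
        - (k : DiffFun) * coord (.u (k - 1) (l + 1))

/-- The total derivative `D_x = ∂_x + ∑ u_{k+1,l} ∂_{u_{kl}}`. -/
def Dx : Derivation ℝ DiffFun DiffFun :=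
  field fun
    | .t => 0
    | .x => 1
    | .y => 0
    | .u k l => coord (.u (k + 1) l)

/-- The total derivative `D_y = ∂_y + ∑ u_{k,l+1} ∂_{u_{kl}}`. -/
def Dy : Derivation ℝ DiffFun DiffFun :=
  field fun
    | .t => 0
    | .x => 0
    | .y => 1
    | .u k l => coord (.u k (l + 1))

/-- The operator `F = D_t + x D_y - D_x ^ 2`. -/
def opF (η : DiffFun) : DiffFun := Dt η + coord .x * Dy η - Dx (Dx η)

/-- The prolongation `∑ (D_x ^ k D_y ^ l η) ∂_{u_{kl}}` of the generalized vector field `η ∂_u`. -/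
def prolong (η : DiffFun) : Derivation ℝ DiffFun DiffFun :=
  field fun
    | .t => 0
    | .x => 0
    | .y => 0
    | .u k l => (⇑Dx)^[k] ((⇑Dy)^[l] η)

theorem Dx_Dy (f : DiffFun) : Dx (Dy f) = Dy (Dx f) := by
  rw [← sub_eq_zero, Dx, Dy, field_comm]
  refine field_zero (fun i => ?_) f
  cases i <;> simp [field_coord]

theorem Dt_Dx (f : DiffFun) : Dt (Dx f) = Dx (Dt f) := by
  rw [← sub_eq_zero, Dt, Dx, field_comm]
  refine field_zero (fun i => ?_) f
  cases i with
  | u k l =>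
    rcases k with _ | k
    · simp [field_coord, Derivation.leibniz]
      ring
    · simp [field_coord, Derivation.leibniz]
      ring
  | _ => simp

theorem Dt_Dy (f : DiffFun) : Dt (Dy f) = Dy (Dt f) := by
  rw [← sub_eq_zero, Dt, Dy, field_comm]
  refine field_zero (fun i => ?_) f
  cases i with
  | u k l => simp [field_coord, Derivation.leibniz]
  | _ => simp

theorem iter_Dy_Dx (k : ℕ) (f : DiffFun) : Dy ((⇑Dx)^[k] f) = (⇑Dx)^[k] (Dy f) := by
  induction k generalizing f with
  | zero => rfl
  | succ k ih => rw [Function.iterate_succ_apply, ih, Function.iterate_succ_apply, Dx_Dy]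

theorem iter_Dt_Dx (k : ℕ) (f : DiffFun) : Dt ((⇑Dx)^[k] f) = (⇑Dx)^[k] (Dt f) := by
  induction k generalizing f with
  | zero => rfl
  | succ k ih => rw [Function.iterate_succ_apply, ih, Function.iterate_succ_apply, Dt_Dx]

theorem iter_Dt_Dy (k : ℕ) (f : DiffFun) : Dt ((⇑Dy)^[k] f) = (⇑Dy)^[k] (Dt f) := by
  induction k generalizing f with
  | zero => rfl
  | succ k ih => rw [Function.iterate_succ_apply, ih, Function.iterate_succ_apply, Dt_Dy]

theorem iter_Dx_sub (k : ℕ) (f g : DiffFun) :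
    (⇑Dx)^[k] (f - g) = (⇑Dx)^[k] f - (⇑Dx)^[k] g := by
  induction k generalizing f g with
  | zero => rfl
  | succ k ih => simp only [Function.iterate_succ_apply, map_sub, ih]

theorem iter_Dy_sub (k : ℕ) (f g : DiffFun) :
    (⇑Dy)^[k] (f - g) = (⇑Dy)^[k] f - (⇑Dy)^[k] g := by
  induction k generalizing f g with
  | zero => rfl
  | succ k ih => simp only [Function.iterate_succ_apply, map_sub, ih]

theorem iter_Dx_add (k : ℕ) (f g : DiffFun) :
    (⇑Dx)^[k] (f + g) = (⇑Dx)^[k] f + (⇑Dx)^[k] g := by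
  induction k generalizing f g with
  | zero => rfl
  | succ k ih => simp only [Function.iterate_succ_apply, map_add, ih]

theorem iter_Dy_add (k : ℕ) (f g : DiffFun) :
    (⇑Dy)^[k] (f + g) = (⇑Dy)^[k] f + (⇑Dy)^[k] g := by
  induction k generalizing f g with
  | zero => rfl
  | succ k ih => simp only [Function.iterate_succ_apply, map_add, ih]

theorem iter_Dx_smul (k : ℕ) (c : ℝ) (f : DiffFun) :
    (⇑Dx)^[k] (c • f) = c • (⇑Dx)^[k] f := by
  induction k generalizing f with
  | zero => rfl
  | succ k ih => simp only [Function.iterate_succ_apply, Derivation.map_smul, ih]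

theorem iter_Dy_smul (k : ℕ) (c : ℝ) (f : DiffFun) :
    (⇑Dy)^[k] (c • f) = c • (⇑Dy)^[k] f := by
  induction k generalizing f with
  | zero => rfl
  | succ k ih => simp only [Function.iterate_succ_apply, Derivation.map_smul, ih]

theorem iter_Dx_zero (k : ℕ) : (⇑Dx)^[k] (0 : DiffFun) = 0 :=
  Function.iterate_fixed (map_zero Dx) k

theorem iter_Dy_zero (k : ℕ) : (⇑Dy)^[k] (0 : DiffFun) = 0 :=
  Function.iterate_fixed (map_zero Dy) k

theorem Dx_x_mul (f : DiffFun) : Dx (coord .x * f) = coord .x * Dx f + f := by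
  rw [Derivation.leibniz, smul_eq_mul, smul_eq_mul]
  congr 1
  rw [Dx, field_coord, mul_one]

theorem Dy_x_mul (f : DiffFun) : Dy (coord .x * f) = coord .x * Dy f := by
  rw [Derivation.leibniz, smul_eq_mul, smul_eq_mul]
  conv_rhs => rw [← add_zero (coord .x * Dy f)]
  congr 1
  rw [Dy, field_coord, mul_zero]

theorem iter_Dy_x_mul (l : ℕ) (f : DiffFun) :
    (⇑Dy)^[l] (coord .x * f) = coord .x * (⇑Dy)^[l] f := by
  induction l generalizing f with
  | zero => rfl
  | succ l ih => rw [Function.iterate_succ_apply, Dy_x_mul, ih, Function.iterate_succ_apply]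

theorem iter_Dx_x_mul (k : ℕ) (f : DiffFun) :
    (⇑Dx)^[k] (coord .x * f) = coord .x * (⇑Dx)^[k] f + (k : DiffFun) * (⇑Dx)^[k - 1] f := by
  induction k generalizing f with
  | zero => simp
  | succ k ih =>
    rw [Function.iterate_succ_apply, Dx_x_mul, iter_Dx_add, ih, Function.iterate_succ_apply]
    rcases k with _ | k
    · simp
    · simp only [Nat.add_sub_cancel, Function.iterate_succ_apply]
      push_cast
      ring

theorem prolong_coord_u (η : DiffFun) (k l : ℕ) :
    prolong η (coord (.u k l)) = (⇑Dx)^[k] ((⇑Dy)^[l] η) := by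
  rw [prolong, field_coord]

theorem prolong_coord_x (η : DiffFun) : prolong η (coord .x) = 0 := by
  rw [prolong, field_coord]

theorem Dx_prolong (η f : DiffFun) : Dx (prolong η f) = prolong η (Dx f) := by
  rw [← sub_eq_zero]
  conv_lhs => rw [Dx, prolong, field_comm]
  refine field_zero (fun i => ?_) f
  cases i with
  | u k l =>
    rw [← Dx, ← prolong]
    simp only
    rw [prolong_coord_u, ← Function.iterate_succ_apply' (⇑Dx), sub_self]
  | _ => simp

theorem Dy_prolong (η f : DiffFun) : Dy (prolong η f) = prolong η (Dy f) := by
  rw [← sub_eq_zero]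
  conv_lhs => rw [Dy, prolong, field_comm]
  refine field_zero (fun i => ?_) f
  cases i with
  | u k l =>
    rw [← Dy, ← prolong]
    simp only
    rw [prolong_coord_u, iter_Dy_Dx, ← Function.iterate_succ_apply' (⇑Dy), sub_self]
  | _ => simp

theorem iter_prolong (k l : ℕ) (η f : DiffFun) :
    (⇑Dx)^[k] ((⇑Dy)^[l] (prolong η f)) = prolong η ((⇑Dx)^[k] ((⇑Dy)^[l] f)) := by
  have h1 : ∀ (l : ℕ) (f : DiffFun),
      (⇑Dy)^[l] (prolong η f) = prolong η ((⇑Dy)^[l] f) := by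
    intro l
    induction l with
    | zero => intro f; rfl
    | succ l ih => intro f; rw [Function.iterate_succ_apply, Dy_prolong, ih,
        Function.iterate_succ_apply]
  have h2 : ∀ (k : ℕ) (f : DiffFun),
      (⇑Dx)^[k] (prolong η f) = prolong η ((⇑Dx)^[k] f) := by
    intro k
    induction k with
    | zero => intro f; rfl
    | succ k ih => intro f; rw [Function.iterate_succ_apply, Dx_prolong, ih,
        Function.iterate_succ_apply]
  rw [h1, h2]

theorem prolong_add (η ζ f : DiffFun) : prolong (η + ζ) f = prolong η f + prolong ζ f := by
  obtain ⟨S, hf⟩ := f.2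
  rw [prolong, prolong, prolong, field_eq_sum _ hf, field_eq_sum _ hf, field_eq_sum _ hf,
    ← Finset.sum_add_distrib]
  refine Finset.sum_congr rfl fun i _ => ?_
  cases i with
  | u k l => simp only [iter_Dx_add, iter_Dy_add, add_mul]
  | _ => simp

theorem prolong_smul (c : ℝ) (η f : DiffFun) : prolong (c • η) f = c • prolong η f := by
  obtain ⟨S, hf⟩ := f.2
  rw [prolong, prolong, field_eq_sum _ hf, field_eq_sum _ hf, Finset.smul_sum]
  refine Finset.sum_congr rfl fun i _ => ?_
  cases i <;> simp [iter_Dx_smul, iter_Dy_smul]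

theorem prolong_comm (η ζ f : DiffFun) :
    prolong η (prolong ζ f) - prolong ζ (prolong η f) =
      prolong (prolong η ζ - prolong ζ η) f := by
  conv_lhs => rw [prolong, prolong, field_comm, ← prolong, ← prolong]
  conv_rhs => rw [prolong]
  refine field_ext (fun i => ?_) f
  cases i with
  | u k l => simp only [iter_Dy_sub, iter_Dx_sub, iter_prolong]
  | _ => simp

theorem Dt_prolong {η : DiffFun} (hη : opF η = 0) (f : DiffFun) :
    Dt (prolong η f) = prolong η (Dt f) := by
  rw [← sub_eq_zero]
  conv_lhs => rw [Dt, prolong, field_comm]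
  refine field_zero (fun i => ?_) f
  cases i with
  | u k l =>
    rw [← Dt, ← prolong]
    simp only
    rw [map_sub, map_sub, Derivation.leibniz, Derivation.leibniz, prolong_coord_u,
      prolong_coord_u, prolong_coord_u, prolong_coord_x, iter_Dt_Dx, iter_Dt_Dy]
    have h : Dt η = Dx (Dx η) - coord .x * Dy η := by
      rw [opF] at hη
      linear_combination hη
    have hxx : ∀ g, (⇑Dy)^[l] (Dx g) = Dx ((⇑Dy)^[l] g) := by
      intro g
      induction l generalizing g with
      | zero => rfl
      | succ l ih => rw [Function.iterate_succ_apply, ← Dx_Dy, ih, Function.iterate_succ_apply]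
    rw [h, iter_Dy_sub, iter_Dx_sub, iter_Dy_x_mul, iter_Dx_x_mul, hxx, hxx]
    simp only [Function.iterate_succ_apply, smul_eq_mul, mul_zero, add_zero,
      Derivation.map_natCast]
    ring
  | _ => simp

theorem opF_sub (f g : DiffFun) : opF (f - g) = opF f - opF g := by
  simp only [opF, map_sub]
  ring

theorem opF_prolong {η : DiffFun} (hη : opF η = 0) (ζ : DiffFun) :
    opF (prolong η ζ) = prolong η (opF ζ) := by
  simp only [opF, map_add, map_sub, Derivation.leibniz, Dt_prolong hη, Dx_prolong, Dy_prolong,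
    prolong_coord_x, smul_eq_mul, mul_zero, add_zero]

/-- Evolutionary generalized vector fields `η ∂_u`. Such a vector field is given by its
characteristic `η`, a differential function. -/
structure EvField : Type where
  /-- The generalized vector field `η ∂_u`. -/
  mk ::
  /-- The characteristic `η` of `η ∂_u`. -/
  char : DiffFun

namespace EvField

theorem char_injective : Function.Injective char := fun a b h => by
  cases a; cases b; cases h; rfl

instance : Zero EvField := ⟨⟨0⟩⟩
instance : Add EvField := ⟨fun a b => ⟨a.char + b.char⟩⟩
instance : Neg EvField := ⟨fun a => ⟨-a.char⟩⟩
instance : Sub EvField := ⟨fun a b => ⟨a.char - b.char⟩⟩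
instance : SMul ℕ EvField := ⟨fun n a => ⟨n • a.char⟩⟩
instance : SMul ℤ EvField := ⟨fun n a => ⟨n • a.char⟩⟩
instance : SMul ℝ EvField := ⟨fun c a => ⟨c • a.char⟩⟩

instance : AddCommGroup EvField :=
  char_injective.addCommGroup char rfl (fun _ _ => rfl) (fun _ => rfl) (fun _ _ => rfl)
    (fun _ _ => rfl) (fun _ _ => rfl)

/-- The characteristic, as an additive map. -/
def charHom : EvField →+ DiffFun where
  toFun := char
  map_zero' := rfl
  map_add' _ _ := rfl

instance : Module ℝ EvField := char_injective.module ℝ charHom (fun _ _ => rfl)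

@[simp] theorem char_zero : (0 : EvField).char = 0 := rfl
@[simp] theorem char_add (a b : EvField) : (a + b).char = a.char + b.char := rfl
@[simp] theorem char_neg (a : EvField) : (-a).char = -a.char := rfl
@[simp] theorem char_sub (a b : EvField) : (a - b).char = a.char - b.char := rfl
@[simp] theorem char_smul (c : ℝ) (a : EvField) : (c • a).char = c • a.char := rfl

/-- The Lie bracket of evolutionary vector fields: `[η ∂_u, ζ ∂_u]` has the characteristic
`pr(η ∂_u) ζ - pr(ζ ∂_u) η`. -/
instance : Bracket EvField EvField :=
  ⟨fun a b => ⟨prolong a.char b.char - prolong b.char a.char⟩⟩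

theorem char_lie (a b : EvField) :
    ⁅a, b⁆.char = prolong a.char b.char - prolong b.char a.char := rfl

instance : LieRing EvField where
  add_lie a b c := char_injective <| by
    simp only [char_lie, char_add, prolong_add, map_add]
    ring
  lie_add a b c := char_injective <| by
    simp only [char_lie, char_add, prolong_add, map_add]
    ring
  lie_self a := char_injective <| by simp [char_lie]
  leibniz_lie a b c := char_injective <| by
    simp only [char_lie, char_add, map_sub, ← prolong_comm]
    ring

instance : LieAlgebra ℝ EvField where
  lie_smul c a b := char_injective <| by
    simp only [char_lie, char_smul, prolong_smul, Derivation.map_smul, smul_sub]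

end EvField

/-- The algebra of (canonical representatives of) generalized symmetries of the equation
`u_t + x u_y = u_xx`: the vector fields `η ∂_u` with `F η = 0`. -/
def symmetries : LieSubalgebra ℝ EvField where
  carrier := {Q | opF Q.char = 0}
  zero_mem' := by simp [opF]
  add_mem' {a b} ha hb := by
    simp only [Set.mem_ofPred_eq, opF, EvField.char_add, map_add] at ha hb ⊢
    linear_combination ha + hb
  smul_mem' c a ha := by
    simp only [Set.mem_ofPred_eq, opF, EvField.char_smul, Derivation.map_smul] at ha ⊢
    rw [mul_smul_comm, ← smul_add, ← smul_sub, ha, smul_zero]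
  lie_mem' {a b} ha hb := by
    simp only [Set.mem_ofPred_eq] at ha hb ⊢
    rw [EvField.char_lie, opF_sub, opF_prolong ha, opF_prolong hb, ha, hb, map_zero, map_zero,
      sub_zero]

/-- `f` depends on `t`, `x`, `y` only. -/
def IsBase (f : DiffFun) : Prop := IsSmoothIn {.t, .x, .y} (f : Jet → ℝ)

/-- `η` has the form `∑_{k+l ≤ n} η^{kl}(t,x,y) u_{kl}` for some `n`. -/
def IsLinear (η : DiffFun) : Prop :=
  ∃ (n : ℕ) (c : ℕ → ℕ → DiffFun), (∀ k l, IsBase (c k l)) ∧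
    η = ∑ kl ∈ (Finset.range (n + 1) ×ˢ Finset.range (n + 1)).filter
      (fun kl => kl.1 + kl.2 ≤ n), c kl.1 kl.2 * coord (.u kl.1 kl.2)

theorem isBase_zero : IsBase 0 := isSmoothIn_const _ 0

theorem isBase_one : IsBase 1 := isSmoothIn_const _ 1

theorem IsLinear.zero : IsLinear 0 :=
  ⟨0, fun _ _ => 0, fun _ _ => isBase_zero, by simp⟩

theorem sum_extend {n m : ℕ} (h : n ≤ m) (c : ℕ → ℕ → DiffFun) :
    ∑ kl ∈ (Finset.range (n + 1) ×ˢ Finset.range (n + 1)).filter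
      (fun kl => kl.1 + kl.2 ≤ n), c kl.1 kl.2 * coord (.u kl.1 kl.2) =
    ∑ kl ∈ (Finset.range (m + 1) ×ˢ Finset.range (m + 1)).filter
      (fun kl => kl.1 + kl.2 ≤ m),
        (if kl.1 + kl.2 ≤ n then c kl.1 kl.2 else 0) * coord (.u kl.1 kl.2) := by
  rw [Finset.sum_congr rfl fun kl (_ : kl ∈ (Finset.range (m + 1) ×ˢ
    Finset.range (m + 1)).filter (fun kl => kl.1 + kl.2 ≤ m)) => by
      rw [ite_mul, zero_mul], ← Finset.sum_filter]
  refine Finset.sum_congr ?_ fun _ _ => rfl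
  ext ⟨a, b⟩
  simp only [Finset.mem_filter, Finset.mem_product, Finset.mem_range]
  omega

theorem IsLinear.add {η ζ : DiffFun} (hη : IsLinear η) (hζ : IsLinear ζ) :
    IsLinear (η + ζ) := by
  obtain ⟨n, c, hc, rfl⟩ := hη
  obtain ⟨m, d, hd, rfl⟩ := hζ
  refine ⟨max n m, fun k l => (if k + l ≤ n then c k l else 0) +
    (if k + l ≤ m then d k l else 0), fun k l => ?_, ?_⟩
  · have h1 : IsBase (if k + l ≤ n then c k l else 0) := by
      split_ifs
      exacts [hc k l, isBase_zero]
    have h2 : IsBase (if k + l ≤ m then d k l else 0) := by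
      split_ifs
      exacts [hd k l, isBase_zero]
    exact IsSmoothIn.add h1 h2
  · rw [sum_extend (le_max_left n m) c, sum_extend (le_max_right n m) d,
      ← Finset.sum_add_distrib]
    exact Finset.sum_congr rfl fun kl _ => by rw [add_mul]

theorem IsLinear.base_mul {b η : DiffFun} (hb : IsBase b) (hη : IsLinear η) :
    IsLinear (b * η) := by
  obtain ⟨n, c, hc, rfl⟩ := hη
  refine ⟨n, fun k l => b * c k l, fun k l => IsSmoothIn.mul hb (hc k l), ?_⟩
  rw [Finset.mul_sum]
  exact Finset.sum_congr rfl fun kl _ => by rw [mul_assoc]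

theorem isBase_const (c : ℝ) : IsBase (algebraMap ℝ DiffFun c) := isSmoothIn_const _ c

theorem IsLinear.smul {η : DiffFun} (c : ℝ) (hη : IsLinear η) : IsLinear (c • η) := by
  rw [Algebra.smul_def]
  exact hη.base_mul (isBase_const c)

theorem IsLinear.sub {η ζ : DiffFun} (hη : IsLinear η) (hζ : IsLinear ζ) :
    IsLinear (η - ζ) := by
  rw [sub_eq_add_neg, ← neg_one_smul ℝ ζ]
  exact hη.add (hζ.smul (-1))

theorem isLinear_coord (k l : ℕ) : IsLinear (coord (.u k l)) := by
  refine ⟨k + l, fun a b => if a = k ∧ b = l then 1 else 0, fun a b => ?_, ?_⟩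
  · dsimp only
    split_ifs
    exacts [isSmoothIn_const _ 1, isBase_zero]
  · rw [Finset.sum_eq_single (k, l)]
    · simp
    · rintro ⟨a, b⟩ _ h
      have : ¬(a = k ∧ b = l) := fun h' => h (by rw [h'.1, h'.2])
      simp [this]
    · intro h
      refine absurd ?_ h
      simp only [Finset.mem_filter, Finset.mem_product, Finset.mem_range]
      omega

theorem isLinear_sum {ι : Type} (s : Finset ι) (f : ι → DiffFun) (h : ∀ i ∈ s, IsLinear (f i)) :
    IsLinear (∑ i ∈ s, f i) :=
  Finset.sum_induction f IsLinear (fun _ _ => IsLinear.add) IsLinear.zero h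

theorem isBase_field {a : Coord → DiffFun} (ht : IsBase (a .t)) (hx : IsBase (a .x))
    (hy : IsBase (a .y)) {b : DiffFun} (hb : IsBase b) : IsBase (field a b) := by
  rw [field_eq_sum a hb, Finset.sum_insert (by simp), Finset.sum_insert (by simp),
    Finset.sum_singleton]
  exact IsSmoothIn.add (IsSmoothIn.mul ht (IsSmoothIn.pderiv hb _)) (IsSmoothIn.add
    (IsSmoothIn.mul hx (IsSmoothIn.pderiv hb _)) (IsSmoothIn.mul hy (IsSmoothIn.pderiv hb _)))

theorem IsLinear.Dx {η : DiffFun} (h : IsLinear η) : IsLinear (Dx η) := by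
  obtain ⟨n, c, hc, rfl⟩ := h
  rw [map_sum]
  refine isLinear_sum _ _ fun kl _ => ?_
  rw [Derivation.leibniz, smul_eq_mul, smul_eq_mul, mul_comm (coord _)]
  refine IsLinear.add (IsLinear.base_mul (hc _ _) ?_) (IsLinear.base_mul ?_ (isLinear_coord _ _))
  · rw [Kolmogorov.Dx, field_coord]
    exact isLinear_coord _ _
  · exact isBase_field (b := c _ _) isBase_zero isBase_one isBase_zero (hc _ _)

theorem IsLinear.Dy {η : DiffFun} (h : IsLinear η) : IsLinear (Dy η) := by
  obtain ⟨n, c, hc, rfl⟩ := h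
  rw [map_sum]
  refine isLinear_sum _ _ fun kl _ => ?_
  rw [Derivation.leibniz, smul_eq_mul, smul_eq_mul, mul_comm (coord _)]
  refine IsLinear.add (IsLinear.base_mul (hc _ _) ?_) (IsLinear.base_mul ?_ (isLinear_coord _ _))
  · rw [Kolmogorov.Dy, field_coord]
    exact isLinear_coord _ _
  · exact isBase_field (b := c _ _) isBase_zero isBase_zero isBase_one (hc _ _)

theorem IsLinear.iter {η : DiffFun} (h : IsLinear η) (k l : ℕ) :
    IsLinear ((⇑Kolmogorov.Dx)^[k] ((⇑Kolmogorov.Dy)^[l] η)) := by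
  have h1 : IsLinear ((⇑Kolmogorov.Dy)^[l] η) := by
    induction l with
    | zero => exact h
    | succ l ih =>
      rw [Function.iterate_succ_apply']
      exact ih.Dy
  induction k with
  | zero => exact h1
  | succ k ih =>
    rw [Function.iterate_succ_apply']
    exact ih.Dx

theorem IsLinear.prolong {η ζ : DiffFun} (hη : IsLinear η) (hζ : IsLinear ζ) :
    IsLinear (prolong η ζ) := by
  obtain ⟨n, c, hc, rfl⟩ := hζ
  rw [map_sum]
  refine isLinear_sum _ _ fun kl _ => ?_
  rw [Derivation.leibniz, smul_eq_mul, smul_eq_mul, mul_comm (coord _), prolong_coord_u]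
  have h0 : Kolmogorov.prolong η (c kl.1 kl.2) = 0 := by
    rw [Kolmogorov.prolong, field_eq_sum _ (hc kl.1 kl.2), Finset.sum_insert (by simp),
      Finset.sum_insert (by simp), Finset.sum_singleton]
    simp
  rw [h0, zero_mul, add_zero]
  exact (hη.iter _ _).base_mul (hc _ _)

/-- The algebra `Λ` of linear generalized symmetries of the equation `u_t + x u_y = u_xx`. -/
def linSymmetries : LieSubalgebra ℝ EvField where
  carrier := {Q | Q ∈ symmetries ∧ IsLinear Q.char}
  zero_mem' := ⟨symmetries.zero_mem, IsLinear.zero⟩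
  add_mem' {_ _} ha hb := ⟨symmetries.add_mem ha.1 hb.1, ha.2.add hb.2⟩
  smul_mem' c _ ha := ⟨symmetries.smul_mem c ha.1, ha.2.smul c⟩
  lie_mem' {_ _} ha hb :=
    ⟨symmetries.lie_mem ha.1 hb.1, (ha.2.prolong hb.2).sub (hb.2.prolong ha.2)⟩

/-! ### The operators `P³`, `P²`, `P¹`, `P⁰` and the associative algebra generated by them -/

/-- Multiplication by a differential function. -/
def mulOp (f : DiffFun) : Module.End ℝ DiffFun := LinearMap.mulLeft ℝ f

/-- `P³ = 3t² D_x + t³ D_y - 3(y - tx)`. -/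
def opP3 : Module.End ℝ DiffFun :=
  mulOp (3 * coord .t ^ 2) * Dx.toLinearMap + mulOp (coord .t ^ 3) * Dy.toLinearMap
    - mulOp (3 * (coord .y - coord .t * coord .x))

/-- `P² = 2t D_x + t² D_y + x`. -/
def opP2 : Module.End ℝ DiffFun :=
  mulOp (2 * coord .t) * Dx.toLinearMap + mulOp (coord .t ^ 2) * Dy.toLinearMap
    + mulOp (coord .x)

/-- `P¹ = D_x + t D_y`. -/
def opP1 : Module.End ℝ DiffFun :=
  Dx.toLinearMap + mulOp (coord .t) * Dy.toLinearMap

/-- `P⁰ = D_y`. -/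
def opP0 : Module.End ℝ DiffFun := Dy.toLinearMap

/-- The associative unital algebra `Υ_𝔯` of differential operators generated by
`P³`, `P²`, `P¹`, `P⁰`. -/
def Upsilon : Subalgebra ℝ (Module.End ℝ DiffFun) :=
  Algebra.adjoin ℝ {opP3, opP2, opP1, opP0}

/-- The Lie algebra associated with `Υ_𝔯`; the bracket is the commutator. -/
instance : LieRing Upsilon := LieRing.ofAssociativeRing

/-- The vector field `(Q u) ∂_u`, where the operator `Q` acts on `u = u_{00}`. -/
def actOnU (Q : Module.End ℝ DiffFun) : EvField := ⟨Q (coord (.u 0 0))⟩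

/-- The space `Λ_𝔯` spanned by `((P³)^{i₃} (P²)^{i₂} (P¹)^{i₁} (P⁰)^{i₀} u) ∂_u`. -/
def LambdaR : Submodule ℝ EvField :=
  Submodule.span ℝ (Set.range fun i : ℕ × ℕ × ℕ × ℕ =>
    actOnU (opP3 ^ i.1 * opP2 ^ i.2.1 * opP1 ^ i.2.2.1 * opP0 ^ i.2.2.2))

/-- The vector field `u ∂_u`. -/
def uField : EvField := ⟨coord (.u 0 0)⟩

/-! ### The radical `𝔯` of the essential Lie invariance algebra and its enveloping algebra -/

/-- Vector fields with polynomial coefficients on the space with the coordinates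
`t = X 0`, `x = X 1`, `y = X 2`, `u = X 3`. -/
abbrev PolyVF : Type := Derivation ℝ (MvPolynomial (Fin 4) ℝ) (MvPolynomial (Fin 4) ℝ)

open MvPolynomial in
/-- The vector field `τ ∂_t + ξ ∂_x + ψ ∂_y + φ ∂_u`. -/
def polyVF (τ ξ ψ φ : MvPolynomial (Fin 4) ℝ) : PolyVF := mkDerivation ℝ ![τ, ξ, ψ, φ]

open MvPolynomial in
/-- `𝒫³ = 3t² ∂_x + t³ ∂_y + 3(y - tx) u ∂_u`. -/
def vfP3 : PolyVF := polyVF 0 (3 * X 0 ^ 2) (X 0 ^ 3) (3 * (X 2 - X 0 * X 1) * X 3)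

open MvPolynomial in
/-- `𝒫² = 2t ∂_x + t² ∂_y - x u ∂_u`. -/
def vfP2 : PolyVF := polyVF 0 (2 * X 0) (X 0 ^ 2) (-(X 1 * X 3))

open MvPolynomial in
/-- `𝒫¹ = ∂_x + t ∂_y`. -/
def vfP1 : PolyVF := polyVF 0 1 (X 0) 0

/-- `𝒫⁰ = ∂_y`. -/
def vfP0 : PolyVF := polyVF 0 0 1 0

open MvPolynomial in
/-- `ℐ = u ∂_u`. -/
def vfI : PolyVF := polyVF 0 0 0 (X 3)

theorem mkDerivation_ofNat (f : Fin 4 → MvPolynomial (Fin 4) ℝ) (n : ℕ) [n.AtLeastTwo] :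
    MvPolynomial.mkDerivation ℝ f ofNat(n) = 0 :=
  (MvPolynomial.mkDerivation ℝ f).map_natCast n

theorem polyVF_lie_mem {a b : PolyVF} (ha : a ∈ ({vfP3, vfP2, vfP1, vfP0, vfI} : Set PolyVF))
    (hb : b ∈ ({vfP3, vfP2, vfP1, vfP0, vfI} : Set PolyVF)) :
    ⁅a, b⁆ ∈ Submodule.span ℝ ({vfP3, vfP2, vfP1, vfP0, vfI} : Set PolyVF) := by
  have hI : vfI ∈ Submodule.span ℝ ({vfP3, vfP2, vfP1, vfP0, vfI} : Set PolyVF) :=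
    Submodule.subset_span (by simp)
  have h32 : ⁅vfP3, vfP2⁆ = 0 := by
    refine MvPolynomial.derivation_ext fun i => ?_
    fin_cases i <;> simp [Derivation.commutator_apply, mkDerivation_ofNat, vfP3, vfP2, polyVF,
      MvPolynomial.mkDerivation_X, Derivation.leibniz]
    all_goals ring
  have h31 : ⁅vfP3, vfP1⁆ = 0 := by
    refine MvPolynomial.derivation_ext fun i => ?_
    fin_cases i <;> simp [Derivation.commutator_apply, mkDerivation_ofNat, vfP3, vfP1, polyVF,
      MvPolynomial.mkDerivation_X, Derivation.leibniz]
  have h30 : ⁅vfP3, vfP0⁆ = (-3 : ℝ) • vfI := by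
    refine MvPolynomial.derivation_ext fun i => ?_
    fin_cases i <;> simp [Derivation.commutator_apply, mkDerivation_ofNat, vfP3, vfP0, vfI, polyVF,
      MvPolynomial.mkDerivation_X, Derivation.leibniz, Algebra.smul_def]
    rw [show (MvPolynomial.C 3 : MvPolynomial (Fin 4) ℝ) = 3 from map_ofNat _ 3]
    ring
  have h3I : ⁅vfP3, vfI⁆ = 0 := by
    refine MvPolynomial.derivation_ext fun i => ?_
    fin_cases i <;> simp [Derivation.commutator_apply, mkDerivation_ofNat, vfP3, vfI, polyVF,
      MvPolynomial.mkDerivation_X, Derivation.leibniz]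
  have h21 : ⁅vfP2, vfP1⁆ = vfI := by
    refine MvPolynomial.derivation_ext fun i => ?_
    fin_cases i <;> simp [Derivation.commutator_apply, mkDerivation_ofNat, vfP2, vfP1, vfI, polyVF,
      MvPolynomial.mkDerivation_X, Derivation.leibniz]
  have h20 : ⁅vfP2, vfP0⁆ = 0 := by
    refine MvPolynomial.derivation_ext fun i => ?_
    fin_cases i <;> simp [Derivation.commutator_apply, mkDerivation_ofNat, vfP2, vfP0, polyVF,
      MvPolynomial.mkDerivation_X, Derivation.leibniz]
  have h2I : ⁅vfP2, vfI⁆ = 0 := by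
    refine MvPolynomial.derivation_ext fun i => ?_
    fin_cases i <;> simp [Derivation.commutator_apply, mkDerivation_ofNat, vfP2, vfI, polyVF,
      MvPolynomial.mkDerivation_X, Derivation.leibniz]
  have h10 : ⁅vfP1, vfP0⁆ = 0 := by
    refine MvPolynomial.derivation_ext fun i => ?_
    fin_cases i <;> simp [Derivation.commutator_apply, vfP1, vfP0, polyVF,
      MvPolynomial.mkDerivation_X]
  have h1I : ⁅vfP1, vfI⁆ = 0 := by
    refine MvPolynomial.derivation_ext fun i => ?_
    fin_cases i <;> simp [Derivation.commutator_apply, vfP1, vfI, polyVF,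
      MvPolynomial.mkDerivation_X]
  have h0I : ⁅vfP0, vfI⁆ = 0 := by
    refine MvPolynomial.derivation_ext fun i => ?_
    fin_cases i <;> simp [Derivation.commutator_apply, vfP0, vfI, polyVF,
      MvPolynomial.mkDerivation_X]
  have h3I' := Submodule.smul_mem _ (-3 : ℝ) hI
  have h23 := (lie_skew vfP2 vfP3).symm
  have h13 := (lie_skew vfP1 vfP3).symm
  have h03 := (lie_skew vfP0 vfP3).symm
  have hI3 := (lie_skew vfI vfP3).symm
  have h12 := (lie_skew vfP1 vfP2).symm
  have h02 := (lie_skew vfP0 vfP2).symm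
  have hI2 := (lie_skew vfI vfP2).symm
  have h01 := (lie_skew vfP0 vfP1).symm
  have hI1 := (lie_skew vfI vfP1).symm
  have hI0 := (lie_skew vfI vfP0).symm
  rw [h32] at h23
  rw [h31] at h13
  rw [h30] at h03
  rw [h3I] at hI3
  rw [h21] at h12
  rw [h20] at h02
  rw [h2I] at hI2
  rw [h10] at h01
  rw [h1I] at hI1
  rw [h0I] at hI0
  simp only [Set.mem_insert_iff, Set.mem_singleton_iff] at ha hb
  rcases ha with rfl | rfl | rfl | rfl | rfl <;> rcases hb with rfl | rfl | rfl | rfl | rfl <;>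
    simp only [lie_self, h32, h31, h30, h3I, h21, h20, h2I, h10, h1I, h0I, h23, h13, h03, hI3,
      h12, h02, hI2, h01, hI1, hI0, neg_zero, Submodule.zero_mem, Submodule.neg_mem_iff, hI, h3I']

/-- The Lie algebra `𝔯` spanned by the vector fields `𝒫³`, `𝒫²`, `𝒫¹`, `𝒫⁰`, `ℐ`. -/
def radR : LieSubalgebra ℝ PolyVF where
  toSubmodule := Submodule.span ℝ {vfP3, vfP2, vfP1, vfP0, vfI}
  lie_mem' {a b} ha hb :=
    Submodule.span_induction₂ (p := fun a b _ _ =>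
        ⁅a, b⁆ ∈ Submodule.span ℝ ({vfP3, vfP2, vfP1, vfP0, vfI} : Set PolyVF))
      (fun _ _ h h' => polyVF_lie_mem h h')
      (fun y _ => by rw [show _ = _ from zero_lie y]; exact Submodule.zero_mem _)
      (fun x _ => by rw [show _ = _ from lie_zero x]; exact Submodule.zero_mem _)
      (fun x y z _ _ _ h h' => by rw [show _ = _ from add_lie x y z]; exact Submodule.add_mem _ h h')
      (fun x y z _ _ _ h h' => by rw [show _ = _ from lie_add x y z]; exact Submodule.add_mem _ h h')
      (fun r x y _ _ h => by rw [show _ = _ from smul_lie r x y]; exact Submodule.smul_mem _ r h)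
      (fun r x y _ _ h => by rw [show _ = _ from lie_smul r x y]; exact Submodule.smul_mem _ r h) ha hb

/-- `𝒫³` as an element of `𝔯`. -/
def rP3 : radR := ⟨vfP3, Submodule.subset_span (by simp)⟩

/-- `𝒫²` as an element of `𝔯`. -/
def rP2 : radR := ⟨vfP2, Submodule.subset_span (by simp)⟩

/-- `𝒫¹` as an element of `𝔯`. -/
def rP1 : radR := ⟨vfP1, Submodule.subset_span (by simp)⟩

/-- `𝒫⁰` as an element of `𝔯`. -/
def rP0 : radR := ⟨vfP0, Submodule.subset_span (by simp)⟩

/-- `ℐ` as an element of `𝔯`. -/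
def rI : radR := ⟨vfI, Submodule.subset_span (by simp)⟩

/-- The relation whose quotient kills `ι(ℐ) + 1`. -/
inductive EnvRel : UniversalEnvelopingAlgebra ℝ radR → UniversalEnvelopingAlgebra ℝ radR → Prop
  | rel : EnvRel (UniversalEnvelopingAlgebra.ι ℝ rI + 1) 0

/-- The quotient `𝔘(𝔯)/(ι(ℐ) + 1)` of the universal enveloping algebra by the two-sided ideal
generated by `ι(ℐ) + 1`. -/
abbrev EnvQuot : Type := RingQuot EnvRel

/-- The Lie algebra associated with `𝔘(𝔯)/(ι(ℐ) + 1)`; the bracket is the commutator. -/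
instance : LieRing EnvQuot := LieRing.ofAssociativeRing

/-- The image in `𝔘(𝔯)/(ι(ℐ) + 1)` of an element of `𝔯`. -/
def toEnvQuot (a : radR) : EnvQuot :=
  RingQuot.mkAlgHom ℝ EnvRel (UniversalEnvelopingAlgebra.ι ℝ a)

/-! ### Weyl algebras -/

/-- The alphabet `p_1, …, p_n, q_1, …, q_n`. -/
inductive WeylGen (n : ℕ) : Type
  | p (i : Fin n) : WeylGen n
  | q (i : Fin n) : WeylGen n

open FreeAlgebra in
/-- The defining relations of the Weyl algebra: the `p_i` commute, the `q_i` commute and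
`p_i q_j - q_j p_i = δ_{ij}`. -/
inductive WeylRel (n : ℕ) : FreeAlgebra ℝ (WeylGen n) → FreeAlgebra ℝ (WeylGen n) → Prop
  | pp (i j : Fin n) : WeylRel n (ι ℝ (.p i) * ι ℝ (.p j) - ι ℝ (.p j) * ι ℝ (.p i)) 0
  | qq (i j : Fin n) : WeylRel n (ι ℝ (.q i) * ι ℝ (.q j) - ι ℝ (.q j) * ι ℝ (.q i)) 0
  | pq (i j : Fin n) : WeylRel n (ι ℝ (.p i) * ι ℝ (.q j) - ι ℝ (.q j) * ι ℝ (.p i))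
      (if i = j then 1 else 0)

/-- The `n`th Weyl algebra `W(n, ℝ)`. -/
abbrev Weyl (n : ℕ) : Type := RingQuot (WeylRel n)

/-- The Lie algebra associated with the Weyl algebra; the bracket is the commutator. -/
instance (n : ℕ) : LieRing (Weyl n) := LieRing.ofAssociativeRing

end Kolmogorov

end

/-!
The operators `P³, P², P¹, P⁰` satisfy `[P¹, P²] = 1`, `[P⁰, P³] = -3`, all other commutators
vanishing; these are, up to signs and scaling, the relations of the second Weyl algebra. The proof
consists of three parts.

*Symmetries are operators.* A linear characteristic `η` is `Q u` for a unique differential operator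
`Q = ∑ η^{kl} D_x ^ k D_y ^ l` (`eq_zero_of_apply_u_eq_zero`, `exists_apply_u_eq`), and `F η = 0`
says that `Q` commutes with `F = D_t + x D_y - D_x ^ 2`. Since `pr(ζ ∂_u)` acts on `Q u` by the
linearization `Q ζ` (`prolong_apply_u`), the Lie bracket of symmetries is minus the commutator.

*Every symmetry operator is a polynomial in the `Pʲ`* (`symOps_le_Upsilon`). Commutation with `F`
means that `F η^{kl} = (k + 1) η^{k+1,l-1} + 2 D_x η^{k-1,l}`. If `Q` has order `n`, these equations
show by descending induction on `k + l = n - j` that `D_x ^ {2j+1} η^{kl} = 0` and that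
`D_x ^ {2j} η^{kl}` is a nonzero multiple of `D_y ^ j η^{k+j,l}`; the equation with `k = 0` then
yields `D_y ^ {j+1} η^{j,n-j} = 0`. Thus enough applications of `D_y` lower the order, and all
coefficients are killed by a power of `D_y` and a power of `D_x`. In other words, `ad P⁰` is
nilpotent on `Q`, and so is `ad P¹` if `Q` commutes with `P⁰`; for the same reason as in the Weyl
algebra, `ad P²` is nilpotent on `Q` that commute with `P⁰` and `P¹`, and `ad P³` on those that
commute with the other three. If `ad p` is nilpotent and `[p, q]` is a nonzero scalar, a Taylor
expansion in `q` reduces the claim for `Q` to operators commuting with `p`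
(`mem_of_adj_iterate_eq_zero`). After four such steps, with `(p, q)` running over `(P⁰, P³)`,
`(P¹, P²)`, `(P², P¹)`, `(P³, P⁰)`, the operator `Q` commutes with all `Pʲ` and is a constant
(`exists_eq_algebraMap_of_mem_symOps`). The last fact also determines the center.

*Algebras with these commutation relations.* In any nontrivial algebra the ordered monomials in
such a quadruple are linearly independent, and they span the subalgebra it generates; hence every
nontrivial algebra generated by such a quadruple is the Weyl algebra (`IsQuad.weylEquiv`). This
applies to `Υ_𝔯` and to `𝔘(𝔯)/(ι(ℐ) + 1)`, which is nontrivial because `𝔯` is represented in `Υ_𝔯`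
with `ℐ` acting as `-1`. It also applies to opposite algebras, so that anti-isomorphisms can be
turned into isomorphisms. Simplicity modulo the center is `IsQuad.lieIdeal_eq_top`.
-/

noncomputable section

namespace Kolmogorov

/-! ### Commutators with conjugate elements -/

section Algebra

variable {A : Type*} [Ring A] [Algebra ℝ A]

/-- The commutator `x ↦ g x - x g`. -/
def adj (g : A) : A →ₗ[ℝ] A := LinearMap.mulLeft ℝ g - LinearMap.mulRight ℝ g

theorem adj_apply (g x : A) : adj g x = g * x - x * g := rfl

theorem adj_eq_zero_iff {g x : A} : adj g x = 0 ↔ g * x = x * g := by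
  rw [adj_apply, sub_eq_zero]

theorem adj_mul (g x y : A) : adj g (x * y) = adj g x * y + x * adj g y := by
  simp only [adj_apply]
  noncomm_ring

theorem adj_mul_left (g h x : A) : adj (g * h) x = g * adj h x + adj g x * h := by
  simp only [adj_apply]
  noncomm_ring

theorem adj_algebraMap (g : A) (r : ℝ) : adj g (algebraMap ℝ A r) = 0 := by
  rw [adj_apply, Algebra.commutes, sub_self]

theorem adj_one (g : A) : adj g 1 = 0 := by simp [adj_apply]

theorem adj_swap (g x : A) : adj g x = -adj x g := by simp [adj_apply]

theorem adj_self (x : A) : adj x x = 0 := by simp [adj_apply]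

/-- Commutators with elements whose own commutator is a scalar commute. -/
theorem adj_adj_comm {g h : A} {r : ℝ} (hgh : adj g h = algebraMap ℝ A r) (x : A) :
    adj g (adj h x) = adj h (adj g x) := by
  have h1 : adj g (adj h x) - adj h (adj g x) = adj (adj g h) x := by
    simp only [adj_apply]
    noncomm_ring
  have h2 : adj (algebraMap ℝ A r) x = 0 := by rw [adj_swap, adj_algebraMap, neg_zero]
  rw [hgh, h2, sub_eq_zero] at h1
  exact h1

section Conjugate

variable {p q : A} {r : ℝ}

theorem adj_pow_succ (hpq : adj p q = algebraMap ℝ A r) (k : ℕ) :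
    adj p (q ^ (k + 1)) = ((k + 1 : ℝ) * r) • q ^ k := by
  induction k with
  | zero => simp [hpq, Algebra.algebraMap_eq_smul_one]
  | succ k ih =>
    rw [pow_succ, adj_mul, ih, hpq, smul_mul_assoc, ← pow_succ, ← Algebra.commutes,
      ← Algebra.smul_def, ← add_smul]
    congr 1
    push_cast
    ring

theorem adj_pow_mul (hpq : adj p q = algebraMap ℝ A r) (k : ℕ) (x : A) :
    adj p (q ^ (k + 1) * x) = ((k + 1 : ℝ) * r) • (q ^ k * x) + q ^ (k + 1) * adj p x := by
  rw [adj_mul, adj_pow_succ hpq, smul_mul_assoc]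

theorem adj_iterate_pow_mul_of_lt (hpq : adj p q = algebraMap ℝ A r) {u : A} (hu : adj p u = 0)
    {k N : ℕ} (h : k < N) : (adj p ^ N) (q ^ k * u) = 0 := by
  induction N generalizing k with
  | zero => omega
  | succ N ih =>
    rw [pow_succ, Module.End.mul_apply]
    cases k with
    | zero => rw [pow_zero, one_mul, hu, map_zero]
    | succ k => rw [adj_pow_mul hpq, hu, mul_zero, add_zero, map_smul, ih (by omega), smul_zero]

theorem adj_iterate_pow_mul_self (hpq : adj p q = algebraMap ℝ A r) {u : A} (hu : adj p u = 0)
    (N : ℕ) : (adj p ^ N) (q ^ N * u) = ((N.factorial : ℝ) * r ^ N) • u := by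
  induction N with
  | zero => simp
  | succ N ih =>
    rw [pow_succ, Module.End.mul_apply, adj_pow_mul hpq, hu, mul_zero, add_zero, map_smul, ih,
      smul_smul, Nat.factorial_succ]
    congr 1
    push_cast
    ring

/-- If `ad p` is nilpotent on `x` and `[p, q]` is a nonzero scalar, then `x` is a sum of products
`q ^ i * u` with `u` commuting with `p`. Hence a subspace `U` stable under `q` contains all such
`x` from `C` as soon as it contains the elements of `C` that commute with `p`. -/
theorem mem_of_adj_iterate_eq_zero (hr : r ≠ 0) (hpq : adj p q = algebraMap ℝ A r)
    {C U : Submodule ℝ A} (hCp : ∀ x ∈ C, adj p x ∈ C) (hCq : ∀ x ∈ C, q * x ∈ C)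
    (hUq : ∀ x ∈ U, q * x ∈ U) (hker : ∀ x ∈ C, adj p x = 0 → x ∈ U) (N : ℕ) {x : A}
    (hx : x ∈ C) (hN : (adj p ^ N) x = 0) : x ∈ U := by
  induction N generalizing x with
  | zero => simp_all
  | succ N ih =>
    have hpow : ∀ (V : Submodule ℝ A), (∀ x ∈ V, q * x ∈ V) → ∀ x ∈ V, ∀ n, q ^ n * x ∈ V := by
      intro V hV x hx n
      induction n with
      | zero => simpa
      | succ n ih => rw [pow_succ', mul_assoc]; exact hV _ ih
    have hC : ∀ n, (adj p ^ n) x ∈ C := by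
      intro n
      induction n with
      | zero => simpa
      | succ n ih => rw [pow_succ', Module.End.mul_apply]; exact hCp _ ih
    -- Subtracting the leading Taylor term `q ^ N * u / (N! r ^ N)` lowers the nilpotency order.
    set u := (adj p ^ N) x with hu
    have hu0 : adj p u = 0 := by rw [hu, ← Module.End.mul_apply, ← pow_succ', hN]
    have huU : u ∈ U := hker u (hC N) hu0
    have hc : (N.factorial : ℝ) * r ^ N ≠ 0 :=
      mul_ne_zero (Nat.cast_ne_zero.2 N.factorial_ne_zero) (pow_ne_zero _ hr)
    have h : x - ((N.factorial : ℝ) * r ^ N)⁻¹ • (q ^ N * u) ∈ U := by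
      refine ih (C.sub_mem hx (C.smul_mem _ (hpow C hCq u (hC N) N))) ?_
      rw [map_sub, map_smul, adj_iterate_pow_mul_self hpq hu0, smul_smul, inv_mul_cancel₀ hc,
        one_smul, ← hu, sub_self]
    have := U.add_mem h (U.smul_mem ((N.factorial : ℝ) * r ^ N)⁻¹ (hpow U hUq u huU N))
    rwa [sub_add_cancel] at this

/-- If `ad p` is nilpotent on `x` and `[p, q]` is a nonzero scalar, then `x` is a commutator with
`p`: integration by parts. -/
theorem exists_adj_eq (hr : r ≠ 0) (hpq : adj p q = algebraMap ℝ A r) (N : ℕ) {x : A}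
    (hN : (adj p ^ N) x = 0) : ∃ y, adj p y = x := by
  -- The induction needs all products `q ^ k * x`, since `ad p` turns `q ^ (k + 1) * x` into a
  -- multiple of `q ^ k * x` plus a term with `ad p x`, for which the nilpotency order is smaller.
  suffices h : ∀ k, q ^ k * x ∈ LinearMap.range (adj p) by simpa using h 0
  induction N generalizing x with
  | zero =>
    have : x = 0 := by simpa using hN
    simp [this]
  | succ N ih =>
    intro k
    have hk : ((k + 1 : ℝ) * r) ≠ 0 := mul_ne_zero (by positivity) hr
    have h1 : ((k + 1 : ℝ) * r) • (q ^ k * x) =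
        adj p (q ^ (k + 1) * x) - q ^ (k + 1) * adj p x := by
      rw [adj_pow_mul hpq, add_sub_cancel_right]
    have h2 : ((k + 1 : ℝ) * r) • (q ^ k * x) ∈ LinearMap.range (adj p) := by
      rw [h1]
      refine Submodule.sub_mem _ ⟨_, rfl⟩ (ih ?_ (k + 1))
      rw [← Module.End.mul_apply, ← pow_succ, hN]
    exact (Submodule.smul_mem_iff _ hk).1 h2

/-- Multiplication by the powers of an element `q` conjugate to `p` preserves linear independence
of vectors commuting with `p`. -/
theorem linearIndependent_pow_mul {ι : Type*} (hr : r ≠ 0) (hpq : adj p q = algebraMap ℝ A r)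
    {v : ι → A} (hv : LinearIndependent ℝ v) (hp : ∀ i, adj p (v i) = 0) :
    LinearIndependent ℝ (fun i : ℕ × ι => q ^ i.1 * v i.2) := by
  classical
  rw [linearIndependent_iff']
  intro s g
  suffices h : ∀ N, ∀ s : Finset (ℕ × ι), (∀ i ∈ s, i.1 < N) →
      ∑ i ∈ s, g i • (q ^ i.1 * v i.2) = 0 → ∀ i ∈ s, g i = 0 from
    h (s.sup Prod.fst + 1) s fun i hi => Nat.lt_succ_of_le (Finset.le_sup (f := Prod.fst) hi)
  intro N
  induction N with
  | zero => intro s hs _ i hi; exact absurd (hs i hi) (Nat.not_lt_zero _)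
  | succ N ih =>
    intro s hs h0
    have hc : (N.factorial : ℝ) * r ^ N ≠ 0 :=
      mul_ne_zero (Nat.cast_ne_zero.2 N.factorial_ne_zero) (pow_ne_zero _ hr)
    -- Applying `(ad p) ^ N` leaves only the terms with the highest power of `q`.
    have htop : ∀ i ∈ s, i.1 = N → g i = 0 := by
      have h1 := congrArg (adj p ^ N) h0
      rw [map_sum, map_zero, ← Finset.sum_filter_add_sum_filter_not s (fun i => i.1 = N),
        Finset.sum_eq_zero (s := s.filter fun i => ¬ i.1 = N), add_zero] at h1
      · have h2 : ∑ j ∈ (s.filter fun i => i.1 = N).image Prod.snd,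
            (((N.factorial : ℝ) * r ^ N) * g (N, j)) • v j = 0 := by
          rw [Finset.sum_image, ← h1]
          · refine Finset.sum_congr rfl fun i hi => ?_
            obtain ⟨n, j⟩ := i
            obtain rfl : n = N := (Finset.mem_filter.1 hi).2
            rw [map_smul, adj_iterate_pow_mul_self hpq (hp j), smul_smul, mul_comm]
          · rintro ⟨n, i⟩ hi ⟨m, j⟩ hj hij
            simp only [Finset.coe_filter, Set.mem_ofPred_eq] at hi hj hij
            rw [hi.2, hj.2, hij]
        rintro ⟨n, j⟩ hi rfl
        have h3 := linearIndependent_iff'.1 hv _ _ h2 j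
          (Finset.mem_image.2 ⟨(n, j), Finset.mem_filter.2 ⟨hi, rfl⟩, rfl⟩)
        exact (mul_eq_zero.1 h3).resolve_left hc
      · intro i hi
        obtain ⟨hi, hn⟩ := Finset.mem_filter.1 hi
        have := hs i hi
        rw [map_smul, adj_iterate_pow_mul_of_lt hpq (hp _) (by omega), smul_zero]
    have hlow := ih (s.filter fun i => ¬ i.1 = N)
      (fun i hi => by
        obtain ⟨hi, hn⟩ := Finset.mem_filter.1 hi
        have := hs i hi
        omega)
      (by
        rw [← Finset.sum_filter_add_sum_filter_not s (fun i => i.1 = N),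
          Finset.sum_eq_zero (s := s.filter fun i => i.1 = N), zero_add] at h0
        · exact h0
        · intro i hi
          obtain ⟨hi, hn⟩ := Finset.mem_filter.1 hi
          rw [htop i hi hn, zero_smul])
    intro i hi
    by_cases hn : i.1 = N
    · exact htop i hi hn
    · exact hlow i (Finset.mem_filter.2 ⟨hi, hn⟩)

end Conjugate

theorem adj_iterate_eq_zero_of_le {g x : A} {N M : ℕ} (h : N ≤ M) (hx : (adj g ^ N) x = 0) :
    (adj g ^ M) x = 0 := by
  obtain ⟨k, rfl⟩ := Nat.exists_eq_add_of_le h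
  rw [add_comm, pow_add, Module.End.mul_apply, hx, map_zero]

theorem exists_adj_iterate_add {g x y : A} (hx : ∃ N, (adj g ^ N) x = 0)
    (hy : ∃ N, (adj g ^ N) y = 0) : ∃ N, (adj g ^ N) (x + y) = 0 := by
  obtain ⟨N, hN⟩ := hx
  obtain ⟨M, hM⟩ := hy
  refine ⟨max N M, ?_⟩
  rw [map_add, adj_iterate_eq_zero_of_le (le_max_left N M) hN,
    adj_iterate_eq_zero_of_le (le_max_right N M) hM, add_zero]

theorem exists_adj_iterate_mul {g x y : A} (hx : ∃ N, (adj g ^ N) x = 0)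
    (hy : ∃ N, (adj g ^ N) y = 0) : ∃ N, (adj g ^ N) (x * y) = 0 := by
  obtain ⟨N, hN⟩ := hx
  obtain ⟨M, hM⟩ := hy
  induction h : N + M generalizing x y N M with
  | zero =>
    obtain rfl : N = 0 := by omega
    have : x = 0 := by simpa using hN
    exact ⟨0, by simp [this]⟩
  | succ k ih =>
    rcases N with _ | N
    · have : x = 0 := by simpa using hN
      exact ⟨0, by simp [this]⟩
    rcases M with _ | M
    · have : y = 0 := by simpa using hM
      exact ⟨0, by simp [this]⟩
    obtain ⟨K, hK⟩ := exists_adj_iterate_add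
      (ih N (x := adj g x) (y := y) (by rw [← Module.End.mul_apply, ← pow_succ, hN]) (M + 1) hM
        (by omega))
      (ih (N + 1) (x := x) (y := adj g y) hN M
        (by rw [← Module.End.mul_apply, ← pow_succ, hM]) (by omega))
    exact ⟨K + 1, by rw [pow_succ, Module.End.mul_apply, adj_mul, hK]⟩

/-! ### Quadruples with canonical commutation relations -/

/-- Four elements with the commutation relations of `P³, P², P¹, P⁰`, in this order: `c` is
conjugate to `b`, `d` is conjugate to `a`, and the two pairs commute with each other. -/
structure IsQuad (a b c d : A) : Prop where
  ab : adj a b = 0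
  ac : adj a c = 0
  ad : adj a d = algebraMap ℝ A 3
  bc : adj b c = algebraMap ℝ A (-1)
  bd : adj b d = 0
  cd : adj c d = 0

namespace IsQuad

variable {a b c d : A} (h : IsQuad a b c d)
include h

theorem da : adj d a = algebraMap ℝ A (-3) := by rw [adj_swap, h.ad, map_neg]
theorem cb : adj c b = algebraMap ℝ A 1 := by rw [adj_swap, h.bc, map_neg, neg_neg]
theorem ba : adj b a = 0 := by rw [adj_swap, h.ab, neg_zero]
theorem ca : adj c a = 0 := by rw [adj_swap, h.ac, neg_zero]
theorem db : adj d b = 0 := by rw [adj_swap, h.bd, neg_zero]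
theorem dc : adj d c = 0 := by rw [adj_swap, h.cd, neg_zero]

theorem adj_scalar {g g' : A} (hg : g ∈ ({a, b, c, d} : Set A)) (hg' : g' ∈ ({a, b, c, d} : Set A)) :
    ∃ r : ℝ, adj g g' = algebraMap ℝ A r := by
  simp only [Set.mem_insert_iff, Set.mem_singleton_iff] at hg hg'
  rcases hg with rfl | rfl | rfl | rfl <;> rcases hg' with rfl | rfl | rfl | rfl <;>
  first
  | exact ⟨_, h.ad⟩ | exact ⟨_, h.da⟩ | exact ⟨_, h.bc⟩ | exact ⟨_, h.cb⟩
  | exact ⟨0, by simp only [adj_self, h.ab, h.ac, h.bd, h.cd, h.ba, h.ca, h.db, h.dc, map_zero]⟩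

/-- Every generator has a generator conjugate to it. -/
theorem exists_conjugate {g : A} (hg : g ∈ ({a, b, c, d} : Set A)) :
    ∃ (q : A) (r : ℝ), r ≠ 0 ∧ adj g q = algebraMap ℝ A r := by
  simp only [Set.mem_insert_iff, Set.mem_singleton_iff] at hg
  rcases hg with rfl | rfl | rfl | rfl
  · exact ⟨_, _, by norm_num, h.ad⟩
  · exact ⟨_, _, by norm_num, h.bc⟩
  · exact ⟨_, _, by norm_num, h.cb⟩
  · exact ⟨_, _, by norm_num, h.da⟩

/-- Commutation with a generator is locally nilpotent: it is a derivation that sends the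
generators to scalars. -/
theorem exists_adj_iterate {g x : A} (hg : g ∈ ({a, b, c, d} : Set A))
    (hx : x ∈ Algebra.adjoin ℝ ({a, b, c, d} : Set A)) : ∃ N, (adj g ^ N) x = 0 := by
  induction hx using Algebra.adjoin_induction with
  | mem x hx =>
    obtain ⟨r, hr⟩ := h.adj_scalar hg hx
    exact ⟨2, by rw [pow_two, Module.End.mul_apply, hr, adj_algebraMap]⟩
  | algebraMap r => exact ⟨1, by rw [pow_one, adj_algebraMap]⟩
  | add x y _ _ hx hy => exact exists_adj_iterate_add hx hy
  | mul x y _ _ hx hy => exact exists_adj_iterate_mul hx hy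

/-- Normal ordering: products of the generators are combinations of ordered monomials. -/
theorem adjoin_le_span : Subalgebra.toSubmodule (Algebra.adjoin ℝ ({a, b, c, d} : Set A)) ≤
    Submodule.span ℝ (Set.range fun i : ℕ × ℕ × ℕ × ℕ =>
      a ^ i.1 * (b ^ i.2.1 * (c ^ i.2.2.1 * d ^ i.2.2.2))) := by
  set S := Submodule.span ℝ (Set.range fun i : ℕ × ℕ × ℕ × ℕ =>
      a ^ i.1 * (b ^ i.2.1 * (c ^ i.2.2.1 * d ^ i.2.2.2))) 
  have mem : ∀ i j k l : ℕ, a ^ i * (b ^ j * (c ^ k * d ^ l)) ∈ S := fun i j k l =>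
    Submodule.subset_span ⟨(i, j, k, l), rfl⟩
  have ind : ∀ g : A, (∀ i j k l : ℕ, g * (a ^ i * (b ^ j * (c ^ k * d ^ l))) ∈ S) →
      ∀ x ∈ S, g * x ∈ S := by
    intro g hg x hx
    induction hx using Submodule.span_induction with
    | mem x hx => obtain ⟨i, rfl⟩ := hx; exact hg _ _ _ _
    | zero => rw [mul_zero]; exact S.zero_mem
    | add x y _ _ hx hy => rw [mul_add]; exact S.add_mem hx hy
    | smul r x _ hx => rw [mul_smul_comm]; exact S.smul_mem r hx
  have hba : Commute b a := adj_eq_zero_iff.1 h.ba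
  have hca : Commute c a := adj_eq_zero_iff.1 h.ca
  have hdb : Commute d b := adj_eq_zero_iff.1 h.db
  have hdc : Commute d c := adj_eq_zero_iff.1 h.dc
  have ha : ∀ x ∈ S, a * x ∈ S := ind a fun i j k l => by
    rw [← mul_assoc, ← pow_succ']; exact mem _ _ _ _
  have hb : ∀ x ∈ S, b * x ∈ S := ind b fun i j k l => by
    rw [← mul_assoc, (hba.pow_right i).eq, mul_assoc, ← mul_assoc b, ← pow_succ']
    exact mem _ _ _ _
  have hc : ∀ x ∈ S, c * x ∈ S := ind c fun i j k l => by
    rw [← mul_assoc, (hca.pow_right i).eq, mul_assoc, ← mul_assoc c]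
    rcases j with _ | j
    · rw [pow_zero, mul_one, ← mul_assoc c, ← pow_succ', ← one_mul (c ^ (k + 1) * d ^ l),
        ← pow_zero b]
      exact mem _ _ _ _
    · have := adj_pow_succ h.cb j
      rw [adj_apply, sub_eq_iff_eq_add] at this
      rw [this, add_mul, smul_mul_assoc, mul_add, mul_smul_comm, mul_assoc, ← mul_assoc c,
        ← pow_succ']
      exact S.add_mem (S.smul_mem _ (mem _ _ _ _)) (mem _ _ _ _)
  have hd' : ∀ i j k l : ℕ, a ^ i * (d * (b ^ j * (c ^ k * d ^ l))) ∈ S := fun i j k l => by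
    rw [← mul_assoc d, (hdb.pow_right j).eq, mul_assoc, ← mul_assoc d, (hdc.pow_right k).eq,
      mul_assoc, ← pow_succ']
    exact mem _ _ _ _
  have hd : ∀ x ∈ S, d * x ∈ S := ind d fun i j k l => by
    rw [← mul_assoc]
    rcases i with _ | i
    · rw [pow_zero, mul_one]
      simpa using hd' 0 j k l
    · have := adj_pow_succ h.da i
      rw [adj_apply, sub_eq_iff_eq_add] at this
      rw [this, add_mul, smul_mul_assoc, mul_assoc]
      exact S.add_mem (S.smul_mem _ (mem _ _ _ _)) (hd' _ _ _ _)
  intro x hx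
  replace hx : x ∈ Algebra.adjoin ℝ ({a, b, c, d} : Set A) := hx
  have key : ∀ y ∈ S, x * y ∈ S := by
    induction hx using Algebra.adjoin_induction with
    | mem x hx =>
      simp only [Set.mem_insert_iff, Set.mem_singleton_iff] at hx
      rcases hx with rfl | rfl | rfl | rfl
      exacts [ha, hb, hc, hd]
    | algebraMap r => intro y hy; rw [← Algebra.smul_def]; exact S.smul_mem r hy
    | add x y _ _ hx hy => intro z hz; rw [add_mul]; exact S.add_mem (hx z hz) (hy z hz)
    | mul x y _ _ hx hy => intro z hz; rw [mul_assoc]; exact hx _ (hy z hz)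
  simpa using key 1 (by simpa using mem 0 0 0 0)

/-- The powers are peeled off one at a time: those of `a` are separated by `ad d`, of `b` by
`ad c`, of `c` by `ad b`, and of `d` by `ad a`. -/
theorem linearIndependent [Nontrivial A] : LinearIndependent ℝ (fun i : ℕ × ℕ × ℕ × ℕ =>
      a ^ i.1 * (b ^ i.2.1 * (c ^ i.2.2.1 * d ^ i.2.2.2))) := by
  have pow0 : ∀ {g x : A}, adj g x = 0 → ∀ n : ℕ, adj g (x ^ n) = 0 := fun hg n =>
    adj_eq_zero_iff.2 ((show Commute _ _ from adj_eq_zero_iff.1 hg).pow_right n)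
  have mul0 : ∀ {g x y : A}, adj g x = 0 → adj g y = 0 → adj g (x * y) = 0 := fun hx hy => by
    rw [adj_mul, hx, hy, zero_mul, mul_zero, add_zero]
  have h0 : LinearIndependent ℝ (fun _ : Unit => (1 : A)) := LinearIndependent.of_subsingleton () one_ne_zero
  have h1 := linearIndependent_pow_mul (by norm_num) h.ad h0 fun _ => adj_one a
  have h1' : LinearIndependent ℝ (fun l : ℕ => d ^ l) := by
    simpa [Function.comp_def] using h1.comp (fun l : ℕ => (l, ())) fun x y hxy => (Prod.ext_iff.1 hxy).1
  have h2 := linearIndependent_pow_mul (by norm_num) h.bc h1' fun _ => pow0 h.bd _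
  have h3 := linearIndependent_pow_mul (by norm_num) h.cb h2 fun _ =>
    mul0 (pow0 (adj_self c) _) (pow0 h.cd _)
  exact linearIndependent_pow_mul (by norm_num) h.da h3 fun _ =>
    mul0 (pow0 h.db _) (mul0 (pow0 h.dc _) (pow0 (adj_self d) _))

/-- An algebra homomorphism from an algebra generated by such a quadruple to a nontrivial
algebra is injective. -/
theorem injective_of_adjoin_eq_top {B : Type*} [Ring B] [Algebra ℝ B] [Nontrivial B]
    (hgen : Algebra.adjoin ℝ ({a, b, c, d} : Set A) = ⊤) (f : A →ₐ[ℝ] B) :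
    Function.Injective f := by
  have hadj : ∀ x y, adj (f x) (f y) = f (adj x y) := fun x y => by simp [adj_apply]
  have hB : IsQuad (f a) (f b) (f c) (f d) := by
    constructor <;> simp only [hadj, h.ab, h.ac, h.ad, h.bc, h.bd, h.cd, map_zero, AlgHom.commutes]
  have hli := hB.linearIndependent
  have hspan := h.adjoin_le_span
  rw [hgen] at hspan
  set m := fun i : ℕ × ℕ × ℕ × ℕ => a ^ i.1 * (b ^ i.2.1 * (c ^ i.2.2.1 * d ^ i.2.2.2)) with hm
  have hfm : f.toLinearMap ∘ m = fun i : ℕ × ℕ × ℕ × ℕ =>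
      f a ^ i.1 * (f b ^ i.2.1 * (f c ^ i.2.2.1 * f d ^ i.2.2.2)) := by
    funext i; simp [hm]
  rw [← hfm] at hli
  rw [injective_iff_map_eq_zero]
  intro x hx
  have hx' : x ∈ Submodule.span ℝ (Set.range m) := hspan trivial
  obtain ⟨g, rfl⟩ := Finsupp.mem_span_range_iff_exists_finsupp.1 hx'
  have hg : Finsupp.linearCombination ℝ (f.toLinearMap ∘ m) g = 0 := by
    rw [← hx, Finsupp.linearCombination_apply, Finsupp.sum, Finsupp.sum, map_sum]
    simp
  rw [linearIndependent_iff.1 hli g hg, Finsupp.sum_zero_index]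

/-- Suppose that only scalars commute with all generators. A nonscalar element of a Lie ideal `K`
yields, by taking the last nonscalar iterated commutator with each generator in turn, a nonscalar
`w ∈ K` whose commutators with the generators are scalars. Some `[g, w]` is then nonzero, whence
`[g², w]` is a nonzero multiple of `g`, and `K` contains all commutators with `g`, which exhaust
the algebra. -/
theorem lieIdeal_eq_top (hgen : Algebra.adjoin ℝ ({a, b, c, d} : Set A) = ⊤)
    (hcent : ∀ z : A, (∀ g ∈ ({a, b, c, d} : Set A), adj g z = 0) → ∃ r, z = algebraMap ℝ A r)
    {K : Submodule ℝ A} (hK : ∀ x ∈ K, ∀ y, adj y x ∈ K) {z : A} (hz : z ∈ K)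
    (hz' : ∀ r, z ≠ algebraMap ℝ A r) : K = ⊤ := by
  have step : ∀ g ∈ ({a, b, c, d} : Set A), ∀ z ∈ K, (∀ r, z ≠ algebraMap ℝ A r) →
      ∃ w ∈ K, (∀ r, w ≠ algebraMap ℝ A r) ∧ (∃ r, adj g w = algebraMap ℝ A r) ∧
        ∀ g' ∈ ({a, b, c, d} : Set A), (∃ r, adj g' z = algebraMap ℝ A r) →
          ∃ r, adj g' w = algebraMap ℝ A r := by
    intro g hg z hz hz'
    have hnil : ∃ N r, (adj g ^ N) z = algebraMap ℝ A r := by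
      obtain ⟨N, hN⟩ := h.exists_adj_iterate hg (hgen ▸ trivial : z ∈ _)
      exact ⟨N, 0, by rw [hN, map_zero]⟩
    classical
    obtain ⟨M, hM⟩ : ∃ M, Nat.find hnil = M + 1 := Nat.exists_eq_succ_of_ne_zero fun h0 => by
      obtain ⟨r, hr⟩ := Nat.find_spec hnil
      rw [h0] at hr
      exact hz' r (by simpa using hr)
    refine ⟨(adj g ^ M) z, ?_, ?_, ?_, ?_⟩
    · clear hM
      induction M with
      | zero => simpa
      | succ M ih => rw [pow_succ', Module.End.mul_apply]; exact hK _ ih _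
    · intro r hr
      exact Nat.find_min hnil (m := M) (by omega) ⟨r, hr⟩
    · obtain ⟨r, hr⟩ := Nat.find_spec hnil
      rw [hM, pow_succ', Module.End.mul_apply] at hr
      exact ⟨r, hr⟩
    · intro g' hg' hs
      obtain ⟨ρ, hρ⟩ := h.adj_scalar hg' hg
      clear hM
      induction M with
      | zero => simpa
      | succ M ih =>
        obtain ⟨r, hr⟩ := ih
        refine ⟨0, ?_⟩
        rw [pow_succ', Module.End.mul_apply, adj_adj_comm hρ, hr, adj_algebraMap, map_zero]
  obtain ⟨w₁, hw₁, hn₁, ha₁, -⟩ := step a (by simp) z hz hz'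
  obtain ⟨w₂, hw₂, hn₂, hb₂, hk₂⟩ := step b (by simp) w₁ hw₁ hn₁
  obtain ⟨w₃, hw₃, hn₃, hc₃, hk₃⟩ := step c (by simp) w₂ hw₂ hn₂
  obtain ⟨w, hw, hn, hd, hk⟩ := step d (by simp) w₃ hw₃ hn₃
  have hall : ∀ g ∈ ({a, b, c, d} : Set A), ∃ r, adj g w = algebraMap ℝ A r := by
    intro g hg
    simp only [Set.mem_insert_iff, Set.mem_singleton_iff] at hg
    rcases hg with rfl | rfl | rfl | rfl
    · exact hk _ (by simp) (hk₃ _ (by simp) (hk₂ _ (by simp) ha₁))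
    · exact hk _ (by simp) (hk₃ _ (by simp) hb₂)
    · exact hk _ (by simp) hc₃
    · exact hd
  obtain ⟨g, hg, hgw⟩ : ∃ g ∈ ({a, b, c, d} : Set A), adj g w ≠ 0 := by
    by_contra! hcon
    obtain ⟨r, hr⟩ := hcent w hcon
    exact hn r hr
  obtain ⟨r, hr⟩ := hall g hg
  have hr0 : r ≠ 0 := by
    rintro rfl
    exact hgw (by rw [hr, map_zero])
  have hgK : g ∈ K := by
    have h1 : adj (g * g) w = (2 * r) • g := by
      rw [adj_mul_left, hr, ← Algebra.commutes, ← Algebra.smul_def, ← add_smul, two_mul]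
    have h2 := hK w hw (g * g)
    rw [h1] at h2
    exact (K.smul_mem_iff (mul_ne_zero two_ne_zero hr0)).1 h2
  obtain ⟨q, ρ, hρ, hq⟩ := h.exists_conjugate hg
  refine Submodule.eq_top_iff'.2 fun x => ?_
  obtain ⟨N, hN⟩ := h.exists_adj_iterate hg (hgen ▸ trivial : x ∈ _)
  obtain ⟨y, rfl⟩ := exists_adj_eq hρ hq N hN
  rw [adj_swap]
  exact K.neg_mem (hK g hgK y)

end IsQuad

end Algebra

/-! ### Differential operators in total derivatives -/

theorem partialD_u_of_isBase {f : DiffFun} (hf : IsBase f) (k l : ℕ) :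
    partialD (.u k l) f = 0 :=
  partialD_of_notMem hf (by simp)

theorem IsBase.Dx {f : DiffFun} (hf : IsBase f) : IsBase (Dx f) :=
  isBase_field isBase_zero isBase_one isBase_zero hf

theorem IsBase.Dy {f : DiffFun} (hf : IsBase f) : IsBase (Dy f) :=
  isBase_field isBase_zero isBase_zero isBase_one hf

theorem IsBase.Dt {f : DiffFun} (hf : IsBase f) : IsBase (Dt f) :=
  isBase_field isBase_one isBase_zero isBase_zero hf

theorem IsBase.mul {f g : DiffFun} (hf : IsBase f) (hg : IsBase g) : IsBase (f * g) :=
  IsSmoothIn.mul hf hg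

theorem IsBase.add {f g : DiffFun} (hf : IsBase f) (hg : IsBase g) : IsBase (f + g) :=
  IsSmoothIn.add hf hg

theorem IsBase.smul {f : DiffFun} (r : ℝ) (hf : IsBase f) : IsBase (r • f) := by
  rw [Algebra.smul_def]
  exact (isBase_const r).mul hf

theorem isBase_t : IsBase (coord .t) := isSmoothIn_coord (by simp)
theorem isBase_x : IsBase (coord .x) := isSmoothIn_coord (by simp)
theorem isBase_y : IsBase (coord .y) := isSmoothIn_coord (by simp)

/-- `D_x` as a linear operator. -/
def opX : Module.End ℝ DiffFun := Dx.toLinearMap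

/-- `D_y` as a linear operator. -/
def opY : Module.End ℝ DiffFun := Dy.toLinearMap

/-- The operator `f D_x ^ k D_y ^ l`, linear in `f`. -/
def monomialOp (k l : ℕ) : DiffFun →ₗ[ℝ] Module.End ℝ DiffFun :=
  LinearMap.mulRight ℝ (opX ^ k * opY ^ l) ∘ₗ (LinearMap.mul ℝ DiffFun)

theorem monomialOp_eq (k l : ℕ) (f : DiffFun) :
    monomialOp k l f = mulOp f * (opX ^ k * opY ^ l) := rfl

theorem mulOp_mul (f g : DiffFun) : mulOp (f * g) = mulOp f * mulOp g := by
  ext h; simp [mulOp]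

theorem mulOp_algebraMap (r : ℝ) : mulOp (algebraMap ℝ DiffFun r) =
    algebraMap ℝ (Module.End ℝ DiffFun) r := by
  ext h; simp [mulOp, Algebra.smul_def]

theorem adj_derivation_mulOp (D : Derivation ℝ DiffFun DiffFun) (f : DiffFun) :
    adj (D.toLinearMap : Module.End ℝ DiffFun) (mulOp f) = mulOp (D f) := by
  ext g
  simp [adj_apply, mulOp, Derivation.leibniz, mul_comm]

theorem adj_opX_mulOp (f : DiffFun) : adj opX (mulOp f) = mulOp (Dx f) :=
  adj_derivation_mulOp Dx f

theorem adj_opY_mulOp (f : DiffFun) : adj opY (mulOp f) = mulOp (Dy f) :=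
  adj_derivation_mulOp Dy f

theorem adj_mulOp_mulOp (f g : DiffFun) : adj (mulOp f) (mulOp g) = 0 := by
  rw [adj_apply, ← mulOp_mul, ← mulOp_mul, mul_comm, sub_self]

theorem commute_opX_opY : Commute opX opY := by
  ext f; exact Dx_Dy f

theorem Dx_t : Dx (coord .t) = 0 := by rw [Dx, field_coord]
theorem Dx_x : Dx (coord .x) = 1 := by rw [Dx, field_coord]
theorem Dx_y : Dx (coord .y) = 0 := by rw [Dx, field_coord]
theorem Dy_t : Dy (coord .t) = 0 := by rw [Dy, field_coord]
theorem Dy_x : Dy (coord .x) = 0 := by rw [Dy, field_coord]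
theorem Dy_y : Dy (coord .y) = 1 := by rw [Dy, field_coord]
theorem Dt_t : Dt (coord .t) = 1 := by rw [Dt, field_coord]
theorem Dt_x : Dt (coord .x) = 0 := by rw [Dt, field_coord]
theorem Dt_y : Dt (coord .y) = 0 := by rw [Dt, field_coord]

theorem mulOp_one : mulOp 1 = 1 := by ext h; simp [mulOp]
theorem mulOp_zero : mulOp 0 = 0 := by ext h; simp [mulOp]

theorem adj_opX_monomialOp (f : DiffFun) (k l : ℕ) :
    adj opX (monomialOp k l f) = monomialOp k l (Dx f) := by
  have h : Commute opX (opX ^ k * opY ^ l) :=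
    ((Commute.refl opX).pow_right k).mul_right (commute_opX_opY.pow_right l)
  rw [monomialOp_eq, adj_mul, adj_opX_mulOp, adj_eq_zero_iff.2 h, mul_zero, add_zero, monomialOp_eq]

theorem adj_opY_monomialOp (f : DiffFun) (k l : ℕ) :
    adj opY (monomialOp k l f) = monomialOp k l (Dy f) := by
  have h : Commute opY (opX ^ k * opY ^ l) :=
    (commute_opX_opY.symm.pow_right k).mul_right ((Commute.refl opY).pow_right l)
  rw [monomialOp_eq, adj_mul, adj_opY_mulOp, adj_eq_zero_iff.2 h, mul_zero, add_zero, monomialOp_eq]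

theorem adj_opT_monomialOp (f : DiffFun) (k l : ℕ) :
    adj (Dt.toLinearMap : Module.End ℝ DiffFun) (monomialOp k l f) = monomialOp k l (Dt f) := by
  have h1 : Commute (Dt.toLinearMap : Module.End ℝ DiffFun) opX := by ext f; exact Dt_Dx f
  have h2 : Commute (Dt.toLinearMap : Module.End ℝ DiffFun) opY := by ext f; exact Dt_Dy f
  rw [monomialOp_eq, adj_mul, adj_derivation_mulOp,
    adj_eq_zero_iff.2 ((h1.pow_right k).mul_right (h2.pow_right l)), mul_zero, add_zero,
    monomialOp_eq]

theorem opX_mul_monomialOp (f : DiffFun) (k l : ℕ) :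
    opX * monomialOp k l f = monomialOp k l (Dx f) + monomialOp (k + 1) l f := by
  have h := adj_opX_mulOp f
  rw [adj_apply, sub_eq_iff_eq_add] at h
  rw [monomialOp_eq, ← mul_assoc, h, add_mul, monomialOp_eq, monomialOp_eq, mul_assoc (mulOp f),
    ← mul_assoc opX, ← pow_succ']

theorem opY_mul_monomialOp (f : DiffFun) (k l : ℕ) :
    opY * monomialOp k l f = monomialOp k l (Dy f) + monomialOp k (l + 1) f := by
  have h := adj_opY_mulOp f
  rw [adj_apply, sub_eq_iff_eq_add] at h
  rw [monomialOp_eq, ← mul_assoc, h, add_mul, monomialOp_eq, monomialOp_eq, mul_assoc (mulOp f),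
    ← mul_assoc opY, (commute_opX_opY.symm.pow_right k).eq, mul_assoc, ← pow_succ']

theorem mulOp_mul_monomialOp (f g : DiffFun) (k l : ℕ) :
    mulOp g * monomialOp k l f = monomialOp k l (g * f) := by
  rw [monomialOp_eq, monomialOp_eq, mulOp_mul, mul_assoc]

theorem monomialOp_mul_opY (f : DiffFun) (k l : ℕ) :
    monomialOp k l f * opY = monomialOp k (l + 1) f := by
  rw [monomialOp_eq, monomialOp_eq, pow_succ]
  simp only [mul_assoc]

theorem monomialOp_mul_opX (f : DiffFun) (k l : ℕ) :
    monomialOp k l f * opX = monomialOp (k + 1) l f := by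
  rw [monomialOp_eq, monomialOp_eq, mul_assoc, mul_assoc, ← (commute_opX_opY.pow_right l).eq,
    pow_succ, mul_assoc]

theorem opX_pow_apply (k : ℕ) (f : DiffFun) : (opX ^ k) f = (⇑Dx)^[k] f := by
  rw [Module.End.pow_apply]; rfl

theorem opY_pow_apply (k : ℕ) (f : DiffFun) : (opY ^ k) f = (⇑Dy)^[k] f := by
  rw [Module.End.pow_apply]; rfl

theorem monomialOp_apply (f g : DiffFun) (k l : ℕ) :
    monomialOp k l f g = f * (⇑Dx)^[k] ((⇑Dy)^[l] g) := by
  rw [monomialOp_eq, Module.End.mul_apply, Module.End.mul_apply, opX_pow_apply, opY_pow_apply]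
  rfl

theorem iter_Dx_Dy_coord (k l : ℕ) :
    (⇑Dx)^[k] ((⇑Dy)^[l] (coord (.u 0 0))) = coord (.u k l) := by
  have h1 : (⇑Dy)^[l] (coord (.u 0 0)) = coord (.u 0 l) := by
    induction l with
    | zero => rfl
    | succ l ih => rw [Function.iterate_succ_apply', ih, Dy, field_coord]
  rw [h1]
  induction k with
  | zero => rfl
  | succ k ih => rw [Function.iterate_succ_apply', ih, Dx, field_coord]

theorem monomialOp_apply_u (f : DiffFun) (k l : ℕ) :
    monomialOp k l f (coord (.u 0 0)) = f * coord (.u k l) := by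
  rw [monomialOp_apply, iter_Dx_Dy_coord]

/-- The linear span of the operators `f D_x ^ k D_y ^ l` with `f` a function of `t`, `x`, `y`. -/
def diffOpSpan : Submodule ℝ (Module.End ℝ DiffFun) :=
  Submodule.span ℝ {Q | ∃ (f : DiffFun) (k l : ℕ), IsBase f ∧ Q = monomialOp k l f}

theorem monomialOp_mem_span {f : DiffFun} (hf : IsBase f) (k l : ℕ) :
    monomialOp k l f ∈ diffOpSpan :=
  Submodule.subset_span ⟨f, k, l, hf, rfl⟩

theorem mul_mem_diffOpSpan {Q R : Module.End ℝ DiffFun} (hQ : Q ∈ diffOpSpan)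
    (hR : R ∈ diffOpSpan) : Q * R ∈ diffOpSpan := by
  have ind : ∀ Q : Module.End ℝ DiffFun,
      (∀ f k l, IsBase f → Q * monomialOp k l f ∈ diffOpSpan) →
      ∀ R ∈ diffOpSpan, Q * R ∈ diffOpSpan := by
    intro Q hQ R hR
    induction hR using Submodule.span_induction with
    | mem x hx => obtain ⟨f, k, l, hf, rfl⟩ := hx; exact hQ f k l hf
    | zero => rw [mul_zero]; exact diffOpSpan.zero_mem
    | add x y _ _ hx hy => rw [mul_add]; exact diffOpSpan.add_mem hx hy
    | smul r x _ hx => rw [mul_smul_comm]; exact diffOpSpan.smul_mem r hx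
  have pow : ∀ Q : Module.End ℝ DiffFun, (∀ R ∈ diffOpSpan, Q * R ∈ diffOpSpan) →
      ∀ n : ℕ, ∀ R ∈ diffOpSpan, Q ^ n * R ∈ diffOpSpan := by
    intro Q hQ n
    induction n with
    | zero => intro R hR; simpa
    | succ n ih => intro R hR; rw [pow_succ, mul_assoc]; exact ih _ (hQ R hR)
  have hX := pow opX (ind opX fun f k l hf => by
    rw [opX_mul_monomialOp]
    exact diffOpSpan.add_mem (monomialOp_mem_span hf.Dx _ _) (monomialOp_mem_span hf _ _))
  have hY := pow opY (ind opY fun f k l hf => by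
    rw [opY_mul_monomialOp]
    exact diffOpSpan.add_mem (monomialOp_mem_span hf.Dy _ _) (monomialOp_mem_span hf _ _))
  induction hQ using Submodule.span_induction with
  | mem x hx =>
    obtain ⟨f, k, l, hf, rfl⟩ := hx
    rw [monomialOp_eq, mul_assoc, mul_assoc]
    refine ind _ (fun g k l hg => ?_) _ (hX k _ (hY l _ hR))
    rw [mulOp_mul_monomialOp]
    exact monomialOp_mem_span (hf.mul hg) _ _
  | zero => rw [zero_mul]; exact diffOpSpan.zero_mem
  | add x y _ _ hx hy => rw [add_mul]; exact diffOpSpan.add_mem hx hy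
  | smul r x _ hx => rw [smul_mul_assoc]; exact diffOpSpan.smul_mem r hx

theorem mulOp_eq_monomialOp (f : DiffFun) : mulOp f = monomialOp 0 0 f := by
  rw [monomialOp_eq]; simp

/-- The algebra of differential operators in the total derivatives `D_x`, `D_y` with coefficients
depending on `t`, `x`, `y`. -/
def diffOps : Subalgebra ℝ (Module.End ℝ DiffFun) where
  carrier := diffOpSpan
  mul_mem' := mul_mem_diffOpSpan
  add_mem' := diffOpSpan.add_mem
  algebraMap_mem' r := by
    rw [← mulOp_algebraMap, mulOp_eq_monomialOp]
    exact monomialOp_mem_span (isBase_const r) 0 0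

theorem monomialOp_mem {f : DiffFun} (hf : IsBase f) (k l : ℕ) : monomialOp k l f ∈ diffOps :=
  monomialOp_mem_span hf k l

theorem mulOp_mem {f : DiffFun} (hf : IsBase f) : mulOp f ∈ diffOps := by
  rw [mulOp_eq_monomialOp]
  exact monomialOp_mem hf 0 0

theorem opX_mem : opX ∈ diffOps := by
  have := monomialOp_mem isBase_one 1 0
  rwa [monomialOp_eq, mulOp_one, one_mul, pow_one, pow_zero, mul_one] at this

theorem opY_mem : opY ∈ diffOps := by
  have := monomialOp_mem isBase_one 0 1
  rwa [monomialOp_eq, mulOp_one, one_mul, pow_one, pow_zero, one_mul] at this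

@[elab_as_elim]
theorem diffOps_induction {P : Module.End ℝ DiffFun → Prop}
    (mon : ∀ f k l, IsBase f → P (monomialOp k l f)) (add : ∀ Q R, P Q → P R → P (Q + R))
    (smul : ∀ (r : ℝ) Q, P Q → P (r • Q)) {Q : Module.End ℝ DiffFun} (hQ : Q ∈ diffOps) : P Q := by
  replace hQ : Q ∈ diffOpSpan := hQ
  induction hQ using Submodule.span_induction with
  | mem x hx => obtain ⟨f, k, l, hf, rfl⟩ := hx; exact mon f k l hf
  | zero => rw [← map_zero (monomialOp 0 0)]; exact mon 0 0 0 isBase_zero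
  | add x y _ _ hx hy => exact add x y hx hy
  | smul r x _ hx => exact smul r x hx

theorem eq_of_eq_monomialOp {M : Type*} [AddCommGroup M] [Module ℝ M]
    {φ ψ : Module.End ℝ DiffFun →ₗ[ℝ] M}
    (h : ∀ f k l, IsBase f → φ (monomialOp k l f) = ψ (monomialOp k l f))
    {Q : Module.End ℝ DiffFun} (hQ : Q ∈ diffOps) : φ Q = ψ Q :=
  diffOps_induction (P := fun Q => φ Q = ψ Q) h
    (fun Q R hQ hR => by rw [map_add, map_add, hQ, hR])
    (fun r Q hQ => by rw [map_smul, map_smul, hQ]) hQ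

/-! ### Coefficients -/

/-- The coefficient of `D_x ^ k D_y ^ l` in a differential operator `Q`, read off from `Q u`. -/
def coef (k l : ℕ) : Module.End ℝ DiffFun →ₗ[ℝ] DiffFun :=
  (partialD (.u k l)).toLinearMap ∘ₗ LinearMap.applyₗ (coord (.u 0 0))

theorem coef_apply (k l : ℕ) (Q : Module.End ℝ DiffFun) :
    coef k l Q = partialD (.u k l) (Q (coord (.u 0 0))) := rfl

theorem coef_monomialOp {f : DiffFun} (hf : IsBase f) (k l a b : ℕ) :
    coef k l (monomialOp a b f) = if k = a ∧ l = b then f else 0 := by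
  rw [coef_apply, monomialOp_apply_u, Derivation.leibniz, partialD_u_of_isBase hf, partialD_coord]
  by_cases h : k = a ∧ l = b
  · simp [h]
  · rw [if_neg h, if_neg (fun h' => h (by simpa using h'))]
    simp

theorem isBase_coef {Q : Module.End ℝ DiffFun} (hQ : Q ∈ diffOps) (k l : ℕ) :
    IsBase (coef k l Q) := by
  refine diffOps_induction (fun f a b hf => ?_) (fun Q R hQ hR => ?_) (fun r Q hQ => ?_) hQ
  · rw [coef_monomialOp hf]
    split_ifs
    exacts [hf, isBase_zero]
  · rw [map_add]; exact hQ.add hR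
  · rw [map_smul]; exact hQ.smul r

theorem exists_coef_eq_zero {Q : Module.End ℝ DiffFun} (hQ : Q ∈ diffOps) :
    ∃ n, ∀ k l, n ≤ k + l → coef k l Q = 0 := by
  refine diffOps_induction (fun f a b hf => ?_) (fun Q R hQ hR => ?_) (fun r Q hQ => ?_) hQ
  · refine ⟨a + b + 1, fun k l h => ?_⟩
    rw [coef_monomialOp hf, if_neg (by omega)]
  · obtain ⟨n, hn⟩ := hQ
    obtain ⟨m, hm⟩ := hR
    exact ⟨max n m, fun k l h => by
      rw [map_add, hn k l (by omega), hm k l (by omega), add_zero]⟩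
  · obtain ⟨n, hn⟩ := hQ
    exact ⟨n, fun k l h => by rw [map_smul, hn k l h, smul_zero]⟩

theorem exists_eq_sum_coef {Q : Module.End ℝ DiffFun} (hQ : Q ∈ diffOps) :
    ∃ n, ∀ m, n ≤ m →
      Q = ∑ kl ∈ Finset.range m ×ˢ Finset.range m, monomialOp kl.1 kl.2 (coef kl.1 kl.2 Q) := by
  refine diffOps_induction (fun f a b hf => ?_) (fun Q R hQ hR => ?_) (fun r Q hQ => ?_) hQ
  · refine ⟨a + b + 1, fun m hm => ?_⟩
    rw [Finset.sum_eq_single (a, b)]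
    · rw [coef_monomialOp hf, if_pos ⟨rfl, rfl⟩]
    · rintro ⟨k, l⟩ _ h
      rw [coef_monomialOp hf, if_neg (fun h' => h (Prod.ext h'.1 h'.2)), map_zero]
    · intro h
      refine absurd ?_ h
      simp only [Finset.mem_product, Finset.mem_range]
      omega
  · obtain ⟨n, hn⟩ := hQ
    obtain ⟨m, hm⟩ := hR
    refine ⟨max n m, fun k h => ?_⟩
    simp only [map_add, Finset.sum_add_distrib]
    rw [← hn k (by omega), ← hm k (by omega)]
  · obtain ⟨n, hn⟩ := hQ
    refine ⟨n, fun k h => ?_⟩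
    simp only [map_smul, ← Finset.smul_sum]
    rw [← hn k h]

theorem eq_zero_of_coef_eq_zero {Q : Module.End ℝ DiffFun} (hQ : Q ∈ diffOps)
    (h : ∀ k l, coef k l Q = 0) : Q = 0 := by
  obtain ⟨n, hn⟩ := exists_eq_sum_coef hQ
  rw [hn n le_rfl]
  exact Finset.sum_eq_zero fun kl _ => by rw [h, map_zero]

/-- A differential operator is determined by its action on `u`. -/
theorem eq_zero_of_apply_u_eq_zero {Q : Module.End ℝ DiffFun} (hQ : Q ∈ diffOps)
    (h : Q (coord (.u 0 0)) = 0) : Q = 0 :=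
  eq_zero_of_coef_eq_zero hQ fun k l => by rw [coef_apply, h, map_zero]

/-- The array `c (k - 1) l`, extended by zero. -/
def shiftX (c : ℕ → ℕ → DiffFun) : ℕ → ℕ → DiffFun
  | 0, _ => 0
  | k + 1, l => c k l

/-- The array `c k (l - 1)`, extended by zero. -/
def shiftY (c : ℕ → ℕ → DiffFun) : ℕ → ℕ → DiffFun
  | _, 0 => 0
  | k, l + 1 => c k l

theorem adj_mulOp_t_monomialOp (f : DiffFun) (k l : ℕ) :
    adj (mulOp (coord .t)) (monomialOp k l f) = 0 := by
  have h1 : Commute (mulOp (coord .t)) opX := (adj_eq_zero_iff.1 (by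
    rw [adj_opX_mulOp, Dx_t, mulOp_zero])).symm
  have h2 : Commute (mulOp (coord .t)) opY := (adj_eq_zero_iff.1 (by
    rw [adj_opY_mulOp, Dy_t, mulOp_zero])).symm
  rw [monomialOp_eq, adj_mul, adj_mulOp_mulOp, zero_mul, zero_add,
    adj_eq_zero_iff.2 ((h1.pow_right k).mul_right (h2.pow_right l)), mul_zero]

theorem adj_mulOp_x_opX : adj (mulOp (coord .x)) opX = algebraMap ℝ _ (-1) := by
  rw [adj_swap, adj_opX_mulOp, Dx_x, mulOp_one, map_neg, map_one]

theorem adj_mulOp_y_opY : adj (mulOp (coord .y)) opY = algebraMap ℝ _ (-1) := by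
  rw [adj_swap, adj_opY_mulOp, Dy_y, mulOp_one, map_neg, map_one]

theorem adj_mulOp_x_monomialOp (f : DiffFun) (k l : ℕ) :
    adj (mulOp (coord .x)) (monomialOp k l f) = -((k : ℝ) • monomialOp (k - 1) l f) := by
  have h2 : Commute (mulOp (coord .x)) opY := (adj_eq_zero_iff.1 (by
    rw [adj_opY_mulOp, Dy_x, mulOp_zero])).symm
  rw [monomialOp_eq, adj_mul, adj_mulOp_mulOp, zero_mul, zero_add, adj_mul,
    adj_eq_zero_iff.2 (h2.pow_right l), mul_zero, add_zero]
  rcases k with _ | k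
  · simp [adj_one]
  · rw [adj_pow_succ adj_mulOp_x_opX, monomialOp_eq, smul_mul_assoc, mul_smul_comm, mul_neg_one, neg_smul]
    simp

theorem adj_mulOp_y_monomialOp (f : DiffFun) (k l : ℕ) :
    adj (mulOp (coord .y)) (monomialOp k l f) = -((l : ℝ) • monomialOp k (l - 1) f) := by
  have h2 : Commute (mulOp (coord .y)) opX := (adj_eq_zero_iff.1 (by
    rw [adj_opX_mulOp, Dx_y, mulOp_zero])).symm
  rw [monomialOp_eq, adj_mul, adj_mulOp_mulOp, zero_mul, zero_add, adj_mul,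
    adj_eq_zero_iff.2 (h2.pow_right k), zero_mul, zero_add]
  rcases l with _ | l
  · simp [adj_one]
  · rw [adj_pow_succ adj_mulOp_y_opY, monomialOp_eq, mul_smul_comm, mul_smul_comm, mul_neg_one, neg_smul]
    simp

section CoefLemmas

variable {Q : Module.End ℝ DiffFun} (hQ : Q ∈ diffOps) (k l : ℕ)
include hQ

theorem coef_mulOp_mul {g : DiffFun} (hg : IsBase g) : coef k l (mulOp g * Q) = g * coef k l Q := by
  refine eq_of_eq_monomialOp (φ := coef k l ∘ₗ LinearMap.mulLeft ℝ (mulOp g))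
    (ψ := LinearMap.mulLeft ℝ g ∘ₗ coef k l) (fun f a b hf => ?_) hQ
  simp only [LinearMap.comp_apply, LinearMap.mulLeft_apply]
  rw [mulOp_mul_monomialOp, coef_monomialOp (hg.mul hf), coef_monomialOp hf]
  split_ifs <;> simp

theorem coef_mul_opX : coef k l (Q * opX) = shiftX (fun k l => coef k l Q) k l := by
  cases k with
  | zero =>
    refine eq_of_eq_monomialOp (φ := coef 0 l ∘ₗ LinearMap.mulRight ℝ opX)
      (ψ := 0) (fun f a b hf => ?_) hQ
    simp only [LinearMap.comp_apply, LinearMap.mulRight_apply, LinearMap.zero_apply]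
    rw [monomialOp_mul_opX, coef_monomialOp hf, if_neg (by simp)]
  | succ k =>
    refine eq_of_eq_monomialOp (φ := coef (k + 1) l ∘ₗ LinearMap.mulRight ℝ opX)
      (ψ := coef k l) (fun f a b hf => ?_) hQ
    simp only [LinearMap.comp_apply, LinearMap.mulRight_apply]
    rw [monomialOp_mul_opX, coef_monomialOp hf, coef_monomialOp hf]
    simp

theorem coef_mul_opY : coef k l (Q * opY) = shiftY (fun k l => coef k l Q) k l := by
  cases l with
  | zero =>
    refine eq_of_eq_monomialOp (φ := coef k 0 ∘ₗ LinearMap.mulRight ℝ opY)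
      (ψ := 0) (fun f a b hf => ?_) hQ
    simp only [LinearMap.comp_apply, LinearMap.mulRight_apply, LinearMap.zero_apply]
    rw [monomialOp_mul_opY, coef_monomialOp hf, if_neg (by simp)]
  | succ l =>
    refine eq_of_eq_monomialOp (φ := coef k (l + 1) ∘ₗ LinearMap.mulRight ℝ opY)
      (ψ := coef k l) (fun f a b hf => ?_) hQ
    simp only [LinearMap.comp_apply, LinearMap.mulRight_apply]
    rw [monomialOp_mul_opY, coef_monomialOp hf, coef_monomialOp hf]
    simp

theorem coef_adj_opX : coef k l (adj opX Q) = Dx (coef k l Q) := by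
  refine eq_of_eq_monomialOp (φ := coef k l ∘ₗ adj opX)
    (ψ := Dx.toLinearMap ∘ₗ coef k l) (fun f a b hf => ?_) hQ
  simp only [LinearMap.comp_apply, Derivation.coeFn_coe]
  rw [adj_opX_monomialOp, coef_monomialOp hf, coef_monomialOp hf.Dx]
  split_ifs <;> simp

theorem coef_adj_opY : coef k l (adj opY Q) = Dy (coef k l Q) := by
  refine eq_of_eq_monomialOp (φ := coef k l ∘ₗ adj opY)
    (ψ := Dy.toLinearMap ∘ₗ coef k l) (fun f a b hf => ?_) hQ
  simp only [LinearMap.comp_apply, Derivation.coeFn_coe]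
  rw [adj_opY_monomialOp, coef_monomialOp hf, coef_monomialOp hf.Dy]
  split_ifs <;> simp

theorem adj_opT_mem : adj (Dt.toLinearMap : Module.End ℝ DiffFun) Q ∈ diffOps := by
  refine diffOps_induction
    (P := fun Q => adj (Dt.toLinearMap : Module.End ℝ DiffFun) Q ∈ diffOps) (fun f a b hf => ?_) (fun Q R hQ hR => ?_) (fun r Q hQ => ?_) hQ
  · rw [adj_opT_monomialOp]; exact monomialOp_mem hf.Dt _ _
  · rw [map_add]; exact diffOps.add_mem hQ hR
  · rw [map_smul]; exact diffOps.smul_mem hQ r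

theorem coef_adj_opT :
    coef k l (adj (Dt.toLinearMap : Module.End ℝ DiffFun) Q) = Dt (coef k l Q) := by
  refine eq_of_eq_monomialOp (φ := coef k l ∘ₗ adj (Dt.toLinearMap : Module.End ℝ DiffFun))
    (ψ := Dt.toLinearMap ∘ₗ coef k l) (fun f a b hf => ?_) hQ
  simp only [LinearMap.comp_apply, Derivation.coeFn_coe]
  rw [adj_opT_monomialOp, coef_monomialOp hf, coef_monomialOp hf.Dt]
  split_ifs <;> simp

theorem adj_mulOp_t : adj (mulOp (coord .t)) Q = 0 :=
  eq_of_eq_monomialOp (φ := adj (mulOp (coord .t))) (ψ := 0)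
    (fun f a b _ => adj_mulOp_t_monomialOp f a b) hQ

theorem coef_adj_mulOp_x :
    coef k l (adj (mulOp (coord .x)) Q) = -((k + 1 : ℝ) • coef (k + 1) l Q) := by
  refine eq_of_eq_monomialOp (φ := coef k l ∘ₗ adj (mulOp (coord .x)))
    (ψ := -((k + 1 : ℝ) • coef (k + 1) l)) (fun f a b hf => ?_) hQ
  simp only [LinearMap.comp_apply, LinearMap.neg_apply, LinearMap.smul_apply]
  rw [adj_mulOp_x_monomialOp, map_neg, map_smul, coef_monomialOp hf, coef_monomialOp hf]
  rcases a with _ | a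
  · simp
  · by_cases h : k = a ∧ l = b
    · simp [h]
    · simp [h]

theorem coef_adj_mulOp_y :
    coef k l (adj (mulOp (coord .y)) Q) = -((l + 1 : ℝ) • coef k (l + 1) Q) := by
  refine eq_of_eq_monomialOp (φ := coef k l ∘ₗ adj (mulOp (coord .y)))
    (ψ := -((l + 1 : ℝ) • coef k (l + 1))) (fun f a b hf => ?_) hQ
  simp only [LinearMap.comp_apply, LinearMap.neg_apply, LinearMap.smul_apply]
  rw [adj_mulOp_y_monomialOp, map_neg, map_smul, coef_monomialOp hf, coef_monomialOp hf]
  rcases b with _ | b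
  · simp
  · by_cases h : k = a ∧ l = b
    · simp [h]
    · simp [h]

end CoefLemmas

theorem adj_mem {P Q : Module.End ℝ DiffFun} (hP : P ∈ diffOps) (hQ : Q ∈ diffOps) :
    adj P Q ∈ diffOps :=
  diffOps.sub_mem (diffOps.mul_mem hP hQ) (diffOps.mul_mem hQ hP)

/-- The operator `F = D_t + x D_y - D_x ^ 2` as an element of the algebra of linear operators. -/
def opFEnd : Module.End ℝ DiffFun := Dt.toLinearMap + mulOp (coord .x) * opY - opX * opX

theorem opFEnd_apply (f : DiffFun) : opFEnd f = opF f := rfl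

theorem adj_opFEnd (Q : Module.End ℝ DiffFun) : adj opFEnd Q =
    adj (Dt.toLinearMap : Module.End ℝ DiffFun) Q + mulOp (coord .x) * adj opY Q +
      adj (mulOp (coord .x)) Q * opY - (adj opX (adj opX Q) + (2 : ℝ) • (adj opX Q * opX)) := by
  rw [two_smul]
  simp only [opFEnd, adj_apply, mul_add, add_mul, mul_sub, sub_mul, mul_assoc]
  abel

theorem adj_opFEnd_mem {Q : Module.End ℝ DiffFun} (hQ : Q ∈ diffOps) :
    adj opFEnd Q ∈ diffOps := by
  have h1 := adj_mem opX_mem hQ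
  have h2 := mulOp_mem isBase_x
  rw [adj_opFEnd]
  exact diffOps.sub_mem (diffOps.add_mem (diffOps.add_mem (adj_opT_mem hQ)
    (diffOps.mul_mem h2 (adj_mem opY_mem hQ))) (diffOps.mul_mem (adj_mem h2 hQ) opY_mem))
    (diffOps.add_mem (adj_mem opX_mem h1) (diffOps.smul_mem (diffOps.mul_mem h1 opX_mem) 2))

/-- The determining equations of symmetry operators. -/
theorem coef_adj_opFEnd {Q : Module.End ℝ DiffFun} (hQ : Q ∈ diffOps) (k l : ℕ) :
    coef k l (adj opFEnd Q) = opF (coef k l Q)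
      - (k + 1 : ℝ) • shiftY (fun k l => coef k l Q) (k + 1) l
      - (2 : ℝ) • Dx (shiftX (fun k l => coef k l Q) k l) := by
  have h1 := adj_mem opX_mem hQ
  have h2 := adj_mem (mulOp_mem isBase_x) hQ
  have h3 : shiftY (fun k l => coef k l (adj (mulOp (coord .x)) Q)) k l =
      -((k + 1 : ℝ) • shiftY (fun k l => coef k l Q) (k + 1) l) := by
    cases l with
    | zero => simp [shiftY]
    | succ l => exact coef_adj_mulOp_x hQ k l
  have h4 : shiftX (fun k l => coef k l (adj opX Q)) k l =
      Dx (shiftX (fun k l => coef k l Q) k l) := by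
    cases k with
    | zero => simp [shiftX]
    | succ k => exact coef_adj_opX hQ k l
  rw [adj_opFEnd, map_sub, map_add, map_add, map_add, map_smul, coef_adj_opT hQ,
    coef_mulOp_mul (adj_mem opY_mem hQ) k l isBase_x, coef_adj_opY hQ, coef_mul_opY h2,
    coef_adj_opX h1, coef_adj_opX hQ, coef_mul_opX h1, h3, h4, opF]
  abel

/-! ### Coefficients of symmetry operators -/

/-- On a function of degree at most `m` in `x`, only the term `x D_y` of `F` raises the degree. -/
theorem opF_iter_Dx {f : DiffFun} {m : ℕ} (hf : (⇑Dx)^[m + 1] f = 0) :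
    (⇑Dx)^[m + 1] (opF f) = (m + 1 : ℝ) • Dy ((⇑Dx)^[m] f) := by
  have h1 : (⇑Dx)^[m + 1] (Dx (Dx f)) = 0 := by
    rw [← Function.iterate_succ_apply, ← Function.iterate_succ_apply,
      Function.iterate_succ_apply', Function.iterate_succ_apply', hf, map_zero, map_zero]
  rw [opF, iter_Dx_sub, iter_Dx_add, h1, ← iter_Dt_Dx, hf, map_zero, iter_Dx_x_mul, ← iter_Dy_Dx,
    hf, map_zero, mul_zero, zero_add, zero_add, sub_zero, Nat.add_sub_cancel, ← iter_Dy_Dx,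
    Algebra.smul_def]
  simp

theorem opF_Dy (f : DiffFun) : opF (Dy f) = Dy (opF f) := by
  simp only [opF, map_add, map_sub, Dt_Dy, Dy_x_mul, Dx_Dy]

section Coefficients

variable {c : ℕ → ℕ → DiffFun} {n : ℕ}

theorem shiftY_of_le {k l j : ℕ} (h : ∀ k l, j ≤ k + l → c k l = 0) (hkl : j ≤ k + l - 1) :
    shiftY c k l = 0 := by
  cases l with
  | zero => rfl
  | succ l => exact h k l (by omega)

variable (hc : ∀ k l, opF (c k l) = (k + 1 : ℝ) • shiftY c (k + 1) l +
    (2 : ℝ) • Dx (shiftX c k l))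
  (hn : ∀ k l, n < k + l → c k l = 0)
include hc hn

/-- The coefficients of order `n - j` are polynomials in `x` of degree at most `2 j`. -/
theorem iter_Dx_coef_eq_zero (j : ℕ) {k l : ℕ} (h : k + l + j = n) :
    (⇑Dx)^[2 * j + 1] (c k l) = 0 := by
  have h2 : (2 : ℝ) ≠ 0 := two_ne_zero
  induction j generalizing k l with
  | zero =>
    have h1 := hc (k + 1) l
    rw [hn (k + 1) l (by omega), shiftY_of_le (j := n + 1) (fun k l h => hn k l (by omega))
      (by omega), smul_zero, zero_add, opF, map_zero, map_zero, map_zero, map_zero, mul_zero,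
      add_zero, sub_zero] at h1
    exact (smul_eq_zero.1 h1.symm).resolve_left h2
  | succ j ih =>
    have h1 := congrArg (⇑Dx)^[2 * j + 2] (hc (k + 1) l)
    have h3 : (⇑Dx)^[2 * j + 1] (c (k + 1) l) = 0 := ih (by omega)
    have h4 : (⇑Dx)^[2 * j + 2] (c (k + 1) l) = 0 := by
      rw [Function.iterate_succ_apply', h3, map_zero]
    have h5 : (⇑Dx)^[2 * j + 2] (shiftY c (k + 1 + 1) l) = 0 := by
      cases l with
      | zero => exact iter_Dx_zero _
      | succ l =>
        rw [Function.iterate_succ_apply']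
        exact (congrArg _ (ih (by omega))).trans (map_zero Dx)
    rw [opF_iter_Dx h4, h3, map_zero, smul_zero, iter_Dx_add, iter_Dx_smul, iter_Dx_smul, h5,
      smul_zero, zero_add, ← Function.iterate_succ_apply] at h1
    exact (smul_eq_zero.1 h1.symm).resolve_left h2

/-- The highest `x`-derivatives of the coefficients are multiples of `y`-derivatives of the
leading coefficients. -/
theorem exists_iter_Dx_coef_eq (j : ℕ) {k l : ℕ} (h : k + l + j = n) :
    ∃ a : ℝ, a ≠ 0 ∧ (⇑Dx)^[2 * j] (c k l) = a • (⇑Dy)^[j] (c (k + j) l) := by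
  induction j generalizing k l with
  | zero => exact ⟨1, one_ne_zero, by simp⟩
  | succ j ih =>
    obtain ⟨a, ha, hja⟩ := ih (k := k + 1) (l := l) (by omega)
    have h1 := congrArg (⇑Dx)^[2 * j + 1] (hc (k + 1) l)
    have h3 : (⇑Dx)^[2 * j + 1] (c (k + 1) l) = 0 := iter_Dx_coef_eq_zero hc hn j (by omega)
    have h5 : (⇑Dx)^[2 * j + 1] (shiftY c (k + 1 + 1) l) = 0 := by
      cases l with
      | zero => exact iter_Dx_zero _
      | succ l => exact iter_Dx_coef_eq_zero hc hn j (by omega)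
    rw [opF_iter_Dx h3, iter_Dx_add, iter_Dx_smul, iter_Dx_smul, h5, smul_zero, zero_add,
      ← Function.iterate_succ_apply, hja, Derivation.map_smul, ← Function.iterate_succ_apply' (⇑Dy),
      smul_smul] at h1
    refine ⟨2⁻¹ * (((2 * j : ℕ) + 1) * a), ?_, ?_⟩
    · have : (((2 * j : ℕ) : ℝ) + 1) ≠ 0 := by positivity
      exact mul_ne_zero (by norm_num) (mul_ne_zero this ha)
    · rw [← smul_smul, show k + (j + 1) = k + 1 + j by omega, h1, smul_smul,
        inv_mul_cancel₀ two_ne_zero, one_smul]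
      rfl

/-- The leading coefficients are polynomials in `y`: this is the equation for `c 0 l` in the
highest degree in `x`, where no coefficient `c (k - 1) l` occurs. -/
theorem iter_Dy_leading_eq_zero {j l : ℕ} (h : j + l = n) : (⇑Dy)^[j + 1] (c j l) = 0 := by
  obtain ⟨a, ha, hja⟩ := exists_iter_Dx_coef_eq hc hn j (k := 0) (l := l) (by omega)
  have h1 := congrArg (⇑Dx)^[2 * j + 1] (hc 0 l)
  have h3 : (⇑Dx)^[2 * j + 1] (c 0 l) = 0 := iter_Dx_coef_eq_zero hc hn j (by omega)
  have h5 : (⇑Dx)^[2 * j + 1] (shiftY c (0 + 1) l) = 0 := by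
    cases l with
    | zero => exact iter_Dx_zero _
    | succ l => exact iter_Dx_coef_eq_zero hc hn j (by omega)
  rw [opF_iter_Dx h3, iter_Dx_add, iter_Dx_smul, iter_Dx_smul, h5, shiftX, map_zero, iter_Dx_zero,
    smul_zero, smul_zero, zero_add, hja, Derivation.map_smul, ← Function.iterate_succ_apply' (⇑Dy),
    smul_smul, zero_add] at h1
  have : (((2 * j : ℕ) : ℝ) + 1) ≠ 0 := by positivity
  exact (smul_eq_zero.1 h1).resolve_left (mul_ne_zero this ha)

end Coefficients

/-- All coefficients are polynomials in `y`: the equations are invariant under `D_y`, and enough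
applications of `D_y` remove the leading coefficients. -/
theorem exists_iter_Dy_coef_eq_zero (n : ℕ) {c : ℕ → ℕ → DiffFun}
    (hc : ∀ k l, opF (c k l) = (k + 1 : ℝ) • shiftY c (k + 1) l + (2 : ℝ) • Dx (shiftX c k l))
    (hn : ∀ k l, n ≤ k + l → c k l = 0) : ∃ N, ∀ k l, (⇑Dy)^[N] (c k l) = 0 := by
  induction n generalizing c with
  | zero => exact ⟨0, fun k l => hn k l (Nat.zero_le _)⟩
  | succ n ih =>
    have hsX : ∀ m k l, shiftX (fun k l => (⇑Dy)^[m] (c k l)) k l = (⇑Dy)^[m] (shiftX c k l) := by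
      intro m k l
      cases k with
      | zero => exact (iter_Dy_zero m).symm
      | succ k => rfl
    have hsY : ∀ m k l, shiftY (fun k l => (⇑Dy)^[m] (c k l)) k l = (⇑Dy)^[m] (shiftY c k l) := by
      intro m k l
      cases l with
      | zero => exact (iter_Dy_zero m).symm
      | succ l => rfl
    have hF : ∀ m f, opF ((⇑Dy)^[m] f) = (⇑Dy)^[m] (opF f) := by
      intro m f
      induction m generalizing f with
      | zero => rfl
      | succ m ih => rw [Function.iterate_succ_apply, ih, opF_Dy, Function.iterate_succ_apply]
    have hD : ∀ m f, (⇑Dy)^[m] (Dx f) = Dx ((⇑Dy)^[m] f) := by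
      intro m f
      induction m generalizing f with
      | zero => rfl
      | succ m ih => rw [Function.iterate_succ_apply, ← Dx_Dy, ih, Function.iterate_succ_apply]
    obtain ⟨N, hN⟩ := ih (c := fun k l => (⇑Dy)^[n + 1] (c k l))
      (fun k l => by
        rw [hsX, hsY, hF, hc, iter_Dy_add, iter_Dy_smul, iter_Dy_smul, hD])
      (fun k l hkl => by
        rcases hkl.eq_or_lt with h | h
        · have h1 := iter_Dy_leading_eq_zero hc (n := n) (fun k l h => hn k l h) h.symm
          obtain ⟨i, hi⟩ : ∃ i, n + 1 = i + (k + 1) := ⟨n - k, by omega⟩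
          rw [hi, Function.iterate_add_apply, h1, iter_Dy_zero]
        · rw [hn k l h, iter_Dy_zero])
    refine ⟨N + (n + 1), fun k l => ?_⟩
    rw [Function.iterate_add_apply]
    exact hN k l

theorem exists_iter_Dx_coef_eq_zero {n : ℕ} {c : ℕ → ℕ → DiffFun}
    (hc : ∀ k l, opF (c k l) = (k + 1 : ℝ) • shiftY c (k + 1) l + (2 : ℝ) • Dx (shiftX c k l))
    (hn : ∀ k l, n < k + l → c k l = 0) : ∃ N, ∀ k l, (⇑Dx)^[N] (c k l) = 0 := by
  refine ⟨2 * n + 1, fun k l => ?_⟩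
  by_cases h : k + l ≤ n
  · obtain ⟨j, rfl⟩ := Nat.exists_eq_add_of_le h
    rw [show 2 * (k + l + j) + 1 = 2 * (k + l) + (2 * j + 1) by ring, Function.iterate_add_apply,
      iter_Dx_coef_eq_zero hc hn j rfl, iter_Dx_zero]
  · rw [hn k l (by omega), iter_Dx_zero]

/-- A function of `t`, `x`, `y` with vanishing derivatives is constant. -/
theorem exists_eq_algebraMap {f : DiffFun} (hf : IsBase f) (ht : Dt f = 0) (hx : Dx f = 0)
    (hy : Dy f = 0) : ∃ r, f = algebraMap ℝ DiffFun r := by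
  have ht' : partialD .t f = 0 := by
    rw [Dt, field_eq_sum _ hf, Finset.sum_insert (by simp), Finset.sum_insert (by simp),
      Finset.sum_singleton] at ht
    simpa using ht
  have hx' : partialD .x f = 0 := by
    rw [Dx, field_eq_sum _ hf, Finset.sum_insert (by simp), Finset.sum_insert (by simp),
      Finset.sum_singleton] at hx
    simpa using hx
  have hy' : partialD .y f = 0 := by
    rw [Dy, field_eq_sum _ hf, Finset.sum_insert (by simp), Finset.sum_insert (by simp),
      Finset.sum_singleton] at hy
    simpa using hy
  obtain ⟨g, hg, hfg⟩ := id hf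
  have hzero : ∀ i (hi : i ∈ ({.t, .x, .y} : Finset Coord)), pderiv i f = 0 := by
    intro i hi
    simp only [Finset.mem_insert, Finset.mem_singleton] at hi
    rcases hi with rfl | rfl | rfl
    · exact congrArg Subtype.val ht'
    · exact congrArg Subtype.val hx'
    · exact congrArg Subtype.val hy'
  have hd : ∀ q, fderiv ℝ g q = 0 := by
    intro q
    set p : Jet := fun i => if hi : i ∈ ({.t, .x, .y} : Finset Coord) then q ⟨i, hi⟩ else 0 with hp
    have hpq : (fun i : ({.t, .x, .y} : Finset Coord) => p i) = q := by
      funext i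
      simp only [hp, i.2, dif_pos]
    apply ContinuousLinearMap.coe_injective
    refine LinearMap.pi_ext' fun i => LinearMap.ext_ring ?_
    have := pderiv_eq hg hfg i.2 p
    rw [hzero i i.2, hpq] at this
    simpa using this.symm
  refine ⟨g 0, Subtype.ext (funext fun p => ?_)⟩
  exact (hfg p).trans (is_const_of_fderiv_eq_zero (hg.differentiable (by simp)) hd _ _)

/-! ### The operators `P³`, `P²`, `P¹`, `P⁰` -/

theorem opP1_eq : opP1 = opX + mulOp (coord .t) * opY := rfl
theorem opP2_eq : opP2 = mulOp (2 * coord .t) * opX + mulOp (coord .t ^ 2) * opY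
    + mulOp (coord .x) := rfl
theorem opP3_eq : opP3 = mulOp (3 * coord .t ^ 2) * opX + mulOp (coord .t ^ 3) * opY
    - mulOp (3 * (coord .y - coord .t * coord .x)) := rfl

theorem isBase_natCast (n : ℕ) : IsBase (n : DiffFun) := by
  rw [← map_natCast (algebraMap ℝ DiffFun)]
  exact isBase_const _

theorem isBase_ofNat (n : ℕ) [n.AtLeastTwo] : IsBase (ofNat(n) : DiffFun) := isBase_natCast n

theorem isBase_t_pow (n : ℕ) : IsBase (coord .t ^ n) := by
  induction n with
  | zero => rw [pow_zero]; exact isBase_one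
  | succ n ih => rw [pow_succ]; exact ih.mul isBase_t

theorem opP0_mem : opP0 ∈ diffOps := opY_mem

theorem opP1_mem : opP1 ∈ diffOps :=
  diffOps.add_mem opX_mem (diffOps.mul_mem (mulOp_mem isBase_t) opY_mem)

theorem opP2_mem : opP2 ∈ diffOps :=
  diffOps.add_mem (diffOps.add_mem
    (diffOps.mul_mem (mulOp_mem ((isBase_ofNat 2).mul isBase_t)) opX_mem)
    (diffOps.mul_mem (mulOp_mem (isBase_t_pow 2)) opY_mem)) (mulOp_mem isBase_x)

theorem mulOp_y_sub : mulOp (3 * (coord .y - coord .t * coord .x)) =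
    (3 : ℝ) • (mulOp (coord .y) - mulOp (coord .t) * mulOp (coord .x)) := by
  ext f
  simp only [mulOp, LinearMap.smul_apply, LinearMap.sub_apply, Module.End.mul_apply,
    LinearMap.mulLeft_apply]
  rw [Algebra.smul_def, map_ofNat]
  ring

theorem opP3_mem : opP3 ∈ diffOps := by
  rw [opP3_eq, mulOp_y_sub]
  exact diffOps.sub_mem (diffOps.add_mem
    (diffOps.mul_mem (mulOp_mem ((isBase_ofNat 3).mul (isBase_t_pow 2))) opX_mem)
    (diffOps.mul_mem (mulOp_mem (isBase_t_pow 3)) opY_mem))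
    (diffOps.smul_mem (diffOps.sub_mem (mulOp_mem isBase_y)
      (diffOps.mul_mem (mulOp_mem isBase_t) (mulOp_mem isBase_x))) 3)

section CoefP

variable {Q : Module.End ℝ DiffFun} (hQ : Q ∈ diffOps)
include hQ

theorem adj_mulOp_t_pow (n : ℕ) : adj (mulOp (coord .t ^ n)) Q = 0 := by
  induction n with
  | zero => rw [pow_zero, mulOp_one, adj_swap, adj_one, neg_zero]
  | succ n ih => rw [pow_succ, mulOp_mul, adj_mul_left, ih, adj_mulOp_t hQ, mul_zero, zero_mul,
      add_zero]

theorem adj_mulOp_natCast_mul_t_pow (m n : ℕ) : adj (mulOp (m * coord .t ^ n)) Q = 0 := by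
  rw [← map_natCast (algebraMap ℝ DiffFun), mulOp_mul, mulOp_algebraMap, adj_mul_left,
    adj_mulOp_t_pow hQ, mul_zero, zero_add, adj_swap, adj_algebraMap, neg_zero, zero_mul]

theorem coef_adj_opP0 (k l : ℕ) : coef k l (adj opP0 Q) = Dy (coef k l Q) :=
  coef_adj_opY hQ k l

theorem coef_adj_opP1 (k l : ℕ) :
    coef k l (adj opP1 Q) = Dx (coef k l Q) + coord .t * Dy (coef k l Q) := by
  have h : adj opP1 Q = adj opX Q + mulOp (coord .t) * adj opY Q := by
    have h := adj_mul_left (mulOp (coord .t)) opY Q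
    rw [adj_mulOp_t hQ, zero_mul, add_zero] at h
    rw [← h, opP1_eq]
    simp only [adj_apply, add_mul, mul_add]
    abel
  rw [h, map_add, coef_adj_opX hQ, coef_mulOp_mul (adj_mem opY_mem hQ) _ _ isBase_t,
    coef_adj_opY hQ]

theorem coef_adj_opP2 (k l : ℕ) :
    coef k l (adj opP2 Q) = 2 * coord .t * Dx (coef k l Q) + coord .t ^ 2 * Dy (coef k l Q)
      - (k + 1 : ℝ) • coef (k + 1) l Q := by
  have h : adj opP2 Q = mulOp (2 * coord .t) * adj opX Q + mulOp (coord .t ^ 2) * adj opY Q +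
      adj (mulOp (coord .x)) Q := by
    have h1 := adj_mul_left (mulOp (2 * coord .t)) opX Q
    have h2 := adj_mul_left (mulOp (coord .t ^ 2)) opY Q
    have h3 := adj_mulOp_natCast_mul_t_pow hQ 2 1
    rw [pow_one] at h3
    rw [show adj (mulOp (2 * coord .t)) Q = 0 from h3, zero_mul, add_zero] at h1
    rw [adj_mulOp_t_pow hQ, zero_mul, add_zero] at h2
    rw [← h1, ← h2, opP2_eq]
    simp only [adj_apply, add_mul, mul_add]
    abel
  rw [h, map_add, map_add, coef_mulOp_mul (adj_mem opX_mem hQ) _ _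
    ((isBase_ofNat 2).mul isBase_t), coef_adj_opX hQ,
    coef_mulOp_mul (adj_mem opY_mem hQ) _ _ (isBase_t_pow 2), coef_adj_opY hQ, coef_adj_mulOp_x hQ,
    sub_eq_add_neg]

theorem coef_adj_opP3 (k l : ℕ) :
    coef k l (adj opP3 Q) = 3 * coord .t ^ 2 * Dx (coef k l Q) + coord .t ^ 3 * Dy (coef k l Q)
      + (3 : ℝ) • ((l + 1 : ℝ) • coef k (l + 1) Q
        - coord .t * ((k + 1 : ℝ) • coef (k + 1) l Q)) := by
  have h : adj opP3 Q = mulOp (3 * coord .t ^ 2) * adj opX Q + mulOp (coord .t ^ 3) * adj opY Q -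
      (3 : ℝ) • (adj (mulOp (coord .y)) Q - mulOp (coord .t) * adj (mulOp (coord .x)) Q) := by
    have h1 := adj_mul_left (mulOp (3 * coord .t ^ 2)) opX Q
    have h2 := adj_mul_left (mulOp (coord .t ^ 3)) opY Q
    have h4 := adj_mul_left (mulOp (coord .t)) (mulOp (coord .x)) Q
    rw [show adj (mulOp (3 * coord .t ^ 2)) Q = 0 from adj_mulOp_natCast_mul_t_pow hQ 3 2,
      zero_mul, add_zero] at h1
    rw [adj_mulOp_t_pow hQ, zero_mul, add_zero] at h2
    rw [adj_mulOp_t hQ, zero_mul, add_zero] at h4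
    rw [← h1, ← h2, ← h4, opP3_eq, mulOp_y_sub]
    simp only [adj_apply, add_mul, mul_add, sub_mul, mul_sub, smul_sub, smul_mul_assoc,
      mul_smul_comm]
    abel
  have hx := adj_mem (mulOp_mem isBase_x) hQ
  rw [h, map_sub, map_add, map_smul, map_sub, coef_mulOp_mul (adj_mem opX_mem hQ) _ _
    ((isBase_ofNat 3).mul (isBase_t_pow 2)), coef_adj_opX hQ,
    coef_mulOp_mul (adj_mem opY_mem hQ) _ _ (isBase_t_pow 3), coef_adj_opY hQ, coef_adj_mulOp_y hQ,
    coef_mulOp_mul hx _ _ isBase_t, coef_adj_mulOp_x hQ, mul_neg, sub_eq_add_neg, ← smul_neg]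
  congr 2
  abel

end CoefP

theorem derivation_ofNat (D : Derivation ℝ DiffFun DiffFun) (n : ℕ) [n.AtLeastTwo] :
    D ofNat(n) = 0 := D.map_natCast n

theorem isQuad_opP : IsQuad opP3 opP2 opP1 opP0 := by
  constructor <;> ext f <;>
    simp only [adj_apply, opP3, opP2, opP1, opP0, mulOp, LinearMap.sub_apply, LinearMap.add_apply,
      Module.End.mul_apply, LinearMap.mulLeft_apply, Derivation.coeFn_coe, map_add, map_sub,
      Derivation.leibniz, Derivation.leibniz_pow, smul_eq_mul, Dx_t, Dx_x, Dx_y, Dy_t, Dy_x, Dy_y,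
      derivation_ofNat, mul_zero, add_zero, sub_zero, zero_sub,
      Dx_Dy, LinearMap.zero_apply, Module.algebraMap_end_apply,
      map_neg, map_one, mul_one, nsmul_eq_mul, LinearMap.neg_apply, Module.End.one_apply]
  all_goals try rw [Algebra.smul_def, map_ofNat]
  all_goals ring

theorem adj_opFEnd_opP {P : Module.End ℝ DiffFun}
    (hP : P ∈ ({opP3, opP2, opP1, opP0} : Set (Module.End ℝ DiffFun))) : adj opFEnd P = 0 := by
  simp only [Set.mem_insert_iff, Set.mem_singleton_iff] at hP
  rcases hP with rfl | rfl | rfl | rfl <;> ext f <;>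
    simp only [adj_apply, opP3, opP2, opP1, opP0, mulOp, LinearMap.sub_apply, LinearMap.add_apply,
      Module.End.mul_apply, LinearMap.mulLeft_apply, Derivation.coeFn_coe, map_add, map_sub,
      Derivation.leibniz, Derivation.leibniz_pow, smul_eq_mul, Dx_t, Dx_x, Dx_y, Dy_t, Dy_x, Dy_y,
      Dt_t, Dt_x, Dt_y, Dt_Dx, Dt_Dy, opFEnd_apply, opF, nsmul_eq_mul, map_neg,
      derivation_ofNat, mul_zero, add_zero, zero_add, smul_zero, sub_zero, zero_sub,
      Dx_Dy, LinearMap.zero_apply, mul_one]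
  all_goals push_cast
  all_goals ring

/-! ### Symmetry operators -/

/-- The differential operators that commute with `F` and with all elements of `G`. -/
def symOps (G : Set (Module.End ℝ DiffFun)) : Submodule ℝ (Module.End ℝ DiffFun) where
  carrier := {Q | Q ∈ diffOps ∧ adj opFEnd Q = 0 ∧ ∀ g ∈ G, adj g Q = 0}
  zero_mem' := ⟨diffOps.zero_mem, map_zero _, fun _ _ => map_zero _⟩
  add_mem' {Q R} hQ hR := ⟨diffOps.add_mem hQ.1 hR.1, by rw [map_add, hQ.2.1, hR.2.1, add_zero],
    fun g hg => by rw [map_add, hQ.2.2 g hg, hR.2.2 g hg, add_zero]⟩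
  smul_mem' r Q hQ := ⟨diffOps.smul_mem hQ.1 r, by rw [map_smul, hQ.2.1, smul_zero],
    fun g hg => by rw [map_smul, hQ.2.2 g hg, smul_zero]⟩

theorem opP_mem {P : Module.End ℝ DiffFun}
    (hP : P ∈ ({opP3, opP2, opP1, opP0} : Set (Module.End ℝ DiffFun))) : P ∈ diffOps := by
  simp only [Set.mem_insert_iff, Set.mem_singleton_iff] at hP
  rcases hP with rfl | rfl | rfl | rfl
  exacts [opP3_mem, opP2_mem, opP1_mem, opP0_mem]

section SymOps

variable {G : Set (Module.End ℝ DiffFun)} {p q Q : Module.End ℝ DiffFun}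

theorem adj_mem_symOps (hG : G ⊆ {opP3, opP2, opP1, opP0})
    (hp : p ∈ ({opP3, opP2, opP1, opP0} : Set (Module.End ℝ DiffFun))) (hQ : Q ∈ symOps G) :
    adj p Q ∈ symOps G := by
  refine ⟨adj_mem (opP_mem hp) hQ.1, ?_, fun g hg => ?_⟩
  · rw [adj_adj_comm (r := 0) (by rw [adj_opFEnd_opP hp, map_zero]), hQ.2.1, map_zero]
  · obtain ⟨r, hr⟩ := isQuad_opP.adj_scalar (hG hg) hp
    rw [adj_adj_comm hr, hQ.2.2 g hg, map_zero]

theorem adj_iterate_mem_symOps (hG : G ⊆ {opP3, opP2, opP1, opP0})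
    (hp : p ∈ ({opP3, opP2, opP1, opP0} : Set (Module.End ℝ DiffFun))) (hQ : Q ∈ symOps G) (N : ℕ) :
    (adj p ^ N) Q ∈ symOps G := by
  induction N with
  | zero => simpa
  | succ N ih => rw [pow_succ', Module.End.mul_apply]; exact adj_mem_symOps hG hp ih

/-- One step of the reduction to the operators commuting with all `Pʲ`. -/
theorem symOps_le_of_insert {r : ℝ} (hr : r ≠ 0) (hpq : adj p q = algebraMap ℝ _ r)
    (hG : G ⊆ {opP3, opP2, opP1, opP0})
    (hp : p ∈ ({opP3, opP2, opP1, opP0} : Set (Module.End ℝ DiffFun)))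
    (hq : q ∈ ({opP3, opP2, opP1, opP0} : Set (Module.End ℝ DiffFun)))
    (hGq : ∀ g ∈ G, adj g q = 0) (hnil : ∀ Q ∈ symOps G, ∃ N, (adj p ^ N) Q = 0)
    (hker : symOps (insert p G) ≤ Subalgebra.toSubmodule Upsilon) :
    symOps G ≤ Subalgebra.toSubmodule Upsilon := by
  intro Q hQ
  obtain ⟨N, hN⟩ := hnil Q hQ
  refine mem_of_adj_iterate_eq_zero hr hpq (fun x hx => adj_mem_symOps hG hp hx)
    (fun x hx => ⟨diffOps.mul_mem (opP_mem hq) hx.1, ?_, fun g hg => ?_⟩)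
    (fun x hx => Upsilon.mul_mem (Algebra.subset_adjoin hq) hx)
    (fun x hx h0 => hker ⟨hx.1, hx.2.1, fun g hg => ?_⟩) N hQ hN
  · rw [adj_mul, adj_opFEnd_opP hq, hx.2.1, zero_mul, mul_zero, add_zero]
  · rw [adj_mul, hGq g hg, hx.2.2 g hg, zero_mul, mul_zero, add_zero]
  · rcases hg with rfl | hg
    exacts [h0, hx.2.2 g hg]

theorem opF_coef (hQ : Q ∈ symOps G) (k l : ℕ) : opF (coef k l Q) =
    (k + 1 : ℝ) • shiftY (fun k l => coef k l Q) (k + 1) l +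
      (2 : ℝ) • Dx (shiftX (fun k l => coef k l Q) k l) := by
  have h := coef_adj_opFEnd hQ.1 k l
  rw [hQ.2.1, map_zero] at h
  linear_combination -h

theorem Dy_coef_eq_zero (h0 : opP0 ∈ G) (hQ : Q ∈ symOps G) (k l : ℕ) : Dy (coef k l Q) = 0 := by
  rw [← coef_adj_opP0 hQ.1, hQ.2.2 _ h0, map_zero]

theorem Dx_coef_eq_zero (h0 : opP0 ∈ G) (h1 : opP1 ∈ G) (hQ : Q ∈ symOps G) (k l : ℕ) :
    Dx (coef k l Q) = 0 := by
  have h := coef_adj_opP1 hQ.1 k l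
  rw [hQ.2.2 _ h1, map_zero, Dy_coef_eq_zero h0 hQ, mul_zero, add_zero] at h
  exact h.symm

theorem coef_succ_left_eq_zero (h0 : opP0 ∈ G) (h1 : opP1 ∈ G) (h2 : opP2 ∈ G) (hQ : Q ∈ symOps G)
    (k l : ℕ) : coef (k + 1) l Q = 0 := by
  have h := coef_adj_opP2 hQ.1 k l
  rw [hQ.2.2 _ h2, map_zero, Dy_coef_eq_zero h0 hQ, Dx_coef_eq_zero h0 h1 hQ, mul_zero, mul_zero,
    add_zero, zero_sub, eq_comm, neg_eq_zero] at h
  exact (smul_eq_zero.1 h).resolve_left (by positivity)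

theorem coef_adj_opP3_eq (h0 : opP0 ∈ G) (h1 : opP1 ∈ G) (h2 : opP2 ∈ G) (hQ : Q ∈ symOps G)
    (k l : ℕ) : coef k l (adj opP3 Q) = (3 : ℝ) • (l + 1 : ℝ) • coef k (l + 1) Q := by
  rw [coef_adj_opP3 hQ.1, Dy_coef_eq_zero h0 hQ, Dx_coef_eq_zero h0 h1 hQ,
    coef_succ_left_eq_zero h0 h1 h2 hQ, smul_zero, mul_zero, mul_zero, mul_zero, add_zero, zero_add,
    sub_zero]

theorem exists_adj_opP0_iterate (hQ : Q ∈ symOps ∅) : ∃ N, (adj opP0 ^ N) Q = 0 := by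
  obtain ⟨n, hn⟩ := exists_coef_eq_zero hQ.1
  obtain ⟨N, hN⟩ := exists_iter_Dy_coef_eq_zero n (c := fun k l => coef k l Q)
    (fun k l => opF_coef hQ k l) hn
  have hmem := adj_iterate_mem_symOps (G := ∅) (p := opP0) (by simp) (by simp) hQ
  have hiter : ∀ M k l, coef k l ((adj opP0 ^ M) Q) = (⇑Dy)^[M] (coef k l Q) := by
    intro M k l
    induction M with
    | zero => simp
    | succ M ih =>
      rw [pow_succ', Module.End.mul_apply, coef_adj_opP0 (hmem M).1, ih,
        ← Function.iterate_succ_apply' (⇑Dy)]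
  exact ⟨N, eq_zero_of_coef_eq_zero (hmem N).1 fun k l => by rw [hiter, hN]⟩

theorem exists_adj_opP1_iterate (hG : G ⊆ {opP3, opP2, opP1, opP0}) (h0 : opP0 ∈ G)
    (hQ : Q ∈ symOps G) : ∃ N, (adj opP1 ^ N) Q = 0 := by
  obtain ⟨n, hn⟩ := exists_coef_eq_zero hQ.1
  obtain ⟨N, hN⟩ := exists_iter_Dx_coef_eq_zero (n := n) (c := fun k l => coef k l Q)
    (fun k l => opF_coef hQ k l) (fun k l h => hn k l h.le)
  have hmem := adj_iterate_mem_symOps (p := opP1) hG (by simp) hQ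
  have hiter : ∀ M k l, coef k l ((adj opP1 ^ M) Q) = (⇑Dx)^[M] (coef k l Q) := by
    intro M k l
    induction M with
    | zero => simp
    | succ M ih =>
      rw [pow_succ', Module.End.mul_apply, coef_adj_opP1 (hmem M).1, Dy_coef_eq_zero h0 (hmem M),
        mul_zero, add_zero, ih, ← Function.iterate_succ_apply' (⇑Dx)]
  exact ⟨N, eq_zero_of_coef_eq_zero (hmem N).1 fun k l => by rw [hiter, hN]⟩

theorem exists_adj_opP2_iterate (hG : G ⊆ {opP3, opP2, opP1, opP0}) (h0 : opP0 ∈ G)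
    (h1 : opP1 ∈ G) (hQ : Q ∈ symOps G) : ∃ N, (adj opP2 ^ N) Q = 0 := by
  obtain ⟨n, hn⟩ := exists_coef_eq_zero hQ.1
  refine ⟨n, ?_⟩
  replace hn : ∀ k l, n ≤ k → coef k l Q = 0 := fun k l h => hn k l (by omega)
  induction n generalizing Q with
  | zero => exact eq_zero_of_coef_eq_zero hQ.1 fun k l => hn k l (Nat.zero_le _)
  | succ n ih =>
    rw [pow_succ, Module.End.mul_apply]
    refine ih (adj_mem_symOps hG (by simp) hQ) fun k l hk => ?_
    rw [coef_adj_opP2 hQ.1, Dy_coef_eq_zero h0 hQ, Dx_coef_eq_zero h0 h1 hQ, hn (k + 1) l (by omega),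
      smul_zero, mul_zero, mul_zero, add_zero, sub_zero]

theorem exists_adj_opP3_iterate (hG : G ⊆ {opP3, opP2, opP1, opP0}) (h0 : opP0 ∈ G)
    (h1 : opP1 ∈ G) (h2 : opP2 ∈ G) (hQ : Q ∈ symOps G) : ∃ N, (adj opP3 ^ N) Q = 0 := by
  obtain ⟨n, hn⟩ := exists_coef_eq_zero hQ.1
  refine ⟨n, ?_⟩
  replace hn : ∀ k l, n ≤ l → coef k l Q = 0 := fun k l h => hn k l (by omega)
  induction n generalizing Q with
  | zero => exact eq_zero_of_coef_eq_zero hQ.1 fun k l => hn k l (Nat.zero_le _)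
  | succ n ih =>
    rw [pow_succ, Module.End.mul_apply]
    refine ih (adj_mem_symOps hG (by simp) hQ) fun k l hk => ?_
    rw [coef_adj_opP3_eq h0 h1 h2 hQ, hn k (l + 1) (by omega), smul_zero, smul_zero]

/-- A symmetry operator commuting with all `Pʲ` has constant coefficients and order zero. -/
theorem exists_eq_algebraMap_of_mem_symOps
    (hQ : Q ∈ symOps {opP3, opP2, opP1, opP0}) : ∃ r, Q = algebraMap ℝ _ r := by
  have h0 : opP0 ∈ ({opP3, opP2, opP1, opP0} : Set (Module.End ℝ DiffFun)) := by simp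
  have h1 : opP1 ∈ ({opP3, opP2, opP1, opP0} : Set (Module.End ℝ DiffFun)) := by simp
  have h2 : opP2 ∈ ({opP3, opP2, opP1, opP0} : Set (Module.End ℝ DiffFun)) := by simp
  have hx := Dx_coef_eq_zero h0 h1 hQ 0 0
  have hy := Dy_coef_eq_zero h0 hQ 0 0
  have ht := opF_coef hQ 0 0
  rw [opF, hx, hy] at ht
  simp only [map_zero, mul_zero, add_zero, sub_zero, shiftX, shiftY, smul_zero] at ht
  obtain ⟨r, hr⟩ := exists_eq_algebraMap (isBase_coef hQ.1 0 0) ht hx hy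
  refine ⟨r, sub_eq_zero.1 (eq_zero_of_coef_eq_zero (diffOps.sub_mem hQ.1
    (diffOps.algebraMap_mem r)) fun k l => ?_)⟩
  rw [map_sub, ← mulOp_algebraMap, mulOp_eq_monomialOp, coef_monomialOp (isBase_const r)]
  rcases k with _ | k
  · rcases l with _ | l
    · simp [hr]
    · have h3 := coef_adj_opP3_eq h0 h1 h2 hQ 0 l
      rw [hQ.2.2 opP3 (by simp), map_zero, eq_comm, smul_eq_zero, smul_eq_zero] at h3
      rw [(h3.resolve_left three_ne_zero).resolve_left (by positivity)]
      simp
  · rw [coef_succ_left_eq_zero h0 h1 h2 hQ]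
    simp

end SymOps

/-- All symmetry operators are polynomials in `P³`, `P²`, `P¹`, `P⁰`. -/
theorem symOps_le_Upsilon : symOps ∅ ≤ Subalgebra.toSubmodule Upsilon := by
  have h := isQuad_opP
  refine symOps_le_of_insert (p := opP0) (q := opP3) (by norm_num) h.da (by simp) (by simp) (by simp)
    (by simp) (fun Q hQ => exists_adj_opP0_iterate hQ) ?_
  refine symOps_le_of_insert (p := opP1) (q := opP2) (by norm_num) h.cb (by simp) (by simp) (by simp)
    (by simp [h.db]) (fun Q hQ => exists_adj_opP1_iterate (by simp) (by simp) hQ) ?_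
  refine symOps_le_of_insert (p := opP2) (q := opP1) (by norm_num) h.bc
    (by simp [Set.insert_subset_iff]) (by simp) (by simp) ?_
    (fun Q hQ => exists_adj_opP2_iterate (by simp [Set.insert_subset_iff]) (by simp) (by simp) hQ) ?_
  · simp [h.dc, adj_self]
  refine symOps_le_of_insert (p := opP3) (q := opP0) (by norm_num) h.ad
    (by simp) (by simp) (by simp) ?_
    (fun Q hQ => exists_adj_opP3_iterate (by simp) (by simp) (by simp)
      (by simp) hQ) ?_
  · simp [h.bd, h.cd, adj_self]
  intro Q hQ
  obtain ⟨r, rfl⟩ := exists_eq_algebraMap_of_mem_symOps (by simpa using hQ)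
  exact Upsilon.algebraMap_mem r

theorem Upsilon_le_symOps : Subalgebra.toSubmodule Upsilon ≤ symOps ∅ := by
  intro Q hQ
  replace hQ : Q ∈ Upsilon := hQ
  rw [Upsilon] at hQ
  refine ⟨?_, ?_, by simp⟩
  · exact Algebra.adjoin_le (S := diffOps) (fun P hP => opP_mem hP) hQ
  · induction hQ using Algebra.adjoin_induction with
    | mem P hP => exact adj_opFEnd_opP hP
    | algebraMap r => exact adj_algebraMap _ r
    | add x y _ _ hx hy => rw [map_add, hx, hy, add_zero]
    | mul x y _ _ hx hy => rw [adj_mul, hx, hy, zero_mul, mul_zero, add_zero]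

theorem mem_diffOps_of_mem_Upsilon {Q : Module.End ℝ DiffFun} (hQ : Q ∈ Upsilon) : Q ∈ diffOps :=
  (Upsilon_le_symOps hQ).1

theorem exists_eq_algebraMap_of_mem_Upsilon {Q : Module.End ℝ DiffFun} (hQ : Q ∈ Upsilon)
    (h : ∀ P ∈ ({opP3, opP2, opP1, opP0} : Set (Module.End ℝ DiffFun)), adj P Q = 0) :
    ∃ r, Q = algebraMap ℝ _ r :=
  exists_eq_algebraMap_of_mem_symOps ⟨(Upsilon_le_symOps hQ).1, (Upsilon_le_symOps hQ).2.1, h⟩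

/-! ### Symmetry operators and linear generalized symmetries -/

theorem opF_coord_u : opF (coord (.u 0 0)) = 0 := by
  rw [opF, Dt, Dy, Dx, field_coord, field_coord, field_coord, field_coord]
  simp

theorem isLinear_apply_u {Q : Module.End ℝ DiffFun} (hQ : Q ∈ diffOps) :
    IsLinear (Q (coord (.u 0 0))) := by
  refine diffOps_induction (P := fun Q => IsLinear (Q (coord (.u 0 0)))) (fun f a b hf => ?_)
    (fun Q R hQ hR => hQ.add hR) (fun r Q hQ => hQ.smul r) hQ
  rw [monomialOp_apply_u]
  exact (isLinear_coord a b).base_mul hf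

theorem exists_apply_u_eq {η : DiffFun} (h : IsLinear η) :
    ∃ Q ∈ diffOps, Q (coord (.u 0 0)) = η := by
  obtain ⟨n, c, hc, rfl⟩ := h
  refine ⟨∑ kl ∈ (Finset.range (n + 1) ×ˢ Finset.range (n + 1)).filter
      (fun kl => kl.1 + kl.2 ≤ n), monomialOp kl.1 kl.2 (c kl.1 kl.2),
    diffOps.sum_mem fun kl _ => monomialOp_mem (hc _ _) _ _, ?_⟩
  rw [LinearMap.sum_apply]
  exact Finset.sum_congr rfl fun kl _ => monomialOp_apply_u _ _ _

/-- The evolutionary vector field `ζ ∂_u` acts on `Q u` by the linearization `Q ζ`. -/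
theorem prolong_apply_u {Q : Module.End ℝ DiffFun} (hQ : Q ∈ diffOps) (ζ : DiffFun) :
    prolong ζ (Q (coord (.u 0 0))) = Q ζ := by
  refine eq_of_eq_monomialOp
    (φ := (prolong ζ).toLinearMap ∘ₗ LinearMap.applyₗ (coord (.u 0 0)))
    (ψ := LinearMap.applyₗ ζ) (fun f k l hf => ?_) hQ
  have h0 : prolong ζ f = 0 := by
    rw [prolong, field_eq_sum _ hf, Finset.sum_insert (by simp), Finset.sum_insert (by simp),
      Finset.sum_singleton]
    simp
  change prolong ζ (monomialOp k l f (coord (.u 0 0))) = monomialOp k l f ζ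
  rw [monomialOp_apply_u, Derivation.leibniz, h0, prolong_coord_u, monomialOp_apply]
  simp

theorem actOnU_mem {Q : Module.End ℝ DiffFun} (hQ : Q ∈ Upsilon) : actOnU Q ∈ linSymmetries := by
  obtain ⟨h1, h2, -⟩ := Upsilon_le_symOps hQ
  refine ⟨?_, isLinear_apply_u h1⟩
  change opF (Q (coord (.u 0 0))) = 0
  have h := LinearMap.congr_fun h2 (coord (.u 0 0))
  rw [adj_apply, LinearMap.sub_apply, Module.End.mul_apply, Module.End.mul_apply, opFEnd_apply,
    opFEnd_apply, opF_coord_u, map_zero, sub_zero] at h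
  exact h

theorem exists_actOnU_eq {v : EvField} (hv : v ∈ linSymmetries) :
    ∃ Q ∈ Upsilon, actOnU Q = v := by
  obtain ⟨h1, h2⟩ := hv
  obtain ⟨Q, hQ, hQv⟩ := exists_apply_u_eq h2
  refine ⟨Q, symOps_le_Upsilon ⟨hQ, ?_, by simp⟩, EvField.char_injective hQv⟩
  refine eq_zero_of_apply_u_eq_zero (adj_opFEnd_mem hQ) ?_
  rw [adj_apply, LinearMap.sub_apply, Module.End.mul_apply, Module.End.mul_apply, opFEnd_apply,
    opFEnd_apply, opF_coord_u, map_zero, sub_zero, hQv]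
  exact h1

/-- The correspondence `Q ↦ (Q u) ∂_u` between `Υ_𝔯` and `Λ`. -/
def upsilonEquiv : Upsilon ≃ₗ[ℝ] linSymmetries :=
  LinearEquiv.ofBijective
    { toFun := fun Q => ⟨actOnU (Q : Module.End ℝ DiffFun), actOnU_mem Q.2⟩
      map_add' := fun _ _ => rfl
      map_smul' := fun _ _ => rfl }
    ⟨(injective_iff_map_eq_zero _).2 fun Q h => Subtype.ext
        (eq_zero_of_apply_u_eq_zero (mem_diffOps_of_mem_Upsilon Q.2)
          (congrArg (fun v : linSymmetries => (v : EvField).char) h)),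
      fun v => by
        obtain ⟨Q, hQ, h⟩ := exists_actOnU_eq v.2
        exact ⟨⟨Q, hQ⟩, Subtype.ext h⟩⟩

/-- The Lie bracket of symmetries is minus the commutator of the operators. -/
theorem upsilonEquiv_lie (Q R : Upsilon) :
    ⁅upsilonEquiv Q, upsilonEquiv R⁆ = -upsilonEquiv (adj Q R) := by
  apply Subtype.ext
  apply EvField.char_injective
  change prolong (Q.1 (coord (.u 0 0))) (R.1 (coord (.u 0 0))) -
    prolong (R.1 (coord (.u 0 0))) (Q.1 (coord (.u 0 0))) =
      -(Q.1 (R.1 (coord (.u 0 0))) - R.1 (Q.1 (coord (.u 0 0))))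
  rw [prolong_apply_u (mem_diffOps_of_mem_Upsilon R.2),
    prolong_apply_u (mem_diffOps_of_mem_Upsilon Q.2), neg_sub]

theorem linSymmetries_eq_LambdaR : linSymmetries.toSubmodule = LambdaR := by
  apply le_antisymm
  · intro v hv
    obtain ⟨Q, hQ, rfl⟩ := exists_actOnU_eq hv
    let act : Module.End ℝ DiffFun →ₗ[ℝ] EvField :=
      { toFun := actOnU
        map_add' := fun _ _ => rfl
        map_smul' := fun _ _ => rfl }
    have h1 := Submodule.mem_map_of_mem (f := act) (isQuad_opP.adjoin_le_span hQ)
    rw [Submodule.map_span, ← Set.range_comp] at h1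
    simp only [Function.comp_def, ← mul_assoc] at h1
    exact h1
  · rw [LambdaR, Submodule.span_le]
    rintro _ ⟨i, rfl⟩
    refine actOnU_mem ?_
    have hP : ∀ P ∈ ({opP3, opP2, opP1, opP0} : Set (Module.End ℝ DiffFun)), P ∈ Upsilon :=
      fun P hP => Algebra.subset_adjoin hP
    exact Upsilon.mul_mem (Upsilon.mul_mem (Upsilon.mul_mem
      (Upsilon.pow_mem (hP _ (by simp)) _) (Upsilon.pow_mem (hP _ (by simp)) _))
      (Upsilon.pow_mem (hP _ (by simp)) _)) (Upsilon.pow_mem (hP _ (by simp)) _)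

/-! ### The Weyl algebra -/

/-- The generators `p_i` of the Weyl algebra. -/
def weylP (i : Fin 2) : Weyl 2 := RingQuot.mkAlgHom ℝ (WeylRel 2) (FreeAlgebra.ι ℝ (.p i))

/-- The generators `q_i` of the Weyl algebra. -/
def weylQ (i : Fin 2) : Weyl 2 := RingQuot.mkAlgHom ℝ (WeylRel 2) (FreeAlgebra.ι ℝ (.q i))

theorem adj_weylP_weylP (i j : Fin 2) : adj (weylP i) (weylP j) = 0 := by
  simpa [adj_apply, weylP] using RingQuot.mkAlgHom_rel ℝ (WeylRel.pp (n := 2) i j)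

theorem adj_weylQ_weylQ (i j : Fin 2) : adj (weylQ i) (weylQ j) = 0 := by
  simpa [adj_apply, weylQ] using RingQuot.mkAlgHom_rel ℝ (WeylRel.qq (n := 2) i j)

theorem adj_weylP_weylQ (i j : Fin 2) : adj (weylP i) (weylQ j) = if i = j then 1 else 0 := by
  have h := RingQuot.mkAlgHom_rel ℝ (WeylRel.pq (n := 2) i j)
  rw [map_sub, map_mul, map_mul] at h
  rw [adj_apply, weylP, weylQ, h]
  split_ifs <;> simp

theorem isQuad_weyl : IsQuad ((-3 : ℝ) • weylQ 1) (weylQ 0) (weylP 0) (weylP 1) where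
  ab := by rw [adj_swap, map_smul, adj_weylQ_weylQ, smul_zero, neg_zero]
  ac := by rw [adj_swap, map_smul, adj_weylP_weylQ]; simp
  ad := by rw [adj_swap, map_smul, adj_weylP_weylQ, Algebra.algebraMap_eq_smul_one]; simp
  bc := by rw [adj_swap, adj_weylP_weylQ]; simp
  bd := by rw [adj_swap, adj_weylP_weylQ]; simp
  cd := adj_weylP_weylP 0 1

theorem adjoin_weyl : Algebra.adjoin ℝ
    ({(-3 : ℝ) • weylQ 1, weylQ 0, weylP 0, weylP 1} : Set (Weyl 2)) = ⊤ := by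
  have h1 : (⊤ : Subalgebra ℝ (Weyl 2)) =
      (Algebra.adjoin ℝ (Set.range (FreeAlgebra.ι ℝ))).map (RingQuot.mkAlgHom ℝ (WeylRel 2)) := by
    rw [FreeAlgebra.adjoin_range_ι, Algebra.map_top, eq_comm, AlgHom.range_eq_top]
    exact RingQuot.mkAlgHom_surjective ℝ _
  rw [eq_top_iff, h1, AlgHom.map_adjoin]
  refine Algebra.adjoin_le ?_
  rintro _ ⟨_, ⟨g, rfl⟩, rfl⟩
  match g with
  | .p 0 => exact Algebra.subset_adjoin (by simp [weylP])
  | .p 1 => exact Algebra.subset_adjoin (by simp [weylP])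
  | .q 0 => exact Algebra.subset_adjoin (by simp [weylQ])
  | .q 1 =>
    have h : (-3 : ℝ) • weylQ 1 ∈ Algebra.adjoin ℝ
      ({(-3 : ℝ) • weylQ 1, weylQ 0, weylP 0, weylP 1} : Set (Weyl 2)) :=
      Algebra.subset_adjoin (by simp)
    have h' := Subalgebra.smul_mem _ h (-3 : ℝ)⁻¹
    rw [smul_smul, inv_mul_cancel₀ (by norm_num), one_smul] at h'
    exact h'

namespace IsQuad

variable {B : Type*} [Ring B] [Algebra ℝ B] {a b c d : B}

/-- The homomorphism from the Weyl algebra defined by a quadruple with the commutation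
relations of `P³, P², P¹, P⁰`. -/
def weylHom (h : IsQuad a b c d) : Weyl 2 →ₐ[ℝ] B :=
  RingQuot.liftAlgHom ℝ ⟨FreeAlgebra.lift ℝ fun
    | .p i => ![c, d] i
    | .q i => ![b, (-3 : ℝ)⁻¹ • a] i, by
    have h3 : (-3 : ℝ)⁻¹ • algebraMap ℝ B (-3) = 1 := by
      rw [Algebra.algebraMap_eq_smul_one, smul_smul, inv_mul_cancel₀ (by norm_num), one_smul]
    rintro _ _ (⟨i, j⟩ | ⟨i, j⟩ | ⟨i, j⟩)
    · rw [map_sub, map_mul, map_mul, ← adj_apply]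
      fin_cases i <;> fin_cases j <;> simp [adj_self, h.cd, h.dc]
    · rw [map_sub, map_mul, map_mul, ← adj_apply]
      fin_cases i <;> fin_cases j
      · simp [adj_self]
      · simp [h.ba]
      · simp [adj_swap _ b, h.ba]
      · simp [adj_apply]
    · rw [map_sub, map_mul, map_mul, ← adj_apply]
      fin_cases i <;> fin_cases j
      · simp [h.cb]
      · simp [h.ca]
      · simp [h.db]
      · simp only [FreeAlgebra.lift_ι_apply, Fin.mk_one, Matrix.cons_val_one, map_smul, h.da, h3,
          Matrix.cons_val_fin_one]
        simp⟩

variable (h : IsQuad a b c d)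

theorem weylHom_p (i : Fin 2) : h.weylHom (weylP i) = ![c, d] i := by
  rw [weylHom, weylP, RingQuot.liftAlgHom_mkAlgHom_apply, FreeAlgebra.lift_ι_apply]

theorem weylHom_q (i : Fin 2) : h.weylHom (weylQ i) = ![b, (-3 : ℝ)⁻¹ • a] i := by
  rw [weylHom, weylQ, RingQuot.liftAlgHom_mkAlgHom_apply, FreeAlgebra.lift_ι_apply]

theorem weylHom_a : h.weylHom ((-3 : ℝ) • weylQ 1) = a := by
  rw [map_smul, weylHom_q]
  simp [smul_smul]

theorem weylHom_surjective (hgen : Algebra.adjoin ℝ ({a, b, c, d} : Set B) = ⊤) :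
    Function.Surjective h.weylHom := by
  rw [← AlgHom.range_eq_top, eq_top_iff, ← hgen]
  refine Algebra.adjoin_le ?_
  simp only [Set.insert_subset_iff, Set.singleton_subset_iff]
  exact ⟨⟨_, h.weylHom_a⟩, ⟨weylQ 0, h.weylHom_q 0⟩, ⟨weylP 0, h.weylHom_p 0⟩,
    ⟨weylP 1, h.weylHom_p 1⟩⟩

/-- A nontrivial algebra generated by a quadruple with the commutation relations of
`P³, P², P¹, P⁰` is isomorphic to the Weyl algebra. -/
def weylEquiv [Nontrivial B] (hgen : Algebra.adjoin ℝ ({a, b, c, d} : Set B) = ⊤) :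
    Weyl 2 ≃ₐ[ℝ] B :=
  AlgEquiv.ofBijective h.weylHom
    ⟨isQuad_weyl.injective_of_adjoin_eq_top adjoin_weyl _, h.weylHom_surjective hgen⟩

include h in
/-- Changing the signs of `a` and `b` gives a quadruple in the opposite algebra. -/
theorem op : IsQuad (MulOpposite.op (-a)) (MulOpposite.op (-b)) (MulOpposite.op c)
    (MulOpposite.op d) := by
  have hop : ∀ x y : B, adj (MulOpposite.op x) (MulOpposite.op y) = MulOpposite.op (adj y x) := by
    intro x y
    simp [adj_apply]
  constructor <;> rw [hop] <;> simp only [map_neg, h.ca, h.da, h.cb, h.db, h.dc] <;>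
    simp [adj_swap (-b), h.ab, MulOpposite.algebraMap_apply]

theorem adjoin_op (hgen : Algebra.adjoin ℝ ({a, b, c, d} : Set B) = ⊤) :
    Algebra.adjoin ℝ ({MulOpposite.op (-a), MulOpposite.op (-b), MulOpposite.op c,
      MulOpposite.op d} : Set Bᵐᵒᵖ) = ⊤ := by
  have h1 : Algebra.adjoin ℝ (MulOpposite.unop ⁻¹' ({a, b, c, d} : Set B)) = ⊤ := by
    rw [← Subalgebra.op_adjoin, hgen, Subalgebra.op_top]
  rw [eq_top_iff, ← h1]
  refine Algebra.adjoin_le fun x hx => ?_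
  have mem : ∀ y ∈ ({MulOpposite.op (-a), MulOpposite.op (-b), MulOpposite.op c,
      MulOpposite.op d} : Set Bᵐᵒᵖ), y ∈ Algebra.adjoin ℝ ({MulOpposite.op (-a),
      MulOpposite.op (-b), MulOpposite.op c, MulOpposite.op d} : Set Bᵐᵒᵖ) :=
    fun y hy => Algebra.subset_adjoin hy
  simp only [Set.mem_preimage, Set.mem_insert_iff, Set.mem_singleton_iff] at hx
  rcases hx with hx | hx | hx | hx <;> rw [← MulOpposite.op_unop x, hx]
  · simpa using Subalgebra.neg_mem _ (mem (MulOpposite.op (-a)) (by simp))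
  · simpa using Subalgebra.neg_mem _ (mem (MulOpposite.op (-b)) (by simp))
  · exact mem _ (by simp)
  · exact mem _ (by simp)

end IsQuad

/-! ### The algebra `Υ_𝔯` -/

theorem opP_mem_Upsilon {P : Module.End ℝ DiffFun}
    (hP : P ∈ ({opP3, opP2, opP1, opP0} : Set (Module.End ℝ DiffFun))) : P ∈ Upsilon :=
  Algebra.subset_adjoin hP

/-- `P³` as an element of `Υ_𝔯`. -/
def uP3 : Upsilon := ⟨opP3, opP_mem_Upsilon (by simp)⟩

/-- `P²` as an element of `Υ_𝔯`. -/
def uP2 : Upsilon := ⟨opP2, opP_mem_Upsilon (by simp)⟩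

/-- `P¹` as an element of `Υ_𝔯`. -/
def uP1 : Upsilon := ⟨opP1, opP_mem_Upsilon (by simp)⟩

/-- `P⁰` as an element of `Υ_𝔯`. -/
def uP0 : Upsilon := ⟨opP0, opP_mem_Upsilon (by simp)⟩

theorem isQuad_uP : IsQuad uP3 uP2 uP1 uP0 where
  ab := Subtype.ext isQuad_opP.ab
  ac := Subtype.ext isQuad_opP.ac
  ad := Subtype.ext isQuad_opP.ad
  bc := Subtype.ext isQuad_opP.bc
  bd := Subtype.ext isQuad_opP.bd
  cd := Subtype.ext isQuad_opP.cd

theorem adjoin_uP : Algebra.adjoin ℝ ({uP3, uP2, uP1, uP0} : Set Upsilon) = ⊤ := by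
  have h : ({uP3, uP2, uP1, uP0} : Set Upsilon) =
      Subtype.val ⁻¹' ({opP3, opP2, opP1, opP0} : Set (Module.End ℝ DiffFun)) := by
    ext Q
    simp [uP3, uP2, uP1, uP0, Subtype.ext_iff]
  rw [h]
  exact Algebra.adjoin_adjoin_coe_preimage

instance : Nontrivial DiffFun :=
  ⟨0, 1, fun h => zero_ne_one (congrFun (congrArg Subtype.val h) fun _ => 0)⟩

/-- The center of `Υ_𝔯` consists of scalars. -/
theorem exists_eq_algebraMap_of_adj_uP {Q : Upsilon}
    (h : ∀ P ∈ ({uP3, uP2, uP1, uP0} : Set Upsilon), adj P Q = 0) :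
    ∃ r, Q = algebraMap ℝ Upsilon r := by
  obtain ⟨r, hr⟩ := exists_eq_algebraMap_of_mem_Upsilon Q.2 fun P hP => by
    simp only [Set.mem_insert_iff, Set.mem_singleton_iff] at hP
    rcases hP with rfl | rfl | rfl | rfl
    · exact congrArg Subtype.val (h uP3 (by simp))
    · exact congrArg Subtype.val (h uP2 (by simp))
    · exact congrArg Subtype.val (h uP1 (by simp))
    · exact congrArg Subtype.val (h uP0 (by simp))
  exact ⟨r, Subtype.ext hr⟩

/-! ### The enveloping algebra -/

theorem vf_32 : ⁅vfP3, vfP2⁆ = 0 := by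
  refine MvPolynomial.derivation_ext fun i => ?_
  fin_cases i <;> simp [Derivation.commutator_apply, mkDerivation_ofNat, vfP3, vfP2, polyVF,
    MvPolynomial.mkDerivation_X, Derivation.leibniz]
  all_goals ring

theorem vf_31 : ⁅vfP3, vfP1⁆ = 0 := by
  refine MvPolynomial.derivation_ext fun i => ?_
  fin_cases i <;> simp [Derivation.commutator_apply, mkDerivation_ofNat, vfP3, vfP1, polyVF,
    MvPolynomial.mkDerivation_X, Derivation.leibniz]

theorem vf_30 : ⁅vfP3, vfP0⁆ = (-3 : ℝ) • vfI := by
  refine MvPolynomial.derivation_ext fun i => ?_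
  fin_cases i <;> simp [Derivation.commutator_apply, mkDerivation_ofNat, vfP3, vfP0, vfI, polyVF,
    MvPolynomial.mkDerivation_X, Derivation.leibniz, Algebra.smul_def]
  rw [show (MvPolynomial.C 3 : MvPolynomial (Fin 4) ℝ) = 3 from map_ofNat _ 3]
  ring

theorem vf_21 : ⁅vfP2, vfP1⁆ = vfI := by
  refine MvPolynomial.derivation_ext fun i => ?_
  fin_cases i <;> simp [Derivation.commutator_apply, mkDerivation_ofNat, vfP2, vfP1, vfI, polyVF,
    MvPolynomial.mkDerivation_X, Derivation.leibniz]

theorem vf_20 : ⁅vfP2, vfP0⁆ = 0 := by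
  refine MvPolynomial.derivation_ext fun i => ?_
  fin_cases i <;> simp [Derivation.commutator_apply, mkDerivation_ofNat, vfP2, vfP0, polyVF,
    MvPolynomial.mkDerivation_X, Derivation.leibniz]

theorem vf_10 : ⁅vfP1, vfP0⁆ = 0 := by
  refine MvPolynomial.derivation_ext fun i => ?_
  fin_cases i <;> simp [Derivation.commutator_apply, vfP1, vfP0, polyVF,
    MvPolynomial.mkDerivation_X]

theorem vf_I {v : PolyVF} (hv : v ∈ ({vfP3, vfP2, vfP1, vfP0, vfI} : Set PolyVF)) :
    ⁅v, vfI⁆ = 0 := by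
  simp only [Set.mem_insert_iff, Set.mem_singleton_iff] at hv
  rcases hv with rfl | rfl | rfl | rfl | rfl <;> refine MvPolynomial.derivation_ext fun i => ?_ <;>
    fin_cases i <;> simp [Derivation.commutator_apply, mkDerivation_ofNat, vfP3, vfP2, vfP1, vfP0,
      vfI, polyVF, MvPolynomial.mkDerivation_X, Derivation.leibniz]

/-- The value at `v` of the coefficient of `∂_i`. -/
def evalCoeff (v : Fin 4 → ℝ) (i : Fin 4) : PolyVF →ₗ[ℝ] ℝ where
  toFun D := MvPolynomial.eval v (D (MvPolynomial.X i))
  map_add' D E := by simp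
  map_smul' r D := by simp

/-- A linear map that sends `𝒫ʲ` to `Pʲ` and `ℐ` to `-1`. The coefficients of a vector field
`c₃ 𝒫³ + c₂ 𝒫² + c₁ 𝒫¹ + c₀ 𝒫⁰ + c ℐ` are found from values of its components: its component
along `∂_x` is `3 c₃ t² + 2 c₂ t + c₁`, that along `∂_y` is `c₀` at the origin, and that along `∂_u`
is `c` at `t = x = y = 0`, `u = 1`. -/
def polyVFToUpsilon : PolyVF →ₗ[ℝ] Upsilon :=
  (6 : ℝ)⁻¹ • (evalCoeff ![1, 0, 0, 0] 1 + evalCoeff ![-1, 0, 0, 0] 1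
      - (2 : ℝ) • evalCoeff 0 1).smulRight uP3
    + (4 : ℝ)⁻¹ • (evalCoeff ![1, 0, 0, 0] 1 - evalCoeff ![-1, 0, 0, 0] 1).smulRight uP2
    + (evalCoeff 0 1).smulRight uP1 + (evalCoeff 0 2).smulRight uP0
    - (evalCoeff ![0, 0, 0, 1] 3).smulRight 1

theorem polyVFToUpsilon_vfP3 : polyVFToUpsilon vfP3 = uP3 := by
  simp [polyVFToUpsilon, evalCoeff, vfP3, polyVF, MvPolynomial.mkDerivation_X, smul_smul]
  norm_num

theorem polyVFToUpsilon_vfP2 : polyVFToUpsilon vfP2 = uP2 := by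
  simp [polyVFToUpsilon, evalCoeff, vfP2, polyVF, MvPolynomial.mkDerivation_X, smul_smul]
  norm_num

theorem polyVFToUpsilon_vfP1 : polyVFToUpsilon vfP1 = uP1 := by
  simp [polyVFToUpsilon, evalCoeff, vfP1, polyVF, MvPolynomial.mkDerivation_X]
  norm_num

theorem polyVFToUpsilon_vfP0 : polyVFToUpsilon vfP0 = uP0 := by
  simp [polyVFToUpsilon, evalCoeff, vfP0, polyVF, MvPolynomial.mkDerivation_X]

theorem polyVFToUpsilon_vfI : polyVFToUpsilon vfI = -1 := by
  simp [polyVFToUpsilon, evalCoeff, vfI, polyVF, MvPolynomial.mkDerivation_X]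

theorem polyVFToUpsilon_lie {v w : PolyVF} (hv : v ∈ radR) (hw : w ∈ radR) :
    polyVFToUpsilon ⁅v, w⁆ = adj (polyVFToUpsilon v) (polyVFToUpsilon w) := by
  have skew : ∀ v w : PolyVF, polyVFToUpsilon ⁅v, w⁆ =
      adj (polyVFToUpsilon v) (polyVFToUpsilon w) → polyVFToUpsilon ⁅w, v⁆ =
      adj (polyVFToUpsilon w) (polyVFToUpsilon v) := fun v w h => by
    rw [← lie_skew, map_neg, h, adj_swap, neg_neg]
  have self : ∀ v : PolyVF, polyVFToUpsilon ⁅v, v⁆ =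
      adj (polyVFToUpsilon v) (polyVFToUpsilon v) := fun v => by rw [lie_self, map_zero, adj_self]
  have hI : ∀ v ∈ ({vfP3, vfP2, vfP1, vfP0, vfI} : Set PolyVF), polyVFToUpsilon ⁅v, vfI⁆ =
      adj (polyVFToUpsilon v) (polyVFToUpsilon vfI) := fun v hv => by
    rw [vf_I hv, map_zero, polyVFToUpsilon_vfI, map_neg, adj_one, neg_zero]
  have h32 : polyVFToUpsilon ⁅vfP3, vfP2⁆ = adj (polyVFToUpsilon vfP3) (polyVFToUpsilon vfP2) := by
    rw [vf_32, map_zero, polyVFToUpsilon_vfP3, polyVFToUpsilon_vfP2, isQuad_uP.ab]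
  have h31 : polyVFToUpsilon ⁅vfP3, vfP1⁆ = adj (polyVFToUpsilon vfP3) (polyVFToUpsilon vfP1) := by
    rw [vf_31, map_zero, polyVFToUpsilon_vfP3, polyVFToUpsilon_vfP1, isQuad_uP.ac]
  have h30 : polyVFToUpsilon ⁅vfP3, vfP0⁆ = adj (polyVFToUpsilon vfP3) (polyVFToUpsilon vfP0) := by
    rw [vf_30, map_smul, polyVFToUpsilon_vfP3, polyVFToUpsilon_vfP0, isQuad_uP.ad,
      polyVFToUpsilon_vfI, Algebra.algebraMap_eq_smul_one]
    simp
  have h21 : polyVFToUpsilon ⁅vfP2, vfP1⁆ = adj (polyVFToUpsilon vfP2) (polyVFToUpsilon vfP1) := by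
    rw [vf_21, polyVFToUpsilon_vfP2, polyVFToUpsilon_vfP1, isQuad_uP.bc, polyVFToUpsilon_vfI]
    simp
  have h20 : polyVFToUpsilon ⁅vfP2, vfP0⁆ = adj (polyVFToUpsilon vfP2) (polyVFToUpsilon vfP0) := by
    rw [vf_20, map_zero, polyVFToUpsilon_vfP2, polyVFToUpsilon_vfP0, isQuad_uP.bd]
  have h10 : polyVFToUpsilon ⁅vfP1, vfP0⁆ = adj (polyVFToUpsilon vfP1) (polyVFToUpsilon vfP0) := by
    rw [vf_10, map_zero, polyVFToUpsilon_vfP1, polyVFToUpsilon_vfP0, isQuad_uP.cd]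
  refine Submodule.span_induction₂ (p := fun v w _ _ => polyVFToUpsilon ⁅v, w⁆ =
      adj (polyVFToUpsilon v) (polyVFToUpsilon w)) (fun v w hv hw => ?_)
    (fun w _ => ?_) (fun v _ => ?_) (fun v v' w _ _ _ h h' => ?_) (fun v w w' _ _ _ h h' => ?_)
    (fun r v w _ _ h => ?_) (fun r v w _ _ h => ?_) hv hw
  · have hv' := hI v hv
    have hw' := skew _ _ (hI w hw)
    simp only [Set.mem_insert_iff, Set.mem_singleton_iff] at hv hw
    rcases hv with rfl | rfl | rfl | rfl | rfl <;> rcases hw with rfl | rfl | rfl | rfl | rfl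
    exacts [self _, h32, h31, h30, hv', skew _ _ h32, self _, h21, h20, hv', skew _ _ h31,
      skew _ _ h21, self _, h10, hv', skew _ _ h30, skew _ _ h20, skew _ _ h10, self _, hv',
      hw', hw', hw', hw', hw']
  · rw [show ⁅(0 : PolyVF), w⁆ = 0 from zero_lie w, map_zero, adj_swap, map_zero, neg_zero]
  · rw [show ⁅v, (0 : PolyVF)⁆ = 0 from lie_zero v, map_zero, map_zero]
  · rw [show ⁅v + v', w⁆ = ⁅v, w⁆ + ⁅v', w⁆ from add_lie v v' w, map_add, h, h', map_add,
      adj_swap (_ + _), map_add, neg_add, ← adj_swap, ← adj_swap]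
  · rw [show ⁅v, w + w'⁆ = ⁅v, w⁆ + ⁅v, w'⁆ from lie_add v w w', map_add, h, h', map_add, map_add]
  · rw [show ⁅r • v, w⁆ = r • ⁅v, w⁆ from smul_lie r v w, map_smul, h, map_smul, adj_swap (_ • _),
      map_smul, ← smul_neg, ← adj_swap]
  · rw [show ⁅v, r • w⁆ = r • ⁅v, w⁆ from lie_smul r v w, map_smul, h, map_smul, map_smul]

/-- The representation of `𝔯` in `Υ_𝔯` that sends `𝒫ʲ` to `Pʲ` and `ℐ` to `-1`. -/
def radRToUpsilon : radR →ₗ⁅ℝ⁆ Upsilon where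
  toLinearMap := polyVFToUpsilon ∘ₗ radR.toSubmodule.subtype
  map_lie' {v w} := polyVFToUpsilon_lie v.2 w.2

/-- The homomorphism from `𝔘(𝔯)/(ι(ℐ) + 1)` to `Υ_𝔯` induced by `radRToUpsilon`. -/
def envQuotToUpsilon : EnvQuot →ₐ[ℝ] Upsilon :=
  RingQuot.liftAlgHom ℝ ⟨UniversalEnvelopingAlgebra.lift ℝ radRToUpsilon, by
    rintro _ _ ⟨⟩
    rw [map_add, UniversalEnvelopingAlgebra.lift_ι_apply, map_one, map_zero]
    have h : radRToUpsilon rI = -1 := polyVFToUpsilon_vfI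
    rw [h, neg_add_cancel]⟩

instance : Nontrivial EnvQuot := envQuotToUpsilon.toRingHom.domain_nontrivial

instance : LieRing (UniversalEnvelopingAlgebra ℝ radR) := LieRing.ofAssociativeRing

/-- `toEnvQuot` as a linear map. -/
def toEnvQuotLinear : radR →ₗ[ℝ] EnvQuot :=
  (RingQuot.mkAlgHom ℝ EnvRel).toLinearMap ∘ₗ
    (UniversalEnvelopingAlgebra.ι ℝ : radR →ₗ⁅ℝ⁆ _).toLinearMap

theorem toEnvQuotLinear_apply (v : radR) : toEnvQuotLinear v = toEnvQuot v := rfl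

theorem adj_toEnvQuot (v w : radR) : adj (toEnvQuot v) (toEnvQuot w) = toEnvQuot ⁅v, w⁆ := by
  rw [adj_apply, toEnvQuot, toEnvQuot, toEnvQuot, LieHom.map_lie,
    ← map_mul (RingQuot.mkAlgHom ℝ EnvRel), ← map_mul (RingQuot.mkAlgHom ℝ EnvRel), ← map_sub]
  rfl

theorem toEnvQuot_rI : toEnvQuot rI = -1 := by
  have h := RingQuot.mkAlgHom_rel ℝ EnvRel.rel
  rw [map_add, map_one, map_zero] at h
  exact eq_neg_of_add_eq_zero_left h

theorem toEnvQuot_zero : toEnvQuot 0 = 0 := map_zero toEnvQuotLinear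

theorem isQuad_toEnvQuot :
    IsQuad (toEnvQuot rP3) (toEnvQuot rP2) (toEnvQuot rP1) (toEnvQuot rP0) := by
  constructor <;> rw [adj_toEnvQuot]
  · rw [show ⁅rP3, rP2⁆ = 0 from Subtype.ext vf_32, toEnvQuot_zero]
  · rw [show ⁅rP3, rP1⁆ = 0 from Subtype.ext vf_31, toEnvQuot_zero]
  · rw [show ⁅rP3, rP0⁆ = (-3 : ℝ) • rI from Subtype.ext vf_30, ← toEnvQuotLinear_apply, map_smul,
      toEnvQuotLinear_apply, toEnvQuot_rI, Algebra.algebraMap_eq_smul_one]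
    simp
  · rw [show ⁅rP2, rP1⁆ = rI from Subtype.ext vf_21, toEnvQuot_rI, map_neg, map_one]
  · rw [show ⁅rP2, rP0⁆ = 0 from Subtype.ext vf_20, toEnvQuot_zero]
  · rw [show ⁅rP1, rP0⁆ = 0 from Subtype.ext vf_10, toEnvQuot_zero]

theorem toEnvQuot_mem_adjoin (v : radR) : toEnvQuot v ∈ Algebra.adjoin ℝ
    ({toEnvQuot rP3, toEnvQuot rP2, toEnvQuot rP1, toEnvQuot rP0} : Set EnvQuot) := by
  set S := Algebra.adjoin ℝ
    ({toEnvQuot rP3, toEnvQuot rP2, toEnvQuot rP1, toEnvQuot rP0} : Set EnvQuot)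
  have h : radR.toSubmodule ≤
      (S.toSubmodule.comap toEnvQuotLinear).map radR.toSubmodule.subtype := by
    refine Submodule.span_le.2 ?_
    have hI : toEnvQuot rI ∈ S := by
      rw [toEnvQuot_rI]
      exact S.neg_mem S.one_mem
    simp only [Set.insert_subset_iff, Set.singleton_subset_iff]
    exact ⟨⟨rP3, Algebra.subset_adjoin (by simp [toEnvQuotLinear_apply]), rfl⟩,
      ⟨rP2, Algebra.subset_adjoin (by simp [toEnvQuotLinear_apply]), rfl⟩,
      ⟨rP1, Algebra.subset_adjoin (by simp [toEnvQuotLinear_apply]), rfl⟩,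
      ⟨rP0, Algebra.subset_adjoin (by simp [toEnvQuotLinear_apply]), rfl⟩, ⟨rI, hI, rfl⟩⟩
  obtain ⟨w, hw, hwv⟩ := h v.2
  have hw : toEnvQuot w ∈ S := hw
  rwa [show w = v from Subtype.ext hwv] at hw

theorem adjoin_toEnvQuot : Algebra.adjoin ℝ
    ({toEnvQuot rP3, toEnvQuot rP2, toEnvQuot rP1, toEnvQuot rP0} : Set EnvQuot) = ⊤ := by
  set S := Algebra.adjoin ℝ
    ({toEnvQuot rP3, toEnvQuot rP2, toEnvQuot rP1, toEnvQuot rP0} : Set EnvQuot)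
  have hmem : ∀ v : radR, toEnvQuot v ∈ S := toEnvQuot_mem_adjoin
  have hsurj : Function.Surjective (UniversalEnvelopingAlgebra.mkAlgHom ℝ radR) :=
    RingCon.mkₐ_surjective _
  refine Algebra.eq_top_iff.2 fun x => ?_
  obtain ⟨x, rfl⟩ := RingQuot.mkAlgHom_surjective ℝ EnvRel x
  obtain ⟨x, rfl⟩ := hsurj x
  induction x using TensorAlgebra.induction with
  | algebraMap r => rw [AlgHom.commutes, AlgHom.commutes]; exact S.algebraMap_mem r
  | ι v => exact hmem v
  | mul x y hx hy => rw [map_mul, map_mul]; exact S.mul_mem hx hy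
  | add x y hx hy => rw [map_add, map_add]; exact S.add_mem hx hy

/-! ### The Lie algebra of linear generalized symmetries -/

/-- Since `Bᵐᵒᵖ` is also generated by a quadruple with the same relations, `Υ_𝔯` is isomorphic to
`Bᵐᵒᵖ`, that is, anti-isomorphic to `B`. The composition with the anti-isomorphism from `Λ` to
`Υ_𝔯` is an isomorphism from `Λ` onto the commutator algebra of `B`. -/
theorem exists_linearEquiv_lie {B : Type*} [Ring B] [Algebra ℝ B] [Nontrivial B] {a b c d : B}
    (h : IsQuad a b c d) (hgen : Algebra.adjoin ℝ ({a, b, c, d} : Set B) = ⊤) :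
    ∃ e : linSymmetries ≃ₗ[ℝ] B, ∀ v w, e ⁅v, w⁆ = e v * e w - e w * e v := by
  let θ : Upsilon ≃ₐ[ℝ] Bᵐᵒᵖ :=
    (isQuad_uP.weylEquiv adjoin_uP).symm.trans (h.op.weylEquiv (IsQuad.adjoin_op hgen))
  refine ⟨upsilonEquiv.symm.trans (θ.toLinearEquiv.trans (MulOpposite.opLinearEquiv ℝ).symm),
    fun v w => ?_⟩
  obtain ⟨Q, rfl⟩ := upsilonEquiv.surjective v
  obtain ⟨R, rfl⟩ := upsilonEquiv.surjective w
  rw [upsilonEquiv_lie, ← map_neg, adj_apply]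
  simp

theorem mem_center_iff {v : linSymmetries} : v ∈ LieAlgebra.center ℝ linSymmetries ↔
    ∃ r : ℝ, v = r • upsilonEquiv 1 := by
  obtain ⟨Q, rfl⟩ := upsilonEquiv.surjective v
  rw [LieModule.mem_maxTrivSubmodule]
  constructor
  · intro h
    obtain ⟨r, hr⟩ := exists_eq_algebraMap_of_adj_uP (Q := Q) fun P _ => by
      have h1 := h (upsilonEquiv P)
      rw [upsilonEquiv_lie, neg_eq_zero] at h1
      exact upsilonEquiv.map_eq_zero_iff.1 h1
    exact ⟨r, by rw [hr, Algebra.algebraMap_eq_smul_one, map_smul]⟩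
  · rintro ⟨r, hr⟩ w
    obtain ⟨R, rfl⟩ := upsilonEquiv.surjective w
    rw [hr, lie_smul, upsilonEquiv_lie, adj_one, map_zero, neg_zero, smul_zero]

/-- A Lie ideal of `Λ` that contains a noncentral element is the whole of `Λ`. -/
theorem eq_top_of_notMem_center {J : LieIdeal ℝ linSymmetries} {v : linSymmetries} (hv : v ∈ J)
    (hv' : v ∉ LieAlgebra.center ℝ linSymmetries) : J = ⊤ := by
  have hK := isQuad_uP.lieIdeal_eq_top adjoin_uP (fun z hz => exists_eq_algebraMap_of_adj_uP hz)
    (K := J.toSubmodule.comap upsilonEquiv.toLinearMap)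
    (fun Q hQ R => by
      have h1 : ⁅upsilonEquiv Q, upsilonEquiv R⁆ ∈ J := lie_mem_left ℝ _ J _ _ hQ
      rw [upsilonEquiv_lie, ← map_neg, ← adj_swap] at h1
      exact h1)
    (z := upsilonEquiv.symm v) (by simpa using hv)
    (fun r hr => hv' (mem_center_iff.2 ⟨r, by
      rw [← map_smul, ← Algebra.algebraMap_eq_smul_one, ← hr, LinearEquiv.apply_symm_apply]⟩))
  refine eq_top_iff.2 fun w _ => ?_
  have h1 : upsilonEquiv.symm w ∈ J.toSubmodule.comap upsilonEquiv.toLinearMap := hK ▸ trivial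
  simpa using h1

theorem isSimple_quotient_center :
    LieAlgebra.IsSimple ℝ (linSymmetries ⧸ LieAlgebra.center ℝ linSymmetries) where
  eq_bot_or_eq_top I := by
    let π : linSymmetries →ₗ⁅ℝ⁆ linSymmetries ⧸ LieAlgebra.center ℝ linSymmetries :=
      { (LieAlgebra.center ℝ linSymmetries).toSubmodule.mkQ with
        map_lie' := fun {_ _} => rfl }
    have hπ : Function.Surjective π := Submodule.Quotient.mk_surjective _
    by_cases h : ∃ v, π v ∈ I ∧ v ∉ LieAlgebra.center ℝ linSymmetries
    · right
      obtain ⟨v, hv, hv'⟩ := h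
      have hJ := eq_top_of_notMem_center (J := I.comap π) (LieIdeal.mem_comap.2 hv) hv'
      refine eq_top_iff.2 fun x _ => ?_
      obtain ⟨w, rfl⟩ := hπ x
      have : w ∈ I.comap π := hJ ▸ trivial
      exact LieIdeal.mem_comap.1 this
    · left
      push Not at h
      refine eq_bot_iff.2 fun x hx => ?_
      obtain ⟨w, rfl⟩ := hπ x
      exact (LieSubmodule.Quotient.mk_eq_zero').2 (h w hx)
  non_abelian h := by
    -- `[P¹ P¹, P²]` is a nonzero multiple of `P¹`, which is not central.
    have h1 : ⁅upsilonEquiv (uP1 * uP1), upsilonEquiv uP2⁆ ∈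
        LieAlgebra.center ℝ linSymmetries := by
      rw [← LieSubmodule.Quotient.mk_eq_zero', LieSubmodule.Quotient.mk_bracket]
      exact h.trivial _ _
    have h2 := (LieModule.mem_maxTrivSubmodule _ _ _ _).1 h1 (upsilonEquiv uP2)
    rw [upsilonEquiv_lie, adj_mul_left, isQuad_uP.cb, map_one, mul_one, one_mul,
      lie_neg, upsilonEquiv_lie, neg_neg, map_add, isQuad_uP.bc,
      upsilonEquiv.map_eq_zero_iff, ← map_add, map_eq_zero_iff _ (algebraMap ℝ Upsilon).injective]
      at h2
    norm_num at h2

end Kolmogorov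

end

theorem mainTheorem3 :
    -- The linear generalized symmetries are generated by the operators from `Υ_𝔯`.
    Kolmogorov.linSymmetries.toSubmodule = Kolmogorov.LambdaR ∧
    -- The map `(Q u) ∂_u ↦ Q` is an anti-isomorphism from `Λ` onto the commutator algebra of `Υ_𝔯`.
    (∃ φ : Kolmogorov.linSymmetries ≃ₗ[ℝ] Kolmogorov.Upsilon,
      (∀ Q : Kolmogorov.Upsilon, (φ.symm Q : Kolmogorov.EvField) =
        Kolmogorov.actOnU (Q : Module.End ℝ Kolmogorov.DiffFun)) ∧
      ∀ a b : Kolmogorov.linSymmetries, φ ⁅a, b⁆ = -⁅φ a, φ b⁆) ∧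
    -- `Υ_𝔯` is isomorphic to `𝔘(𝔯)/(ι(ℐ) + 1)` as a unital associative algebra.
    (∃ ψ : Kolmogorov.EnvQuot ≃ₐ[ℝ] Kolmogorov.Upsilon,
      (ψ (Kolmogorov.toEnvQuot Kolmogorov.rP3) : Module.End ℝ Kolmogorov.DiffFun) =
        Kolmogorov.opP3 ∧
      (ψ (Kolmogorov.toEnvQuot Kolmogorov.rP2) : Module.End ℝ Kolmogorov.DiffFun) =
        Kolmogorov.opP2 ∧
      (ψ (Kolmogorov.toEnvQuot Kolmogorov.rP1) : Module.End ℝ Kolmogorov.DiffFun) =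
        Kolmogorov.opP1 ∧
      (ψ (Kolmogorov.toEnvQuot Kolmogorov.rP0) : Module.End ℝ Kolmogorov.DiffFun) =
        Kolmogorov.opP0) ∧
    -- `Λ` is anti-isomorphic, and also isomorphic, to the commutator algebra of `𝔘(𝔯)/(ι(ℐ) + 1)`.
    (∃ χ : Kolmogorov.linSymmetries ≃ₗ[ℝ] Kolmogorov.EnvQuot,
      ∀ a b : Kolmogorov.linSymmetries, χ ⁅a, b⁆ = -⁅χ a, χ b⁆) ∧
    Nonempty (Kolmogorov.linSymmetries ≃ₗ⁅ℝ⁆ Kolmogorov.EnvQuot) ∧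
    -- `Λ` is isomorphic to the commutator algebra of the second Weyl algebra.
    Nonempty (Kolmogorov.linSymmetries ≃ₗ⁅ℝ⁆ Kolmogorov.Weyl 2) ∧
    -- The center of `Λ` is one-dimensional and spanned by `u ∂_u`, and the quotient is simple.
    (∃ hu : Kolmogorov.uField ∈ Kolmogorov.linSymmetries,
      (LieAlgebra.center ℝ Kolmogorov.linSymmetries).toSubmodule =
        Submodule.span ℝ {(⟨Kolmogorov.uField, hu⟩ : Kolmogorov.linSymmetries)}) ∧
    Module.finrank ℝ (LieAlgebra.center ℝ Kolmogorov.linSymmetries) = 1 ∧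
    LieAlgebra.IsSimple ℝ
      (Kolmogorov.linSymmetries ⧸ LieAlgebra.center ℝ Kolmogorov.linSymmetries) := by
  open Kolmogorov in
  -- The Weyl algebra is nontrivial because it maps to `Υ_𝔯`.
  have hW : Nontrivial (Weyl 2) := isQuad_uP.weylHom.toRingHom.domain_nontrivial
  let ψ : EnvQuot ≃ₐ[ℝ] Upsilon :=
    (isQuad_toEnvQuot.weylEquiv adjoin_toEnvQuot).symm.trans (isQuad_uP.weylEquiv adjoin_uP)
  have hψ : ∀ (x : EnvQuot) (y : Upsilon) (z : Weyl 2), isQuad_toEnvQuot.weylHom z = x →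
      isQuad_uP.weylHom z = y → ψ x = y := by
    rintro x y z rfl rfl
    change isQuad_uP.weylEquiv adjoin_uP ((isQuad_toEnvQuot.weylEquiv adjoin_toEnvQuot).symm
      (isQuad_toEnvQuot.weylEquiv adjoin_toEnvQuot z)) = _
    rw [AlgEquiv.symm_apply_apply]
    rfl
  have hφ : ∀ a b : linSymmetries,
      upsilonEquiv.symm ⁅a, b⁆ = -⁅upsilonEquiv.symm a, upsilonEquiv.symm b⁆ := by
    intro a b
    obtain ⟨Q, rfl⟩ := upsilonEquiv.surjective a
    obtain ⟨R, rfl⟩ := upsilonEquiv.surjective b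
    rw [upsilonEquiv_lie, map_neg]
    simp only [LinearEquiv.symm_apply_apply]
    rfl
  have hcenter : (LieAlgebra.center ℝ linSymmetries).toSubmodule =
      Submodule.span ℝ {upsilonEquiv 1} := by
    ext v
    rw [LieSubmodule.mem_toSubmodule, mem_center_iff, Submodule.mem_span_singleton]
    exact exists_congr fun r => eq_comm
  refine ⟨linSymmetries_eq_LambdaR, ⟨upsilonEquiv.symm, fun Q => rfl, hφ⟩, ⟨ψ, ?_, ?_, ?_, ?_⟩,
    ⟨upsilonEquiv.symm.trans ψ.symm.toLinearEquiv, fun a b => ?_⟩, ?_, ?_,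
    ⟨(upsilonEquiv 1).2, hcenter⟩, ?_, isSimple_quotient_center⟩
  · exact congrArg Subtype.val (hψ _ uP3 _ isQuad_toEnvQuot.weylHom_a isQuad_uP.weylHom_a)
  · exact congrArg Subtype.val
      (hψ _ uP2 (weylQ 0) (isQuad_toEnvQuot.weylHom_q 0) (isQuad_uP.weylHom_q 0))
  · exact congrArg Subtype.val
      (hψ _ uP1 (weylP 0) (isQuad_toEnvQuot.weylHom_p 0) (isQuad_uP.weylHom_p 0))
  · exact congrArg Subtype.val
      (hψ _ uP0 (weylP 1) (isQuad_toEnvQuot.weylHom_p 1) (isQuad_uP.weylHom_p 1))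
  · change ψ.symm (upsilonEquiv.symm ⁅a, b⁆) = _
    rw [hφ, map_neg]
    exact congrArg Neg.neg ((map_sub ψ.symm _ _).trans
      (congrArg₂ _ (map_mul ψ.symm _ _) (map_mul ψ.symm _ _)))
  · obtain ⟨e, he⟩ := exists_linearEquiv_lie isQuad_toEnvQuot adjoin_toEnvQuot
    exact ⟨{ e with map_lie' := fun {v w} => he v w }⟩
  · obtain ⟨e, he⟩ := exists_linearEquiv_lie isQuad_weyl adjoin_weyl
    exact ⟨{ e with map_lie' := fun {v w} => he v w }⟩
  · change Module.finrank ℝ (LieAlgebra.center ℝ linSymmetries).toSubmodule = 1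
    rw [hcenter]
    exact finrank_span_singleton (upsilonEquiv.map_ne_zero_iff.2 one_ne_zero)
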